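/- **Theorem (Companions as a biadjoint).** A *double category* is a pseudo double category: objects and arrows form a category, proarrows $m : x ⇸ y$ and cells form a category, and external composition $\odot$ of proarrows and cells is associative and unital up to coherent globular isomorphism; it is *strict* if these isomorphisms are identities. A *companion* of an arrow $f : x \to y$ is a proarrow $f_! : x ⇸ y$ with a unit cell $\eta$ (top $\mathrm{id}_x$, bottom $f_!$, left side $1_x$, right side $f$) and a counit cell $\varepsilon$ (top $f_!$, bottom $\mathrm{id}_y$, left side $f$, right side $1_y$) whose vertical composite is the external identity $\mathrm{id}_f$ and whose external composite is, up to the unitors, the identity cell $1_{f_!}$. * Let $\mathbf{Dbl}$ be the 2-category of double categories, (pseudo) double functors, and natural transformations. * Let $\mathbf{StrDbl}_{!,\mathrm{pro}}$ be the 2-category whose objects are strict double categories with a functorial choice of companions (each arrow has a chosen companion; the chosen companion of an identity arrow is the external identity, and that of a composite is the composite of the chosen companions, binding cells included); whose morphisms are the strict double functors preserving the chosen companions with their binding cells; and whose 2-morphisms $\tau : F \Rightarrow G$ are strict protransformations, having a proarrow $\tau_x : Fx ⇸ Gx$ for each object $x$ and a cell $\tau_f$ with top $\tau_x$, bottom $\tau_y$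 and sides $Ff$, $Gf$ for each arrow $f : x \to y$, functorially in $f$ and strictly naturally with respect to proarrows and cells. * Let $(-)^\top : \mathbf{StrDbl}_{!,\mathrm{pro}} \to \mathbf{Dbl}$ be the transposition 2-functor, which exchanges arrows and proarrows. * Let $\mathrm{Comp} : \mathbf{Dbl} \to \mathbf{StrDbl}_{!,\mathrm{pro}}$ be the 2-functor sending a double category $\mathbb{D}$ to the strict double category with the objects of $\mathbb{D}$; with arrows the arrows of $\mathbb{D}$ that have a companion; with proarrows all arrows of $\mathbb{D}$; and with cells having top $h : x \to y$, left side $f : x \to w$, right side $g : y \to z$ and bottom $k : w \to z$ the cells of $\mathbb{D}$ from $\mathrm{id}_x$ to $\mathrm{id}_z$ with left side $g h$ and right side $k f$, composed by pasting. The chosen companion in $\mathrm{Comp}\,\mathbb{D}$ of an arrow $f$ is $f$ itself, with external identities as binding cells. A double functor acts through its underlying 2-functor. A natural transformation $\alpha : F \Rightarrow G$ is sent to the strict protransformation with components $\alpha_x$ at objects $x$ and, at arrows $f : x \to y$ having a companion, the external identity cell of the naturality square $Gf \circ \alpha_x = \alpha_y \circ Ff$. Then there is a biadjunction $$(-)^\top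 \dashv \mathrm{Comp} : \mathbf{StrDbl}_{!,\mathrm{pro}} \rightleftarrows \mathbf{Dbl},$$ that is, pseudonatural transformations $1 \Rightarrow \mathrm{Comp}\circ(-)^\top$ (the unit) and $(-)^\top\circ\mathrm{Comp} \Rightarrow 1$ (the counit), together with invertible modifications filling the two triangle identities and satisfying the two swallowtail identities. Moreover, for any choice, for every arrow $h$ having a companion in a double category $\mathbb{D}$, of a companion $h_!$ in $\mathbb{D}$, the biadjunction can be taken such that the component of the counit at each double category $\mathbb{D}$ is a double functor $$(\mathrm{Comp}\,\mathbb{D})^\top \to \mathbb{D}$$ that is the identity on objects and arrows and sends each proarrow $h$ of $(\mathrm{Comp}\,\mathbb{D})^\top$, i.e. each arrow $h$ of $\mathbb{D}$ that has a companion, to the chosen companion $h_!$. -/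

import Mathlib

open CategoryTheory

universe u v

noncomputable section

/-- The type of all proarrows of a family `P` of proarrows indexed by source and target. -/
structure ProArr {O : Type u} (P : O → O → Type v) : Type (max u v) where
  {src tgt : O}
  pro : P src tgt

/-- A (pseudo) double category: a pseudocategory internal to `Cat`.  Objects and arrows form a
category, proarrows and cells form a category (with composition of cells along proarrows), `left`
and `right` are the source and target functors.  A cell `α : .mk m ⟶ .mk n` has top `m`,
bottom `n`, left side `left α` and right side `right α`.  External composition `hcomp` is defined
for cells sharing a side, and is associative and unital up to coherent globular isomorphism. -/
structure DblCat : Type (max (u + 1) (v + 1)) where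
  Obj : Type u
  [cat : Category.{v} Obj]
  Pro : Obj → Obj → Type v
  [cells : Category.{v} (ProArr Pro)]
  left {X Y : ProArr Pro} : (X ⟶ Y) → (X.src ⟶ Y.src)
  right {X Y : ProArr Pro} : (X ⟶ Y) → (X.tgt ⟶ Y.tgt)
  left_id (X : ProArr Pro) : left (𝟙 X) = 𝟙 X.src
  right_id (X : ProArr Pro) : right (𝟙 X) = 𝟙 X.tgt
  left_comp {X Y Z : ProArr Pro} (α : X ⟶ Y) (β : Y ⟶ Z) : left (α ≫ β) = left α ≫ left β
  right_comp {X Y Z : ProArr Pro} (α : X ⟶ Y) (β : Y ⟶ Z) : right (α ≫ β) = right α ≫ right β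
  /-- the external identity proarrow -/
  unit (a : Obj) : Pro a a
  /-- the external identity cell on an arrow -/
  unitCell {a b : Obj} (f : a ⟶ b) : ProArr.mk (unit a) ⟶ ProArr.mk (unit b)
  left_unitCell {a b : Obj} (f : a ⟶ b) : left (unitCell f) = f
  right_unitCell {a b : Obj} (f : a ⟶ b) : right (unitCell f) = f
  unitCell_id (a : Obj) : unitCell (𝟙 a) = 𝟙 (ProArr.mk (unit a))
  unitCell_comp {a b c : Obj} (f : a ⟶ b) (g : b ⟶ c) :
    unitCell (f ≫ g) = unitCell f ≫ unitCell g
  /-- external composition of proarrows, in diagrammatic order -/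
  pcomp {a b c : Obj} : Pro a b → Pro b c → Pro a c
  /-- external composition of cells, in diagrammatic order -/
  hcomp {a b c a' b' c' : Obj} {m : Pro a b} {n : Pro b c} {m' : Pro a' b'} {n' : Pro b' c'}
    (α : ProArr.mk m ⟶ ProArr.mk m') (β : ProArr.mk n ⟶ ProArr.mk n')
    (h : right α = left β) : ProArr.mk (pcomp m n) ⟶ ProArr.mk (pcomp m' n')
  left_hcomp {a b c a' b' c' : Obj} {m : Pro a b} {n : Pro b c} {m' : Pro a' b'} {n' : Pro b' c'}
    (α : ProArr.mk m ⟶ ProArr.mk m') (β : ProArr.mk n ⟶ ProArr.mk n')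
    (h : right α = left β) : left (hcomp α β h) = left α
  right_hcomp {a b c a' b' c' : Obj} {m : Pro a b} {n : Pro b c} {m' : Pro a' b'} {n' : Pro b' c'}
    (α : ProArr.mk m ⟶ ProArr.mk m') (β : ProArr.mk n ⟶ ProArr.mk n')
    (h : right α = left β) : right (hcomp α β h) = right β
  hcomp_id {a b c : Obj} (m : Pro a b) (n : Pro b c) :
    hcomp (𝟙 (ProArr.mk m)) (𝟙 (ProArr.mk n)) ((right_id (ProArr.mk m)).trans (left_id (ProArr.mk n)).symm) = 𝟙 _
  hcomp_comp {a b c a' b' c' a'' b'' c'' : Obj} {m : Pro a b} {n : Pro b c}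
    {m' : Pro a' b'} {n' : Pro b' c'} {m'' : Pro a'' b''} {n'' : Pro b'' c''}
    (α : ProArr.mk m ⟶ ProArr.mk m') (β : ProArr.mk n ⟶ ProArr.mk n')
    (α' : ProArr.mk m' ⟶ ProArr.mk m'') (β' : ProArr.mk n' ⟶ ProArr.mk n'')
    (h : right α = left β) (h' : right α' = left β') :
    hcomp (α ≫ α') (β ≫ β') (by rw [right_comp, left_comp, h, h']) =
      hcomp α β h ≫ hcomp α' β' h'
  assoc {a b c d : Obj} (m : Pro a b) (n : Pro b c) (p : Pro c d) :
    ProArr.mk (pcomp (pcomp m n) p) ≅ ProArr.mk (pcomp m (pcomp n p))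
  left_assoc {a b c d : Obj} (m : Pro a b) (n : Pro b c) (p : Pro c d) :
    left (assoc m n p).hom = 𝟙 a
  right_assoc {a b c d : Obj} (m : Pro a b) (n : Pro b c) (p : Pro c d) :
    right (assoc m n p).hom = 𝟙 d
  assoc_naturality {a b c d a' b' c' d' : Obj} {m : Pro a b} {n : Pro b c} {p : Pro c d}
    {m' : Pro a' b'} {n' : Pro b' c'} {p' : Pro c' d'}
    (α : ProArr.mk m ⟶ ProArr.mk m') (β : ProArr.mk n ⟶ ProArr.mk n')
    (γ : ProArr.mk p ⟶ ProArr.mk p') (h : right α = left β) (h' : right β = left γ) :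
    hcomp (hcomp α β h) γ ((right_hcomp α β h).trans h') ≫ (assoc m' n' p').hom =
      (assoc m n p).hom ≫ hcomp α (hcomp β γ h') (h.trans (left_hcomp β γ h').symm)
  lunit {a b : Obj} (m : Pro a b) : ProArr.mk (pcomp (unit a) m) ≅ ProArr.mk m
  left_lunit {a b : Obj} (m : Pro a b) : left (lunit m).hom = 𝟙 a
  right_lunit {a b : Obj} (m : Pro a b) : right (lunit m).hom = 𝟙 b
  lunit_naturality {a b a' b' : Obj} {m : Pro a b} {m' : Pro a' b'}
    (α : ProArr.mk m ⟶ ProArr.mk m') :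
    hcomp (unitCell (left α)) α (right_unitCell _) ≫ (lunit m').hom = (lunit m).hom ≫ α
  runit {a b : Obj} (m : Pro a b) : ProArr.mk (pcomp m (unit b)) ≅ ProArr.mk m
  left_runit {a b : Obj} (m : Pro a b) : left (runit m).hom = 𝟙 a
  right_runit {a b : Obj} (m : Pro a b) : right (runit m).hom = 𝟙 b
  runit_naturality {a b a' b' : Obj} {m : Pro a b} {m' : Pro a' b'}
    (α : ProArr.mk m ⟶ ProArr.mk m') :
    hcomp α (unitCell (right α)) (left_unitCell _).symm ≫ (runit m').hom = (runit m).hom ≫ α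
  pentagon {a b c d e : Obj} (m : Pro a b) (n : Pro b c) (p : Pro c d) (q : Pro d e) :
    hcomp (assoc m n p).hom (𝟙 (ProArr.mk q)) ((right_assoc m n p).trans (left_id (ProArr.mk q)).symm) ≫
        (assoc m (pcomp n p) q).hom ≫
        hcomp (𝟙 (ProArr.mk m)) (assoc n p q).hom ((right_id (ProArr.mk m)).trans (left_assoc n p q).symm) =
      (assoc (pcomp m n) p q).hom ≫ (assoc m n (pcomp p q)).hom
  triangle {a b c : Obj} (m : Pro a b) (n : Pro b c) :
    (assoc m (unit b) n).hom ≫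
        hcomp (𝟙 (ProArr.mk m)) (lunit n).hom ((right_id (ProArr.mk m)).trans (left_lunit n).symm) =
      hcomp (runit m).hom (𝟙 (ProArr.mk n)) ((right_runit m).trans (left_id (ProArr.mk n)).symm)

namespace DblCat

attribute [instance] DblCat.cat DblCat.cells

attribute [simp] left_id right_id left_comp right_comp left_unitCell right_unitCell
  left_hcomp right_hcomp left_assoc right_assoc left_lunit right_lunit left_runit right_runit
  hcomp_id

/-- Cells with given top and bottom proarrows. -/
abbrev Cell (D : DblCat.{u, v}) {a b c d : D.Obj} (m : D.Pro a b) (n : D.Pro c d) : Type v :=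
  (ProArr.mk m : ProArr D.Pro) ⟶ ProArr.mk n

section basic

variable (D : DblCat.{u, v})

theorem left_inv {a b : D.Obj} {m n : D.Pro a b} (e : ProArr.mk m ≅ ProArr.mk n)
    (h : D.left e.hom = 𝟙 a) : D.left e.inv = 𝟙 a := by
  have := D.left_comp e.hom e.inv
  simpa [h] using this.symm

theorem right_inv {a b : D.Obj} {m n : D.Pro a b} (e : ProArr.mk m ≅ ProArr.mk n)
    (h : D.right e.hom = 𝟙 b) : D.right e.inv = 𝟙 b := by
  have := D.right_comp e.hom e.inv
  simpa [h] using this.symm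

@[simp] theorem left_assoc_inv {a b c d : D.Obj} (m : D.Pro a b) (n : D.Pro b c)
    (p : D.Pro c d) : D.left (D.assoc m n p).inv = 𝟙 a := D.left_inv _ (D.left_assoc m n p)

@[simp] theorem right_assoc_inv {a b c d : D.Obj} (m : D.Pro a b) (n : D.Pro b c)
    (p : D.Pro c d) : D.right (D.assoc m n p).inv = 𝟙 d := D.right_inv _ (D.right_assoc m n p)

@[simp] theorem left_lunit_inv {a b : D.Obj} (m : D.Pro a b) :
    D.left (D.lunit m).inv = 𝟙 a := D.left_inv _ (D.left_lunit m)

@[simp] theorem right_lunit_inv {a b : D.Obj} (m : D.Pro a b) :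
    D.right (D.lunit m).inv = 𝟙 b := D.right_inv _ (D.right_lunit m)

@[simp] theorem left_runit_inv {a b : D.Obj} (m : D.Pro a b) :
    D.left (D.runit m).inv = 𝟙 a := D.left_inv _ (D.left_runit m)

@[simp] theorem right_runit_inv {a b : D.Obj} (m : D.Pro a b) :
    D.right (D.runit m).inv = 𝟙 b := D.right_inv _ (D.right_runit m)

theorem left_eqToHom {a b : D.Obj} {m n : D.Pro a b} (h : m = n) :
    D.left (eqToHom (congrArg ProArr.mk h)) = 𝟙 a := by
  subst h; simp

theorem right_eqToHom {a b : D.Obj} {m n : D.Pro a b} (h : m = n) :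
    D.right (eqToHom (congrArg ProArr.mk h)) = 𝟙 b := by
  subst h; simp

theorem hcomp_congr {a b c a' b' c' : D.Obj} {m : D.Pro a b} {n : D.Pro b c}
    {m' : D.Pro a' b'} {n' : D.Pro b' c'} {α α' : D.Cell m m'} {β β' : D.Cell n n'}
    (hα : α = α') (hβ : β = β') (h : D.right α = D.left β) :
    D.hcomp α β h = D.hcomp α' β' (by rw [← hα, ← hβ, h]) := by
  subst hα hβ; rfl

theorem comp_heq {X Y Z X' Y' Z' : ProArr D.Pro} {α : X ⟶ Y} {β : Y ⟶ Z} {α' : X' ⟶ Y'}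
    {β' : Y' ⟶ Z'} (hX : X = X') (hY : Y = Y') (hZ : Z = Z') (hα : HEq α α') (hβ : HEq β β') :
    HEq (α ≫ β) (α' ≫ β') := by
  subst hX hY hZ; cases hα; cases hβ; rfl

theorem hcomp_heq {a b c a' b' c' : D.Obj} {m₁ m₂ : D.Pro a b} {n₁ n₂ : D.Pro b c}
    {m₁' m₂' : D.Pro a' b'} {n₁' n₂' : D.Pro b' c'}
    {α₁ : D.Cell m₁ m₁'} {β₁ : D.Cell n₁ n₁'} {α₂ : D.Cell m₂ m₂'} {β₂ : D.Cell n₂ n₂'}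
    (hm : m₁ = m₂) (hm' : m₁' = m₂') (hn : n₁ = n₂) (hn' : n₁' = n₂')
    (hα : HEq α₁ α₂) (hβ : HEq β₁ β₂) (h₁ : D.right α₁ = D.left β₁)
    (h₂ : D.right α₂ = D.left β₂) : HEq (D.hcomp α₁ β₁ h₁) (D.hcomp α₂ β₂ h₂) := by
  subst hm hm' hn hn'; cases hα; cases hβ; rfl

theorem heq_of_comm {X Y X' Y' : ProArr D.Pro} {α : X ⟶ Y} {α' : X' ⟶ Y'} (hX : X = X')
    (hY : Y = Y') (h : α ≫ eqToHom hY = eqToHom hX ≫ α') : HEq α α' := by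
  subst hX hY; simpa using h

theorem comm_of_heq {X Y X' Y' : ProArr D.Pro} {α : X ⟶ Y} {α' : X' ⟶ Y'} (hX : X = X')
    (hY : Y = Y') (h : HEq α α') : α ≫ eqToHom hY = eqToHom hX ≫ α' := by
  subst hX hY; simpa using h

theorem left_heq {a b c d : D.Obj} {m m' : D.Pro a b} {n n' : D.Pro c d} {α : D.Cell m n}
    {α' : D.Cell m' n'} (hm : m = m') (hn : n = n') (h : HEq α α') :
    D.left α = D.left α' := by
  subst hm hn; cases h; rfl

theorem right_heq {a b c d : D.Obj} {m m' : D.Pro a b} {n n' : D.Pro c d} {α : D.Cell m n}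
    {α' : D.Cell m' n'} (hm : m = m') (hn : n = n') (h : HEq α α') :
    D.right α = D.right α' := by
  subst hm hn; cases h; rfl

theorem hcomp_eqToHom {a b c : D.Obj} {m m' : D.Pro a b} {n n' : D.Pro b c} (h : m = m')
    (h' : n = n') :
    D.hcomp (eqToHom (congrArg ProArr.mk h)) (eqToHom (congrArg ProArr.mk h'))
      (by rw [right_eqToHom _ h, left_eqToHom _ h']) =
      eqToHom (congrArg ProArr.mk (congrArg₂ D.pcomp h h')) := by
  subst h h'; simp

/-- Globular cells between parallel proarrows form a category. -/
instance horCat (a b : D.Obj) : Category.{v} (D.Pro a b) where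
  Hom m n := {α : D.Cell m n // D.left α = 𝟙 a ∧ D.right α = 𝟙 b}
  id m := ⟨𝟙 _, D.left_id _, D.right_id _⟩
  comp α β := ⟨α.1 ≫ β.1, by rw [D.left_comp, α.2.1, β.2.1, Category.comp_id],
    by rw [D.right_comp, α.2.2, β.2.2, Category.comp_id]⟩
  id_comp α := Subtype.ext (Category.id_comp _)
  comp_id α := Subtype.ext (Category.comp_id _)
  assoc α β γ := Subtype.ext (Category.assoc _ _ _)

/-- The objects of `D`, regarded as the objects of the horizontal bicategory of `D`, which has
proarrows as 1-morphisms and globular cells as 2-morphisms. -/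
structure Hor where
  of : D.Obj

variable {D} in
/-- A globular isomorphism, as an isomorphism in the category of globular cells. -/
def globIso {a b : D.Obj} {m n : D.Pro a b} (e : ProArr.mk m ≅ ProArr.mk n)
    (hl : D.left e.hom = 𝟙 a) (hr : D.right e.hom = 𝟙 b) : m ≅ n where
  hom := ⟨e.hom, hl, hr⟩
  inv := ⟨e.inv, D.left_inv e hl, D.right_inv e hr⟩
  hom_inv_id := Subtype.ext e.hom_inv_id
  inv_hom_id := Subtype.ext e.inv_hom_id

instance : Bicategory.{v, v} D.Hor where
  Hom a b := D.Pro a.of b.of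
  id a := D.unit a.of
  comp m n := D.pcomp m n
  homCategory a b := D.horCat a.of b.of
  whiskerLeft m _ _ α := ⟨D.hcomp (𝟙 _) α.1 ((D.right_id _).trans α.2.1.symm),
    (D.left_hcomp _ _ _).trans (D.left_id _), (D.right_hcomp _ _ _).trans α.2.2⟩
  whiskerRight α m := ⟨D.hcomp α.1 (𝟙 _) (α.2.2.trans (D.left_id (ProArr.mk m)).symm),
    (D.left_hcomp _ _ _).trans α.2.1, (D.right_hcomp _ _ _).trans (D.right_id _)⟩
  associator m n p := globIso (D.assoc m n p) (D.left_assoc m n p) (D.right_assoc m n p)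
  leftUnitor m := globIso (D.lunit m) (D.left_lunit m) (D.right_lunit m)
  rightUnitor m := globIso (D.runit m) (D.left_runit m) (D.right_runit m)
  whiskerLeft_id m n := Subtype.ext (D.hcomp_id _ _)
  whiskerLeft_comp m _ _ _ α β := Subtype.ext (by
    change D.hcomp (𝟙 _) (α.1 ≫ β.1) _ = D.hcomp (𝟙 _) α.1 _ ≫ D.hcomp (𝟙 _) β.1 _
    rw [← D.hcomp_comp]; exact D.hcomp_congr (by simp) rfl _)
  id_whiskerLeft {a b m n} α := Subtype.ext (by
    change D.hcomp (𝟙 _) α.1 _ = (D.lunit m).hom ≫ α.1 ≫ (D.lunit n).inv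
    rw [← Category.assoc, ← D.lunit_naturality, Category.assoc, Iso.hom_inv_id, Category.comp_id]
    exact D.hcomp_congr (by rw [α.2.1, D.unitCell_id]) rfl _)
  comp_whiskerLeft {a b c d} m n p p' α := Subtype.ext (by
    change D.hcomp (𝟙 _) α.1 _ = (D.assoc m n p).hom ≫
      D.hcomp (𝟙 _) (D.hcomp (𝟙 _) α.1 _) _ ≫ (D.assoc m n p').inv
    rw [← Category.assoc, ← D.assoc_naturality _ _ _ (by simp) (by simp [α.2.1]), Category.assoc,
      Iso.hom_inv_id, Category.comp_id]
    exact D.hcomp_congr (by simp) rfl _)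
  id_whiskerRight m n := Subtype.ext (D.hcomp_id _ _)
  comp_whiskerRight α β n := Subtype.ext (by
    change D.hcomp (α.1 ≫ β.1) (𝟙 _) _ = D.hcomp α.1 (𝟙 _) _ ≫ D.hcomp β.1 (𝟙 _) _
    rw [← D.hcomp_comp]; exact D.hcomp_congr rfl (by simp) _)
  whiskerRight_id {a b m n} α := Subtype.ext (by
    change D.hcomp α.1 (𝟙 _) _ = (D.runit m).hom ≫ α.1 ≫ (D.runit n).inv
    rw [← Category.assoc, ← D.runit_naturality, Category.assoc, Iso.hom_inv_id, Category.comp_id]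
    exact D.hcomp_congr rfl (by rw [α.2.2, D.unitCell_id]) _)
  whiskerRight_comp {a b c d m m'} α n p := Subtype.ext (by
    change D.hcomp α.1 (𝟙 _) _ = (D.assoc m n p).inv ≫
      D.hcomp (D.hcomp α.1 (𝟙 _) _) (𝟙 _) _ ≫ (D.assoc m' n p).hom
    rw [D.assoc_naturality _ _ _ (by simp [α.2.2]) (by simp), Iso.inv_hom_id_assoc]
    exact D.hcomp_congr rfl (by simp) _)
  whisker_assoc {a b c d} m n n' α p := Subtype.ext (by
    change D.hcomp (D.hcomp (𝟙 _) α.1 _) (𝟙 _) _ = (D.assoc m n p).hom ≫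
      D.hcomp (𝟙 _) (D.hcomp α.1 (𝟙 _) _) _ ≫ (D.assoc m n' p).inv
    rw [← Category.assoc, ← D.assoc_naturality _ _ _ (by simp [α.2.1]) (by simp [α.2.2]),
      Category.assoc, Iso.hom_inv_id, Category.comp_id])
  whisker_exchange {a b c m m' n n'} α β := Subtype.ext (by
    change D.hcomp (𝟙 _) β.1 _ ≫ D.hcomp α.1 (𝟙 _) _ = D.hcomp α.1 (𝟙 _) _ ≫ D.hcomp (𝟙 _) β.1 _
    rw [← D.hcomp_comp, ← D.hcomp_comp]; exact D.hcomp_congr (by simp) (by simp) _)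
  pentagon m n p q := Subtype.ext (D.pentagon m n p q)
  triangle m n := Subtype.ext (D.triangle m n)

theorem lunit_unit (a : D.Obj) : (D.lunit (D.unit a)).hom = (D.runit (D.unit a)).hom :=
  congrArg (fun α : {α : D.Cell (D.pcomp (D.unit a) (D.unit a)) (D.unit a) //
    D.left α = 𝟙 a ∧ D.right α = 𝟙 a} => α.1)
    (Bicategory.unitors_equal (B := D.Hor) (a := ⟨a⟩))

theorem lunit_unit_iso (a : D.Obj) : D.lunit (D.unit a) = D.runit (D.unit a) :=
  Iso.ext (D.lunit_unit a)

end basic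

end DblCat

namespace DblCat

variable {D : DblCat.{u, v}}

/-- A companion of an arrow: a proarrow with unit and counit cells satisfying the two companion
equations. -/
@[ext]
structure Companion (D : DblCat.{u, v}) {x y : D.Obj} (f : x ⟶ y) where
  pro : D.Pro x y
  η : D.Cell (D.unit x) pro
  ε : D.Cell pro (D.unit y)
  left_η : D.left η = 𝟙 x
  right_η : D.right η = f
  left_ε : D.left ε = f
  right_ε : D.right ε = 𝟙 y
  η_ε : η ≫ ε = D.unitCell f
  ε_η : (D.lunit pro).inv ≫ D.hcomp η ε (right_η.trans left_ε.symm) ≫ (D.runit pro).hom =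
    𝟙 (ProArr.mk pro)

attribute [simp] Companion.left_η Companion.right_η Companion.left_ε Companion.right_ε

/-- The property of having a companion. -/
def HasCompanion (D : DblCat.{u, v}) {x y : D.Obj} (f : x ⟶ y) : Prop :=
  Nonempty (D.Companion f)

/-- The external identity is a companion of the identity arrow. -/
@[simps]
def Companion.id (D : DblCat.{u, v}) (x : D.Obj) : D.Companion (𝟙 x) where
  pro := D.unit x
  η := 𝟙 _
  ε := 𝟙 _
  left_η := D.left_id _
  right_η := D.right_id _
  left_ε := D.left_id _
  right_ε := D.right_id _
  η_ε := by simp [D.unitCell_id]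
  ε_η := by simp [← D.lunit_unit]

theorem coh_aux {B : Type*} [Bicategory B] {x y z : B} (p : x ⟶ y) (q : y ⟶ z) :
    (Bicategory.leftUnitor (p ≫ q)).inv ≫
      Bicategory.whiskerRight (Bicategory.leftUnitor (𝟙 x)).inv (p ≫ q) ≫
      (Bicategory.associator _ _ _).hom ≫
      Bicategory.whiskerLeft (𝟙 x) ((Bicategory.associator (𝟙 x) p q).inv ≫
        Bicategory.whiskerRight (Bicategory.leftUnitor p).hom q) ≫
      (Bicategory.associator _ _ _).inv ≫
      Bicategory.whiskerRight ((Bicategory.leftUnitor p).hom ≫ (Bicategory.rightUnitor p).inv) q ≫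
      (Bicategory.associator _ _ _).hom ≫
      Bicategory.whiskerLeft p ((Bicategory.leftUnitor q).hom ≫ (Bicategory.rightUnitor q).inv) ≫
      Bicategory.whiskerLeft p (Bicategory.whiskerRight (Bicategory.rightUnitor q).inv (𝟙 z) ≫
        (Bicategory.associator _ _ _).hom) ≫
      (Bicategory.associator _ _ _).inv ≫
      Bicategory.whiskerLeft (p ≫ q) (Bicategory.leftUnitor (𝟙 z)).hom ≫
      (Bicategory.rightUnitor (p ≫ q)).hom = 𝟙 (p ≫ q) := by
  bicategory

theorem Companion.hcomp_eq {x y : D.Obj} {f : x ⟶ y} (c : D.Companion f) :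
    D.hcomp c.η c.ε (c.right_η.trans c.left_ε.symm) =
      (D.lunit c.pro).hom ≫ (D.runit c.pro).inv := by
  rw [← Iso.inv_comp_eq, ← Iso.comp_hom_eq_id, Category.assoc, c.ε_η]

theorem unit_hcomp {a b a' b' : D.Obj} {m : D.Pro a b} {m' : D.Pro a' b'} (f : a ⟶ a')
    (α : D.Cell m m') (h : D.right (D.unitCell f) = D.left α) :
    D.hcomp (D.unitCell f) α h = (D.lunit m).hom ≫ α ≫ (D.lunit m').inv := by
  have hf : f = D.left α := (D.right_unitCell f).symm.trans h
  subst hf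
  rw [← Category.assoc, ← D.lunit_naturality, Category.assoc, Iso.hom_inv_id, Category.comp_id]

theorem hcomp_unit {a b a' b' : D.Obj} {m : D.Pro a b} {m' : D.Pro a' b'} (f : b ⟶ b')
    (α : D.Cell m m') (h : D.right α = D.left (D.unitCell f)) :
    D.hcomp α (D.unitCell f) h = (D.runit m).hom ≫ α ≫ (D.runit m').inv := by
  have hf : f = D.right α := (D.left_unitCell f).symm.trans h.symm
  subst hf
  rw [← Category.assoc, ← D.runit_naturality, Category.assoc, Iso.hom_inv_id, Category.comp_id]

theorem Companion.comp_aux {x y z : D.Obj} {k : x ⟶ y} {l : y ⟶ z} (c : D.Companion k)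
    (d : D.Companion l) :
    D.hcomp (D.hcomp c.η (D.unitCell k ≫ d.η) (by simp)) (D.hcomp (c.ε ≫ D.unitCell l) d.ε
      (by simp)) (by simp) =
    (D.assoc _ _ _).hom ≫ D.hcomp (𝟙 (ProArr.mk (D.unit x))) ((D.assoc _ _ _).inv ≫
        D.hcomp (D.lunit c.pro).hom (𝟙 (ProArr.mk d.pro)) (by simp)) (by simp) ≫
      (D.assoc _ _ _).inv ≫
      D.hcomp ((D.lunit c.pro).hom ≫ (D.runit c.pro).inv) (𝟙 (ProArr.mk d.pro)) (by simp) ≫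
      (D.assoc _ _ _).hom ≫
      D.hcomp (𝟙 (ProArr.mk c.pro)) ((D.lunit d.pro).hom ≫ (D.runit d.pro).inv) (by simp) ≫
      D.hcomp (𝟙 (ProArr.mk c.pro)) (D.hcomp (D.runit d.pro).inv (𝟙 (ProArr.mk (D.unit z)))
        (by simp) ≫ (D.assoc _ _ _).hom) (by simp) ≫
      (D.assoc _ _ _).inv := by
  have h1 : D.hcomp (D.unitCell k ≫ d.η) (c.ε ≫ D.unitCell l) (by simp) =
      (D.lunit c.pro).hom ≫ (c.ε ≫ d.η) ≫ (D.runit d.pro).inv := by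
    rw [D.hcomp_comp _ _ _ _ (by simp) (by simp), unit_hcomp, hcomp_unit, D.lunit_unit_iso]
    simp
  have h2 : D.hcomp (D.unitCell k ≫ d.η) (D.hcomp (c.ε ≫ D.unitCell l) d.ε (by simp)) (by simp) =
      (D.assoc _ _ _).inv ≫ D.hcomp (D.lunit c.pro).hom (𝟙 (ProArr.mk d.pro)) (by simp) ≫
        D.hcomp (c.ε ≫ d.η) d.ε (by simp) ≫
        D.hcomp (D.runit d.pro).inv (𝟙 (ProArr.mk (D.unit z))) (by simp) ≫
        (D.assoc _ _ _).hom := by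
    have e : D.hcomp ((D.lunit c.pro).hom ≫ (c.ε ≫ d.η) ≫ (D.runit d.pro).inv) d.ε (by simp) =
        D.hcomp (D.lunit c.pro).hom (𝟙 (ProArr.mk d.pro)) (by simp) ≫
        D.hcomp (c.ε ≫ d.η) d.ε (by simp) ≫
        D.hcomp (D.runit d.pro).inv (𝟙 (ProArr.mk (D.unit z))) (by simp) := by
      rw [← D.hcomp_comp, ← D.hcomp_comp]
      exact D.hcomp_congr rfl (by simp) _
    rw [Iso.eq_inv_comp, ← D.assoc_naturality _ _ _ (by simp) (by simp), D.hcomp_congr h1 rfl, e]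
    simp only [Category.assoc]
  have h3 : D.hcomp c.η (D.hcomp (c.ε ≫ d.η) d.ε (by simp)) (by simp) =
      D.hcomp c.η (D.hcomp c.ε (𝟙 (ProArr.mk d.pro)) (by simp)) (by simp) ≫
        D.hcomp (𝟙 (ProArr.mk c.pro)) (D.hcomp d.η d.ε (by simp)) (by simp) := by
    rw [← D.hcomp_comp]
    exact D.hcomp_congr (by simp) (by rw [← D.hcomp_comp]; exact D.hcomp_congr rfl (by simp) _) _
  have h4 : D.hcomp c.η (D.hcomp c.ε (𝟙 (ProArr.mk d.pro)) (by simp)) (by simp) =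
      (D.assoc _ _ _).inv ≫
      D.hcomp ((D.lunit c.pro).hom ≫ (D.runit c.pro).inv) (𝟙 (ProArr.mk d.pro)) (by simp) ≫
      (D.assoc _ _ _).hom := by
    rw [Iso.eq_inv_comp, ← D.assoc_naturality _ _ _ (by simp) (by simp)]
    congr 1
    exact D.hcomp_congr c.hcomp_eq rfl _
  have h5 : D.hcomp c.η (D.hcomp (D.unitCell k ≫ d.η) (D.hcomp (c.ε ≫ D.unitCell l) d.ε
      (by simp)) (by simp)) (by simp) = 
      D.hcomp (𝟙 (ProArr.mk (D.unit x))) ((D.assoc _ _ _).inv ≫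
        D.hcomp (D.lunit c.pro).hom (𝟙 (ProArr.mk d.pro)) (by simp)) (by simp) ≫ 
      D.hcomp c.η (D.hcomp (c.ε ≫ d.η) d.ε (by simp)) (by simp) ≫
      D.hcomp (𝟙 (ProArr.mk c.pro)) (D.hcomp (D.runit d.pro).inv (𝟙 (ProArr.mk (D.unit z)))
        (by simp) ≫ (D.assoc _ _ _).hom) (by simp) := by
    rw [← D.hcomp_comp, ← D.hcomp_comp]
    exact D.hcomp_congr (by simp) (by rw [h2]; simp) _
  rw [← cancel_mono (D.assoc _ _ _).hom, D.assoc_naturality _ _ _ (by simp) (by simp), h5, h3, h4,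
    D.hcomp_congr rfl d.hcomp_eq]
  simp only [Category.assoc, Iso.inv_hom_id, Category.comp_id]

/-- Companions compose: `k_! ⊙ l_!` is a companion of `k ≫ l`, with unit and counit obtained by
pasting. -/
def Companion.comp {x y z : D.Obj} {k : x ⟶ y} {l : y ⟶ z} (c : D.Companion k)
    (d : D.Companion l) : D.Companion (k ≫ l) where
  pro := D.pcomp c.pro d.pro
  η := (D.lunit (D.unit x)).inv ≫ D.hcomp c.η (D.unitCell k ≫ d.η) (by simp)
  ε := D.hcomp (c.ε ≫ D.unitCell l) d.ε (by simp) ≫ (D.lunit (D.unit z)).hom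
  left_η := by simp
  right_η := by simp
  left_ε := by simp
  right_ε := by simp
  η_ε := by
    have : D.hcomp c.η (D.unitCell k ≫ d.η) (by simp) ≫ D.hcomp (c.ε ≫ D.unitCell l) d.ε (by simp)
        = D.hcomp (D.unitCell (k ≫ l)) (D.unitCell (k ≫ l)) (by simp) := by
      rw [← D.hcomp_comp]
      exact D.hcomp_congr (by rw [← Category.assoc, c.η_ε, D.unitCell_comp])
        (by rw [Category.assoc, d.η_ε, D.unitCell_comp]) _
    rw [Category.assoc, ← Category.assoc (D.hcomp _ _ _), this, unit_hcomp]
    simp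
  ε_η := by
    have h : D.hcomp ((D.lunit (D.unit x)).inv ≫ D.hcomp c.η (D.unitCell k ≫ d.η) (by simp))
        (D.hcomp (c.ε ≫ D.unitCell l) d.ε (by simp) ≫ (D.lunit (D.unit z)).hom) (by simp) =
        D.hcomp (D.lunit (D.unit x)).inv (𝟙 (ProArr.mk (D.pcomp c.pro d.pro))) (by simp) ≫
        D.hcomp (D.hcomp c.η (D.unitCell k ≫ d.η) (by simp))
          (D.hcomp (c.ε ≫ D.unitCell l) d.ε (by simp)) (by simp) ≫
        D.hcomp (𝟙 (ProArr.mk (D.pcomp c.pro d.pro))) (D.lunit (D.unit z)).hom (by simp) := by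
      rw [← D.hcomp_comp, ← D.hcomp_comp]
      exact D.hcomp_congr (by simp) (by simp) _
    rw [h, Companion.comp_aux]
    have := congrArg (fun α : {α : D.Cell (D.pcomp c.pro d.pro) (D.pcomp c.pro d.pro) //
      D.left α = 𝟙 x ∧ D.right α = 𝟙 z} => α.1)
      (coh_aux (B := D.Hor) (x := ⟨x⟩) (y := ⟨y⟩) (z := ⟨z⟩) c.pro d.pro)
    simp only [Category.assoc]
    exact this

end DblCat

/-- A (pseudo) double functor. -/
@[ext]
structure DblFunctor (D E : DblCat.{u, v}) where
  obj : D.Obj → E.Obj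
  map {a b : D.Obj} : (a ⟶ b) → (obj a ⟶ obj b)
  map_id (a : D.Obj) : map (𝟙 a) = 𝟙 (obj a)
  map_comp {a b c : D.Obj} (f : a ⟶ b) (g : b ⟶ c) : map (f ≫ g) = map f ≫ map g
  mapPro {a b : D.Obj} : D.Pro a b → E.Pro (obj a) (obj b)
  mapCell {a b c d : D.Obj} {m : D.Pro a b} {n : D.Pro c d} :
    D.Cell m n → E.Cell (mapPro m) (mapPro n)
  left_mapCell {a b c d : D.Obj} {m : D.Pro a b} {n : D.Pro c d} (α : D.Cell m n) :
    E.left (mapCell α) = map (D.left α)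
  right_mapCell {a b c d : D.Obj} {m : D.Pro a b} {n : D.Pro c d} (α : D.Cell m n) :
    E.right (mapCell α) = map (D.right α)
  mapCell_id {a b : D.Obj} (m : D.Pro a b) : mapCell (𝟙 (ProArr.mk m)) = 𝟙 _
  mapCell_comp {a b c d e f : D.Obj} {m : D.Pro a b} {n : D.Pro c d} {p : D.Pro e f}
    (α : D.Cell m n) (β : D.Cell n p) : mapCell (α ≫ β) = mapCell α ≫ mapCell β
  /-- the comparison cells for external identities -/
  mapUnit (a : D.Obj) : ProArr.mk (E.unit (obj a)) ≅ ProArr.mk (mapPro (D.unit a))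
  left_mapUnit (a : D.Obj) : E.left (mapUnit a).hom = 𝟙 _
  right_mapUnit (a : D.Obj) : E.right (mapUnit a).hom = 𝟙 _
  mapUnit_naturality {a b : D.Obj} (f : a ⟶ b) :
    E.unitCell (map f) ≫ (mapUnit b).hom = (mapUnit a).hom ≫ mapCell (D.unitCell f)
  /-- the comparison cells for external composites -/
  mapComp {a b c : D.Obj} (m : D.Pro a b) (n : D.Pro b c) :
    ProArr.mk (E.pcomp (mapPro m) (mapPro n)) ≅ ProArr.mk (mapPro (D.pcomp m n))
  left_mapComp {a b c : D.Obj} (m : D.Pro a b) (n : D.Pro b c) :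
    E.left (mapComp m n).hom = 𝟙 _
  right_mapComp {a b c : D.Obj} (m : D.Pro a b) (n : D.Pro b c) :
    E.right (mapComp m n).hom = 𝟙 _
  mapComp_naturality {a b c a' b' c' : D.Obj} {m : D.Pro a b} {n : D.Pro b c}
    {m' : D.Pro a' b'} {n' : D.Pro b' c'} (α : D.Cell m m') (β : D.Cell n n')
    (h : D.right α = D.left β) :
    E.hcomp (mapCell α) (mapCell β) (by rw [left_mapCell, right_mapCell, h]) ≫
      (mapComp m' n').hom = (mapComp m n).hom ≫ mapCell (D.hcomp α β h)
  mapComp_assoc {a b c d : D.Obj} (m : D.Pro a b) (n : D.Pro b c) (p : D.Pro c d) :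
    E.hcomp (mapComp m n).hom (𝟙 (ProArr.mk (mapPro p)))
        ((right_mapComp m n).trans (E.left_id (ProArr.mk (mapPro p))).symm) ≫
      (mapComp (D.pcomp m n) p).hom ≫ mapCell (D.assoc m n p).hom =
    (E.assoc (mapPro m) (mapPro n) (mapPro p)).hom ≫
      E.hcomp (𝟙 (ProArr.mk (mapPro m))) (mapComp n p).hom
        ((E.right_id (ProArr.mk (mapPro m))).trans (left_mapComp n p).symm) ≫
      (mapComp m (D.pcomp n p)).hom
  mapComp_lunit {a b : D.Obj} (m : D.Pro a b) :
    E.hcomp (mapUnit a).hom (𝟙 (ProArr.mk (mapPro m)))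
        ((right_mapUnit a).trans (E.left_id (ProArr.mk (mapPro m))).symm) ≫
      (mapComp (D.unit a) m).hom ≫ mapCell (D.lunit m).hom = (E.lunit (mapPro m)).hom
  mapComp_runit {a b : D.Obj} (m : D.Pro a b) :
    E.hcomp (𝟙 (ProArr.mk (mapPro m))) (mapUnit b).hom
        ((E.right_id (ProArr.mk (mapPro m))).trans (left_mapUnit b).symm) ≫
      (mapComp m (D.unit b)).hom ≫ mapCell (D.runit m).hom = (E.runit (mapPro m)).hom

namespace DblFunctor

attribute [simp] map_id map_comp left_mapCell right_mapCell mapCell_id mapCell_comp left_mapUnit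
  right_mapUnit left_mapComp right_mapComp

variable {D E K L : DblCat.{u, v}}

@[simp] theorem left_mapUnit_inv (F : DblFunctor D E) (a : D.Obj) :
    E.left (F.mapUnit a).inv = 𝟙 _ := E.left_inv _ (F.left_mapUnit a)

@[simp] theorem right_mapUnit_inv (F : DblFunctor D E) (a : D.Obj) :
    E.right (F.mapUnit a).inv = 𝟙 _ := E.right_inv _ (F.right_mapUnit a)

@[simp] theorem left_mapComp_inv (F : DblFunctor D E) {a b c : D.Obj} (m : D.Pro a b)
    (n : D.Pro b c) : E.left (F.mapComp m n).inv = 𝟙 _ := E.left_inv _ (F.left_mapComp m n)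

@[simp] theorem right_mapComp_inv (F : DblFunctor D E) {a b c : D.Obj} (m : D.Pro a b)
    (n : D.Pro b c) : E.right (F.mapComp m n).inv = 𝟙 _ := E.right_inv _ (F.right_mapComp m n)

/-- A double functor preserves isomorphisms between proarrows. -/
@[simps]
def mapCellIso (F : DblFunctor D E) {a b c d : D.Obj} {m : D.Pro a b} {n : D.Pro c d}
    (e : ProArr.mk m ≅ ProArr.mk n) : ProArr.mk (F.mapPro m) ≅ ProArr.mk (F.mapPro n) where
  hom := F.mapCell e.hom
  inv := F.mapCell e.inv
  hom_inv_id := by rw [← F.mapCell_comp, e.hom_inv_id, F.mapCell_id]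
  inv_hom_id := by rw [← F.mapCell_comp, e.inv_hom_id, F.mapCell_id]

/-- The identity double functor. -/
@[simps]
abbrev id (D : DblCat.{u, v}) : DblFunctor D D where
  obj a := a
  map f := f
  map_id _ := rfl
  map_comp _ _ := rfl
  mapPro m := m
  mapCell α := α
  left_mapCell _ := rfl
  right_mapCell _ := rfl
  mapCell_id _ := rfl
  mapCell_comp _ _ := rfl
  mapUnit _ := Iso.refl _
  left_mapUnit _ := D.left_id _
  right_mapUnit _ := D.right_id _
  mapUnit_naturality _ := by simp
  mapComp _ _ := Iso.refl _
  left_mapComp _ _ := D.left_id _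
  right_mapComp _ _ := D.right_id _
  mapComp_naturality _ _ _ := by simp
  mapComp_assoc _ _ _ := by simp
  mapComp_lunit _ := by simp
  mapComp_runit _ := by simp

/-- Composition of double functors. -/
@[simps]
abbrev comp (F : DblFunctor D E) (G : DblFunctor E K) : DblFunctor D K where
  obj a := G.obj (F.obj a)
  map f := G.map (F.map f)
  map_id _ := by simp
  map_comp _ _ := by simp
  mapPro m := G.mapPro (F.mapPro m)
  mapCell α := G.mapCell (F.mapCell α)
  left_mapCell _ := by simp
  right_mapCell _ := by simp
  mapCell_id _ := by simp
  mapCell_comp _ _ := by simp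
  mapUnit a := G.mapUnit (F.obj a) ≪≫ G.mapCellIso (F.mapUnit a)
  left_mapUnit _ := by simp
  right_mapUnit _ := by simp
  mapUnit_naturality f := by
    have := congrArg G.mapCell (F.mapUnit_naturality f)
    rw [G.mapCell_comp, G.mapCell_comp] at this
    simp only [Iso.trans_hom, mapCellIso_hom, Category.assoc]
    rw [← this, ← Category.assoc, G.mapUnit_naturality, Category.assoc]
  mapComp m n := G.mapComp _ _ ≪≫ G.mapCellIso (F.mapComp m n)
  left_mapComp _ _ := by simp
  right_mapComp _ _ := by simp
  mapComp_naturality α β h := by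
    have := congrArg G.mapCell (F.mapComp_naturality α β h)
    rw [G.mapCell_comp, G.mapCell_comp] at this
    simp only [Iso.trans_hom, mapCellIso_hom, Category.assoc]
    rw [← this, ← Category.assoc, G.mapComp_naturality, Category.assoc]
  mapComp_assoc m n p := by
    have := congrArg G.mapCell (F.mapComp_assoc m n p)
    simp only [G.mapCell_comp] at this
    have h1 : K.hcomp ((G.mapComp (F.mapPro m) (F.mapPro n)).hom ≫ G.mapCell (F.mapComp m n).hom)
        (𝟙 (ProArr.mk (G.mapPro (F.mapPro p)))) (by simp) =
        K.hcomp (G.mapComp (F.mapPro m) (F.mapPro n)).hom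
          (𝟙 (ProArr.mk (G.mapPro (F.mapPro p)))) (by simp) ≫
        K.hcomp (G.mapCell (F.mapComp m n).hom) (G.mapCell (𝟙 (ProArr.mk (F.mapPro p))))
          (by simp) := by
      rw [← K.hcomp_comp]; exact K.hcomp_congr rfl (by simp) _
    have h2 : K.hcomp (𝟙 (ProArr.mk (G.mapPro (F.mapPro m))))
        ((G.mapComp (F.mapPro n) (F.mapPro p)).hom ≫ G.mapCell (F.mapComp n p).hom)
        (by simp) =
        K.hcomp (𝟙 (ProArr.mk (G.mapPro (F.mapPro m))))
          (G.mapComp (F.mapPro n) (F.mapPro p)).hom (by simp) ≫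
        K.hcomp (G.mapCell (𝟙 (ProArr.mk (F.mapPro m)))) (G.mapCell (F.mapComp n p).hom)
          (by simp) := by
      rw [← K.hcomp_comp]; exact K.hcomp_congr (by simp) rfl _
    have h3 := G.mapComp_naturality (F.mapComp m n).hom (𝟙 (ProArr.mk (F.mapPro p))) (by simp)
    have h4 := G.mapComp_naturality (𝟙 (ProArr.mk (F.mapPro m))) (F.mapComp n p).hom (by simp)
    have h5 := G.mapComp_assoc (F.mapPro m) (F.mapPro n) (F.mapPro p)
    simp only [Iso.trans_hom, mapCellIso_hom, Category.assoc]
    rw [h1, h2]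
    simp only [Category.assoc]
    rw [← Category.assoc (K.hcomp (G.mapCell _) _ _), h3, ← Category.assoc (K.hcomp (G.mapCell _) _ _) (Iso.hom _), h4,
      Category.assoc, this, Category.assoc, ← Category.assoc (K.hcomp _ _ _),
      ← Category.assoc (K.hcomp _ _ _ ≫ _)]
    simp only [Category.assoc]
    rw [← Category.assoc (G.mapComp _ _).hom (G.mapCell _), ← Category.assoc (K.hcomp _ _ _), h5]
    simp only [Category.assoc]
  mapComp_lunit m := by
    have := congrArg G.mapCell (F.mapComp_lunit m)
    simp only [G.mapCell_comp] at this
    have h1 : K.hcomp ((G.mapUnit (F.obj _)).hom ≫ G.mapCell (F.mapUnit _).hom)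
        (𝟙 (ProArr.mk (G.mapPro (F.mapPro m)))) (by simp) =
        K.hcomp (G.mapUnit (F.obj _)).hom (𝟙 (ProArr.mk (G.mapPro (F.mapPro m)))) (by simp) ≫
        K.hcomp (G.mapCell (F.mapUnit _).hom) (G.mapCell (𝟙 (ProArr.mk (F.mapPro m))))
          (by simp) := by
      rw [← K.hcomp_comp]; exact K.hcomp_congr rfl (by simp) _
    have h3 := G.mapComp_naturality (F.mapUnit _).hom (𝟙 (ProArr.mk (F.mapPro m))) (by simp)
    simp only [Iso.trans_hom, mapCellIso_hom, Category.assoc]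
    rw [h1, Category.assoc, ← Category.assoc (K.hcomp (G.mapCell _) _ _), h3, Category.assoc, this,
      G.mapComp_lunit]
  mapComp_runit m := by
    have := congrArg G.mapCell (F.mapComp_runit m)
    simp only [G.mapCell_comp] at this
    have h1 : K.hcomp (𝟙 (ProArr.mk (G.mapPro (F.mapPro m))))
        ((G.mapUnit (F.obj _)).hom ≫ G.mapCell (F.mapUnit _).hom) (by simp) =
        K.hcomp (𝟙 (ProArr.mk (G.mapPro (F.mapPro m)))) (G.mapUnit (F.obj _)).hom (by simp) ≫
        K.hcomp (G.mapCell (𝟙 (ProArr.mk (F.mapPro m)))) (G.mapCell (F.mapUnit _).hom)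
          (by simp) := by
      rw [← K.hcomp_comp]; exact K.hcomp_congr (by simp) rfl _
    have h3 := G.mapComp_naturality (𝟙 (ProArr.mk (F.mapPro m))) (F.mapUnit _).hom (by simp)
    simp only [Iso.trans_hom, mapCellIso_hom, Category.assoc]
    rw [h1, Category.assoc, ← Category.assoc (K.hcomp (G.mapCell _) _ _), h3, Category.assoc, this,
      G.mapComp_runit]

/-- Double functors with definitionally equal actions are equal if their comparison cells are. -/
theorem ext_of_rfl {F G : DblFunctor D E} (hobj : F.obj = G.obj)
    (hmap : ∀ {a b : D.Obj} (f : a ⟶ b), HEq (F.map f) (G.map f))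
    (hpro : ∀ {a b : D.Obj} (m : D.Pro a b), HEq (F.mapPro m) (G.mapPro m))
    (hcell : ∀ {a b c d : D.Obj} {m : D.Pro a b} {n : D.Pro c d} (α : D.Cell m n),
      HEq (F.mapCell α) (G.mapCell α))
    (hunit : ∀ a, HEq (F.mapUnit a).hom (G.mapUnit a).hom)
    (hcomp : ∀ {a b c : D.Obj} (m : D.Pro a b) (n : D.Pro b c),
      HEq (F.mapComp m n).hom (G.mapComp m n).hom) : F = G := by
  obtain ⟨Fo, Fm, _, _, Fp, Fc, _, _, _, _, Fu, _, _, _, Fk, _, _, _, _, _, _⟩ := F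
  obtain ⟨Go, Gm, _, _, Gp, Gc, _, _, _, _, Gu, _, _, _, Gk, _, _, _, _, _, _⟩ := G
  dsimp only at *
  subst hobj
  obtain rfl : @Fm = @Gm := by
    funext a b f; exact eq_of_heq (hmap f)
  obtain rfl : @Fp = @Gp := by
    funext a b f; exact eq_of_heq (hpro f)
  obtain rfl : @Fc = @Gc := by
    funext a b c d m n f; exact eq_of_heq (hcell f)
  obtain rfl : @Fu = @Gu := by
    funext a; exact Iso.ext (eq_of_heq (hunit a))
  obtain rfl : @Fk = @Gk := by
    funext a b c m n; exact Iso.ext (eq_of_heq (hcomp m n))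
  rfl

end DblFunctor

/-- A (tight) natural transformation between double functors. -/
@[ext]
structure DblNatTrans {D E : DblCat.{u, v}} (F G : DblFunctor D E) where
  app (a : D.Obj) : F.obj a ⟶ G.obj a
  naturality {a b : D.Obj} (f : a ⟶ b) : F.map f ≫ app b = app a ≫ G.map f
  appPro {a b : D.Obj} (m : D.Pro a b) : E.Cell (F.mapPro m) (G.mapPro m)
  left_appPro {a b : D.Obj} (m : D.Pro a b) : E.left (appPro m) = app a
  right_appPro {a b : D.Obj} (m : D.Pro a b) : E.right (appPro m) = app b
  cell_naturality {a b c d : D.Obj} {m : D.Pro a b} {n : D.Pro c d} (α : D.Cell m n) :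
    F.mapCell α ≫ appPro n = appPro m ≫ G.mapCell α
  appPro_unit (a : D.Obj) :
    (F.mapUnit a).hom ≫ appPro (D.unit a) = E.unitCell (app a) ≫ (G.mapUnit a).hom
  appPro_comp {a b c : D.Obj} (m : D.Pro a b) (n : D.Pro b c) :
    (F.mapComp m n).hom ≫ appPro (D.pcomp m n) =
      E.hcomp (appPro m) (appPro n) ((right_appPro m).trans (left_appPro n).symm) ≫
        (G.mapComp m n).hom

namespace DblNatTrans

attribute [simp] left_appPro right_appPro

variable {D E K L : DblCat.{u, v}}

/-- Double functors and natural transformations form a category. -/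
@[simps]
instance : Category (DblFunctor D E) where
  Hom F G := DblNatTrans F G
  id F :=
    { app := fun a => 𝟙 _
      naturality := fun f => by simp
      appPro := fun m => 𝟙 _
      left_appPro := fun m => E.left_id _
      right_appPro := fun m => E.right_id _
      cell_naturality := fun α => by simp
      appPro_unit := fun a => by simp [E.unitCell_id]
      appPro_comp := fun m n => by simp }
  comp σ τ :=
    { app := fun a => σ.app a ≫ τ.app a
      naturality := fun f => by
        rw [← Category.assoc, σ.naturality, Category.assoc, τ.naturality, Category.assoc]
      appPro := fun m => σ.appPro m ≫ τ.appPro m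
      left_appPro := fun m => by simp
      right_appPro := fun m => by simp
      cell_naturality := fun α => by
        rw [← Category.assoc, σ.cell_naturality, Category.assoc, τ.cell_naturality, Category.assoc]
      appPro_unit := fun a => by
        rw [← Category.assoc, σ.appPro_unit, Category.assoc, τ.appPro_unit, E.unitCell_comp,
          Category.assoc]
      appPro_comp := fun m n => by
        rw [← Category.assoc, σ.appPro_comp, Category.assoc, τ.appPro_comp,
          E.hcomp_comp _ _ _ _ (by simp) (by simp), Category.assoc] }
  id_comp _ := DblNatTrans.ext (funext fun _ => Category.id_comp _)
    (by funext _ _ _; exact Category.id_comp _)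
  comp_id _ := DblNatTrans.ext (funext fun _ => Category.comp_id _)
    (by funext _ _ _; exact Category.comp_id _)
  assoc _ _ _ := DblNatTrans.ext (funext fun _ => Category.assoc _ _ _)
    (by funext _ _ _; exact Category.assoc _ _ _)

theorem hext {F G : DblFunctor D E} {σ τ : F ⟶ G} (h : ∀ a, σ.app a = τ.app a)
    (h' : ∀ {a b : D.Obj} (m : D.Pro a b), σ.appPro m = τ.appPro m) : σ = τ :=
  DblNatTrans.ext (funext h) (by funext a b m; exact h' m)

/-- Whiskering on the left. -/
@[simps]
def whiskerLeft (F : DblFunctor D E) {G H : DblFunctor E K} (τ : DblNatTrans G H) :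
    DblNatTrans (F.comp G) (F.comp H) where
  app a := τ.app (F.obj a)
  naturality f := τ.naturality _
  appPro m := τ.appPro (F.mapPro m)
  left_appPro _ := τ.left_appPro _
  right_appPro _ := τ.right_appPro _
  cell_naturality _ := τ.cell_naturality _
  appPro_unit a := by
    simp only [Iso.trans_hom, DblFunctor.mapCellIso_hom, Category.assoc]
    rw [τ.cell_naturality, ← Category.assoc, τ.appPro_unit, Category.assoc]
  appPro_comp m n := by
    simp only [Iso.trans_hom, DblFunctor.mapCellIso_hom, Category.assoc]
    rw [τ.cell_naturality, ← Category.assoc, τ.appPro_comp, Category.assoc]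

/-- Whiskering on the right. -/
@[simps]
def whiskerRight {F G : DblFunctor D E} (τ : DblNatTrans F G) (H : DblFunctor E K) :
    DblNatTrans (F.comp H) (G.comp H) where
  app a := H.map (τ.app a)
  naturality f := by
    change H.map (F.map f) ≫ _ = _ ≫ H.map (G.map f)
    rw [← H.map_comp, ← H.map_comp, τ.naturality]
  appPro m := H.mapCell (τ.appPro m)
  left_appPro _ := (H.left_mapCell _).trans (congrArg _ (τ.left_appPro _))
  right_appPro _ := (H.right_mapCell _).trans (congrArg _ (τ.right_appPro _))
  cell_naturality α := by
    change H.mapCell (F.mapCell α) ≫ _ = _ ≫ H.mapCell (G.mapCell α)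
    rw [← H.mapCell_comp, ← H.mapCell_comp, τ.cell_naturality]
  appPro_unit a := by
    simp only [Iso.trans_hom, DblFunctor.mapCellIso_hom, Category.assoc]
    rw [← H.mapCell_comp, τ.appPro_unit, H.mapCell_comp, ← Category.assoc,
      ← H.mapUnit_naturality, Category.assoc]
  appPro_comp m n := by
    simp only [Iso.trans_hom, DblFunctor.mapCellIso_hom, Category.assoc]
    rw [← H.mapCell_comp, τ.appPro_comp, H.mapCell_comp, ← Category.assoc,
      ← H.mapComp_naturality, Category.assoc]

theorem eqToHom_app {F G : DblFunctor D E} (h : F = G) (a : D.Obj) :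
    DblNatTrans.app (eqToHom h) a = eqToHom (by rw [h]) := by
  subst h; rfl

theorem eqToHom_appPro {F G : DblFunctor D E} (h : F = G) {a b : D.Obj} (m : D.Pro a b) :
    DblNatTrans.appPro (eqToHom h) m = eqToHom (by rw [h]) := by
  subst h; rfl

end DblNatTrans

theorem eq_id_comp_id {C : Type*} [Category C] {X Y : C} (f : X ⟶ Y) : f = 𝟙 X ≫ f ≫ 𝟙 Y := by
  simp

theorem DblFunctor.id_comp' {D E : DblCat.{u, v}} (F : DblFunctor D E) :
    (DblFunctor.id D).comp F = F :=
  DblFunctor.ext_of_rfl rfl (fun _ => HEq.rfl) (fun _ => HEq.rfl) (fun _ => HEq.rfl)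
    (fun _ => heq_of_eq (by simp)) (fun _ _ => heq_of_eq (by simp))

theorem DblFunctor.comp_id' {D E : DblCat.{u, v}} (F : DblFunctor D E) :
    F.comp (DblFunctor.id E) = F :=
  DblFunctor.ext_of_rfl rfl (fun _ => HEq.rfl) (fun _ => HEq.rfl) (fun _ => HEq.rfl)
    (fun _ => heq_of_eq (by simp)) (fun _ _ => heq_of_eq (by simp))

theorem DblFunctor.comp_assoc' {D E K L : DblCat.{u, v}} (F : DblFunctor D E)
    (G : DblFunctor E K) (H : DblFunctor K L) : (F.comp G).comp H = F.comp (G.comp H) :=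
  DblFunctor.ext_of_rfl rfl (fun _ => HEq.rfl) (fun _ => HEq.rfl) (fun _ => HEq.rfl)
    (fun _ => heq_of_eq (by simp)) (fun _ _ => heq_of_eq (by simp))

namespace DblFunctor

variable {D E K L : DblCat.{u, v}}

/-- The unitor isomorphism, with identity components. -/
def leftUnitor (F : DblFunctor D E) : (DblFunctor.id D).comp F ≅ F where
  hom :=
    { app := fun _ => 𝟙 _
      naturality := fun _ => by simp
      appPro := fun _ => 𝟙 _
      left_appPro := fun _ => E.left_id _
      right_appPro := fun _ => E.right_id _
      cell_naturality := fun _ => by simp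
      appPro_unit := fun _ => by simp [E.unitCell_id]
      appPro_comp := fun _ _ => by simp }
  inv :=
    { app := fun _ => 𝟙 _
      naturality := fun _ => by simp
      appPro := fun _ => 𝟙 _
      left_appPro := fun _ => E.left_id _
      right_appPro := fun _ => E.right_id _
      cell_naturality := fun _ => by simp
      appPro_unit := fun _ => by simp [E.unitCell_id]
      appPro_comp := fun _ _ => by simp }
  hom_inv_id := DblNatTrans.hext (fun _ => Category.id_comp _) (fun _ => Category.id_comp _)
  inv_hom_id := DblNatTrans.hext (fun _ => Category.id_comp _) (fun _ => Category.id_comp _)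

/-- The unitor isomorphism, with identity components. -/
def rightUnitor (F : DblFunctor D E) : F.comp (DblFunctor.id E) ≅ F where
  hom :=
    { app := fun _ => 𝟙 _
      naturality := fun _ => by simp
      appPro := fun _ => 𝟙 _
      left_appPro := fun _ => E.left_id _
      right_appPro := fun _ => E.right_id _
      cell_naturality := fun _ => by simp
      appPro_unit := fun _ => by simp [E.unitCell_id]
      appPro_comp := fun _ _ => by simp }
  inv :=
    { app := fun _ => 𝟙 _
      naturality := fun _ => by simp
      appPro := fun _ => 𝟙 _
      left_appPro := fun _ => E.left_id _
      right_appPro := fun _ => E.right_id _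
      cell_naturality := fun _ => by simp
      appPro_unit := fun _ => by simp [E.unitCell_id]
      appPro_comp := fun _ _ => by simp }
  hom_inv_id := DblNatTrans.hext (fun _ => Category.id_comp _) (fun _ => Category.id_comp _)
  inv_hom_id := DblNatTrans.hext (fun _ => Category.id_comp _) (fun _ => Category.id_comp _)

/-- The associator isomorphism, with identity components. -/
def associator (F : DblFunctor D E) (G : DblFunctor E K) (H : DblFunctor K L) :
    (F.comp G).comp H ≅ F.comp (G.comp H) where
  hom :=
    { app := fun _ => 𝟙 _
      naturality := fun _ => by simp
      appPro := fun _ => 𝟙 _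
      left_appPro := fun _ => L.left_id _
      right_appPro := fun _ => L.right_id _
      cell_naturality := fun _ => by simp
      appPro_unit := fun _ => by simp [L.unitCell_id]
      appPro_comp := fun _ _ => by simp }
  inv :=
    { app := fun _ => 𝟙 _
      naturality := fun _ => by simp
      appPro := fun _ => 𝟙 _
      left_appPro := fun _ => L.left_id _
      right_appPro := fun _ => L.right_id _
      cell_naturality := fun _ => by simp
      appPro_unit := fun _ => by simp [L.unitCell_id]
      appPro_comp := fun _ _ => by simp }
  hom_inv_id := DblNatTrans.hext (fun _ => Category.id_comp _) (fun _ => Category.id_comp _)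
  inv_hom_id := DblNatTrans.hext (fun _ => Category.id_comp _) (fun _ => Category.id_comp _)

end DblFunctor

/-- The 2-category of (pseudo) double categories, (pseudo) double functors and natural
transformations. -/
instance : Bicategory DblCat.{u, v} where
  Hom D E := DblFunctor D E
  id D := DblFunctor.id D
  comp F G := F.comp G
  whiskerLeft F _ _ τ := DblNatTrans.whiskerLeft F τ
  whiskerRight τ H := DblNatTrans.whiskerRight τ H
  associator F G H := DblFunctor.associator F G H
  leftUnitor F := DblFunctor.leftUnitor F
  rightUnitor F := DblFunctor.rightUnitor F
  whiskerLeft_id F G := rfl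
  whiskerLeft_comp F _ _ _ σ τ := rfl
  id_whiskerLeft τ := DblNatTrans.hext
    (fun _ => eq_id_comp_id (DblNatTrans.app τ _)) (fun _ => eq_id_comp_id (DblNatTrans.appPro τ _))
  comp_whiskerLeft F G _ _ τ := DblNatTrans.hext
    (fun _ => eq_id_comp_id (DblNatTrans.app τ _)) (fun _ => eq_id_comp_id (DblNatTrans.appPro τ _))
  id_whiskerRight F G := DblNatTrans.hext
    (fun a => DblFunctor.map_id G _) (fun m => DblFunctor.mapCell_id G _)
  comp_whiskerRight _ _ G := DblNatTrans.hext
    (fun a => DblFunctor.map_comp G _ _) (fun m => DblFunctor.mapCell_comp G _ _)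
  whiskerRight_id τ := DblNatTrans.hext
    (fun _ => eq_id_comp_id (DblNatTrans.app τ _)) (fun _ => eq_id_comp_id (DblNatTrans.appPro τ _))
  whiskerRight_comp τ G H := DblNatTrans.hext
    (fun _ => eq_id_comp_id (DblFunctor.map H (DblFunctor.map G (DblNatTrans.app τ _))))
    (fun _ => eq_id_comp_id (DblFunctor.mapCell H (DblFunctor.mapCell G (DblNatTrans.appPro τ _))))
  whisker_assoc F _ _ τ H := DblNatTrans.hext
    (fun _ => eq_id_comp_id (DblFunctor.map H (DblNatTrans.app τ _)))
    (fun _ => eq_id_comp_id (DblFunctor.mapCell H (DblNatTrans.appPro τ _)))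
  whisker_exchange σ τ := DblNatTrans.hext
    (fun a => (DblNatTrans.naturality τ (DblNatTrans.app σ a)).symm)
    (fun m => (DblNatTrans.cell_naturality τ (DblNatTrans.appPro σ m)).symm)
  pentagon {_ _ _ _ E} F G H K := DblNatTrans.hext
    (fun a => show DblFunctor.map K (𝟙 _) ≫ 𝟙 _ ≫ 𝟙 _ = 𝟙 _ ≫ 𝟙 _ by
      rw [DblFunctor.map_id, Category.id_comp])
    (fun m => show DblFunctor.mapCell K (𝟙 _) ≫ 𝟙 _ ≫ 𝟙 _ = 𝟙 _ ≫ 𝟙 _ by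
      rw [DblFunctor.mapCell_id, Category.id_comp])
  triangle F G := DblNatTrans.hext
    (fun a => show 𝟙 _ ≫ 𝟙 _ = DblFunctor.map G (𝟙 _) by
      rw [DblFunctor.map_id, Category.id_comp])
    (fun m => show 𝟙 _ ≫ 𝟙 _ = DblFunctor.mapCell G (𝟙 _) by
      rw [DblFunctor.mapCell_id, Category.id_comp])

instance : Bicategory.Strict DblCat.{u, v} where
  id_comp F := DblFunctor.id_comp' F
  comp_id F := DblFunctor.comp_id' F
  assoc F G H := DblFunctor.comp_assoc' F G H
  leftUnitor_eqToIso F := Iso.ext (DblNatTrans.hext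
    (fun a => (DblNatTrans.eqToHom_app (DblFunctor.id_comp' F) a).symm)
    (fun m => (DblNatTrans.eqToHom_appPro (DblFunctor.id_comp' F) m).symm))
  rightUnitor_eqToIso F := Iso.ext (DblNatTrans.hext
    (fun a => (DblNatTrans.eqToHom_app (DblFunctor.comp_id' F) a).symm)
    (fun m => (DblNatTrans.eqToHom_appPro (DblFunctor.comp_id' F) m).symm))
  associator_eqToIso F G H := Iso.ext (DblNatTrans.hext
    (fun a => (DblNatTrans.eqToHom_app (DblFunctor.comp_assoc' F G H) a).symm)
    (fun m => (DblNatTrans.eqToHom_appPro (DblFunctor.comp_assoc' F G H) m).symm))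

namespace DblCat

/-- A double category is strict if external composition is strictly associative and unital and
the structure isomorphisms are identities. -/
structure IsStrict (D : DblCat.{u, v}) : Prop where
  pcomp_assoc {a b c d : D.Obj} (m : D.Pro a b) (n : D.Pro b c) (p : D.Pro c d) :
    D.pcomp (D.pcomp m n) p = D.pcomp m (D.pcomp n p)
  unit_pcomp {a b : D.Obj} (m : D.Pro a b) : D.pcomp (D.unit a) m = m
  pcomp_unit {a b : D.Obj} (m : D.Pro a b) : D.pcomp m (D.unit b) = m
  assoc_eq {a b c d : D.Obj} (m : D.Pro a b) (n : D.Pro b c) (p : D.Pro c d) :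
    D.assoc m n p = eqToIso (congrArg ProArr.mk (pcomp_assoc m n p))
  lunit_eq {a b : D.Obj} (m : D.Pro a b) :
    D.lunit m = eqToIso (congrArg ProArr.mk (unit_pcomp m))
  runit_eq {a b : D.Obj} (m : D.Pro a b) :
    D.runit m = eqToIso (congrArg ProArr.mk (pcomp_unit m))

variable {D E : DblCat.{u, v}}

namespace IsStrict

theorem hcomp_assoc (hD : D.IsStrict) {a b c d a' b' c' d' : D.Obj} {m : D.Pro a b} {n : D.Pro b c}
    {p : D.Pro c d} {m' : D.Pro a' b'} {n' : D.Pro b' c'} {p' : D.Pro c' d'}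
    (α : D.Cell m m') (β : D.Cell n n') (γ : D.Cell p p') (h : D.right α = D.left β)
    (h' : D.right β = D.left γ) :
    HEq (D.hcomp (D.hcomp α β h) γ ((D.right_hcomp α β h).trans h'))
      (D.hcomp α (D.hcomp β γ h') (h.trans (D.left_hcomp β γ h').symm)) := by
  have := D.assoc_naturality α β γ h h'
  rw [hD.assoc_eq, hD.assoc_eq, eqToIso.hom, eqToIso.hom] at this
  exact D.heq_of_comm _ _ this

theorem unit_hcomp (hD : D.IsStrict) {a b a' b' : D.Obj} {m : D.Pro a b} {m' : D.Pro a' b'} (f : a ⟶ a')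
    (α : D.Cell m m') (h : D.right (D.unitCell f) = D.left α) :
    HEq (D.hcomp (D.unitCell f) α h) α := by
  have hf : f = D.left α := (D.right_unitCell f).symm.trans h
  subst hf
  have := D.lunit_naturality α
  rw [hD.lunit_eq, hD.lunit_eq, eqToIso.hom, eqToIso.hom] at this
  exact D.heq_of_comm _ _ this

theorem hcomp_unit (hD : D.IsStrict) {a b a' b' : D.Obj} {m : D.Pro a b} {m' : D.Pro a' b'} (f : b ⟶ b')
    (α : D.Cell m m') (h : D.right α = D.left (D.unitCell f)) :
    HEq (D.hcomp α (D.unitCell f) h) α := by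
  have hf : f = D.right α := (D.left_unitCell f).symm.trans h.symm
  subst hf
  have := D.runit_naturality α
  rw [hD.runit_eq, hD.runit_eq, eqToIso.hom, eqToIso.hom] at this
  exact D.heq_of_comm _ _ this

theorem unit_comm (hD : D.IsStrict) {a b : D.Obj} (m : D.Pro a b) :
    D.pcomp m (D.unit b) = D.pcomp (D.unit a) m :=
  (hD.pcomp_unit m).trans (hD.unit_pcomp m).symm

theorem unitCell_comm (hD : D.IsStrict) {a b a' b' : D.Obj} {m : D.Pro a b} {m' : D.Pro a' b'} (f : a ⟶ a')
    (g : b ⟶ b') (α : D.Cell m m') (h : D.right α = D.left (D.unitCell g))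
    (h' : D.right (D.unitCell f) = D.left α) :
    HEq (D.hcomp α (D.unitCell g) h) (D.hcomp (D.unitCell f) α h') :=
  (hD.hcomp_unit g α h).trans (hD.unit_hcomp f α h').symm

theorem eq_unit_unit (hD : D.IsStrict) {a b : D.Obj} (m : D.Pro a b) :
    m = D.pcomp (D.unit a) (D.pcomp m (D.unit b)) := by
  rw [hD.pcomp_unit, hD.unit_pcomp]

theorem heq_unit_unit (hD : D.IsStrict) {a b a' b' : D.Obj} {m : D.Pro a b} {m' : D.Pro a' b'}
    (f : a ⟶ a') (g : b ⟶ b') (α : D.Cell m m') (h : D.right α = D.left (D.unitCell g))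
    (h' : D.right (D.unitCell f) = D.left (D.hcomp α (D.unitCell g) h)) :
    HEq α (D.hcomp (D.unitCell f) (D.hcomp α (D.unitCell g) h) h') :=
  ((hD.unit_hcomp _ _ _).trans (hD.hcomp_unit _ _ _)).symm

end IsStrict

end DblCat

namespace DblFunctor

variable {D E K : DblCat.{u, v}}

/-- A double functor is strict if it strictly preserves external composition and identities and
its comparison cells are identities. -/
structure IsStrict (F : DblFunctor D E) : Prop where
  mapPro_unit (a : D.Obj) : E.unit (F.obj a) = F.mapPro (D.unit a)
  mapPro_pcomp {a b c : D.Obj} (m : D.Pro a b) (n : D.Pro b c) :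
    E.pcomp (F.mapPro m) (F.mapPro n) = F.mapPro (D.pcomp m n)
  mapUnit_eq (a : D.Obj) : F.mapUnit a = eqToIso (congrArg ProArr.mk (mapPro_unit a))
  mapComp_eq {a b c : D.Obj} (m : D.Pro a b) (n : D.Pro b c) :
    F.mapComp m n = eqToIso (congrArg ProArr.mk (mapPro_pcomp m n))

theorem IsStrict.hcomp {F : DblFunctor D E} (hF : F.IsStrict) {a b c a' b' c' : D.Obj}
    {m : D.Pro a b} {n : D.Pro b c} {m' : D.Pro a' b'} {n' : D.Pro b' c'} (α : D.Cell m m')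
    (β : D.Cell n n') (h : D.right α = D.left β)
    (h' : E.right (F.mapCell α) = E.left (F.mapCell β)) :
    HEq (E.hcomp (F.mapCell α) (F.mapCell β) h') (F.mapCell (D.hcomp α β h)) := by
  have := F.mapComp_naturality α β h
  rw [hF.mapComp_eq, hF.mapComp_eq, eqToIso.hom, eqToIso.hom] at this
  exact E.heq_of_comm _ _ this

theorem IsStrict.unitCell {F : DblFunctor D E} (hF : F.IsStrict) {a b : D.Obj} (f : a ⟶ b) :
    HEq (E.unitCell (F.map f)) (F.mapCell (D.unitCell f)) := by
  have := F.mapUnit_naturality f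
  rw [hF.mapUnit_eq, hF.mapUnit_eq, eqToIso.hom, eqToIso.hom] at this
  exact E.heq_of_comm _ _ this

theorem mapCell_heq (F : DblFunctor D E) {a b c d : D.Obj} {m m' : D.Pro a b} {n n' : D.Pro c d}
    {α : D.Cell m n} {α' : D.Cell m' n'} (hm : m = m') (hn : n = n') (h : HEq α α') :
    HEq (F.mapCell α) (F.mapCell α') := by
  subst hm hn; cases h; rfl

theorem mapCell_eqToHom (F : DblFunctor D E) {a b : D.Obj} {m m' : D.Pro a b} (hm : m = m') :
    F.mapCell (eqToHom (congrArg ProArr.mk hm)) =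
      eqToHom (congrArg ProArr.mk (congrArg F.mapPro hm)) := by
  subst hm; simp

theorem IsStrict.id (D : DblCat.{u, v}) : (DblFunctor.id D).IsStrict where
  mapPro_unit _ := rfl
  mapPro_pcomp _ _ := rfl
  mapUnit_eq _ := rfl
  mapComp_eq _ _ := rfl

theorem IsStrict.comp {F : DblFunctor D E} {G : DblFunctor E K} (hF : F.IsStrict)
    (hG : G.IsStrict) : (F.comp G).IsStrict where
  mapPro_unit a := (hG.mapPro_unit _).trans (congrArg G.mapPro (hF.mapPro_unit a))
  mapPro_pcomp m n := (hG.mapPro_pcomp _ _).trans (congrArg G.mapPro (hF.mapPro_pcomp m n))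
  mapUnit_eq a := Iso.ext (by
    change (G.mapUnit _).hom ≫ G.mapCell (F.mapUnit a).hom = _
    rw [hG.mapUnit_eq, hF.mapUnit_eq, eqToIso.hom, eqToIso.hom, G.mapCell_eqToHom (hF.mapPro_unit a),
      eqToHom_trans]; rfl)
  mapComp_eq m n := Iso.ext (by
    change (G.mapComp _ _).hom ≫ G.mapCell (F.mapComp m n).hom = _
    rw [hG.mapComp_eq, hF.mapComp_eq, eqToIso.hom, eqToIso.hom,
      G.mapCell_eqToHom (hF.mapPro_pcomp m n), eqToHom_trans]; rfl)

end DblFunctor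

/-- The image of a companion under a double functor. -/
@[simps]
def DblCat.Companion.map {D E : DblCat.{u, v}} (F : DblFunctor D E) {x y : D.Obj} {f : x ⟶ y}
    (c : D.Companion f) : E.Companion (F.map f) where
  pro := F.mapPro c.pro
  η := (F.mapUnit x).hom ≫ F.mapCell c.η
  ε := F.mapCell c.ε ≫ (F.mapUnit y).inv
  left_η := by simp
  right_η := by simp
  left_ε := by simp
  right_ε := by simp
  η_ε := by
    rw [Category.assoc, ← Category.assoc (F.mapCell _), ← F.mapCell_comp, c.η_ε,
      ← Category.assoc, ← F.mapUnit_naturality, Category.assoc, Iso.hom_inv_id, Category.comp_id]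
  ε_η := by
    have h : E.hcomp ((F.mapUnit x).hom ≫ F.mapCell c.η) (F.mapCell c.ε ≫ (F.mapUnit y).inv)
        (by simp) = E.hcomp (F.mapUnit x).hom (𝟙 (ProArr.mk (F.mapPro c.pro))) (by simp) ≫
        E.hcomp (F.mapCell c.η) (F.mapCell c.ε) (by simp) ≫
        E.hcomp (𝟙 (ProArr.mk (F.mapPro c.pro))) (F.mapUnit y).inv (by simp) := by
      rw [← E.hcomp_comp, ← E.hcomp_comp]
      exact E.hcomp_congr (by simp) (by simp) _
    have h2 : E.hcomp (𝟙 (ProArr.mk (F.mapPro c.pro))) (F.mapUnit y).inv (by simp) ≫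
        E.hcomp (𝟙 (ProArr.mk (F.mapPro c.pro))) (F.mapUnit y).hom (by simp) = 𝟙 _ := by
      rw [← E.hcomp_comp, ← E.hcomp_id]; exact E.hcomp_congr (by simp) (by simp) _
    have h3 := F.mapComp_naturality c.η c.ε (by simp)
    rw [c.hcomp_eq, F.mapCell_comp] at h3
    rw [h, Iso.inv_comp_eq, ← F.mapComp_lunit, ← F.mapComp_runit]
    simp only [Category.assoc, Category.comp_id]
    congr 1
    rw [← Category.assoc (E.hcomp _ (F.mapUnit y).inv _), h2, Category.id_comp, ← Category.assoc,
      h3]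
    simp only [Category.assoc]
    rw [← F.mapCell_comp, Iso.inv_hom_id, F.mapCell_id, Category.comp_id]

theorem DblCat.Companion.map_map {D E K : DblCat.{u, v}} (F : DblFunctor D E)
    (G : DblFunctor E K) {x y : D.Obj} {f : x ⟶ y} (c : D.Companion f) :
    c.map (F.comp G) = (c.map F).map G :=
  DblCat.Companion.ext rfl
    (heq_of_eq ((Category.assoc _ _ _).trans (congrArg (_ ≫ ·) (G.mapCell_comp _ _).symm)))
    (heq_of_eq ((Category.assoc _ _ _).symm.trans (congrArg (· ≫ _) (G.mapCell_comp _ _).symm)))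

/-- A strict protransformation between double functors: its components at objects are proarrows
and its components at arrows are cells. -/
structure ProTrans {D E : DblCat.{u, v}} (F G : DblFunctor D E) where
  app (a : D.Obj) : E.Pro (F.obj a) (G.obj a)
  appArr {a b : D.Obj} (f : a ⟶ b) : E.Cell (app a) (app b)
  left_appArr {a b : D.Obj} (f : a ⟶ b) : E.left (appArr f) = F.map f
  right_appArr {a b : D.Obj} (f : a ⟶ b) : E.right (appArr f) = G.map f
  appArr_id (a : D.Obj) : appArr (𝟙 a) = 𝟙 (ProArr.mk (app a))
  appArr_comp {a b c : D.Obj} (f : a ⟶ b) (g : b ⟶ c) :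
    appArr (f ≫ g) = appArr f ≫ appArr g
  naturality {a b : D.Obj} (m : D.Pro a b) :
    E.pcomp (F.mapPro m) (app b) = E.pcomp (app a) (G.mapPro m)
  cell_naturality {a b c d : D.Obj} {m : D.Pro a b} {n : D.Pro c d} (α : D.Cell m n) :
    HEq (E.hcomp (F.mapCell α) (appArr (D.right α))
        ((F.right_mapCell α).trans (left_appArr (D.right α)).symm))
      (E.hcomp (appArr (D.left α)) (G.mapCell α)
        ((right_appArr (D.left α)).trans (G.left_mapCell α).symm))

namespace ProTrans

attribute [simp] left_appArr right_appArr

variable {D E K : DblCat.{u, v}} {F G H I : DblFunctor D E}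

theorem hext {σ τ : ProTrans F G} (h : ∀ a, σ.app a = τ.app a)
    (h' : ∀ {a b : D.Obj} (f : a ⟶ b), HEq (σ.appArr f) (τ.appArr f)) : σ = τ := by
  obtain ⟨s, s', _, _, _, _, _, _⟩ := σ
  obtain ⟨t, t', _, _, _, _, _, _⟩ := τ
  obtain rfl : s = t := funext h
  obtain rfl : @s' = @t' := by
    funext a b f; exact eq_of_heq (h' f)
  rfl

theorem cell_naturality' (τ : ProTrans F G) {a b c d : D.Obj} {m : D.Pro a b} {n : D.Pro c d}
    (α : D.Cell m n) {f : a ⟶ c} {g : b ⟶ d} (hf : D.left α = f) (hg : D.right α = g)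
    (h : E.right (F.mapCell α) = E.left (τ.appArr g))
    (h' : E.right (τ.appArr f) = E.left (G.mapCell α)) :
    HEq (E.hcomp (F.mapCell α) (τ.appArr g) h) (E.hcomp (τ.appArr f) (G.mapCell α) h') := by
  subst hf hg; exact τ.cell_naturality α

/-- The identity protransformation. -/
@[simps]
def id (hE : E.IsStrict) (F : DblFunctor D E) : ProTrans F F where
  app a := E.unit (F.obj a)
  appArr f := E.unitCell (F.map f)
  left_appArr _ := by simp
  right_appArr _ := by simp
  appArr_id _ := by simp [E.unitCell_id]
  appArr_comp _ _ := by simp [E.unitCell_comp]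
  naturality m := hE.unit_comm _
  cell_naturality α := hE.unitCell_comm _ _ _ _ _

/-- Composition of strict protransformations. -/
@[simps]
def comp (hE : E.IsStrict) (σ : ProTrans F G) (τ : ProTrans G H) : ProTrans F H where
  app a := E.pcomp (σ.app a) (τ.app a)
  appArr f := E.hcomp (σ.appArr f) (τ.appArr f) (by simp)
  left_appArr _ := by simp
  right_appArr _ := by simp
  appArr_id a := by
    rw [← E.hcomp_id]; exact E.hcomp_congr (σ.appArr_id a) (τ.appArr_id a) _
  appArr_comp f g := by
    rw [← E.hcomp_comp]; exact E.hcomp_congr (σ.appArr_comp f g) (τ.appArr_comp f g) _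
  naturality m := by
    rw [← hE.pcomp_assoc, σ.naturality, hE.pcomp_assoc, τ.naturality, hE.pcomp_assoc]
  cell_naturality {a b c d m n} α := by
    refine (hE.hcomp_assoc _ _ _ (by simp) (by simp)).symm.trans ?_
    refine HEq.trans ?_ (hE.hcomp_assoc _ _ _ (by simp) (by simp)).symm
    refine (E.hcomp_heq (σ.naturality m) (σ.naturality n) rfl rfl (σ.cell_naturality α) HEq.rfl
      _ (by simp)).trans ?_
    refine (hE.hcomp_assoc _ _ _ (by simp) (by simp)).trans ?_
    exact E.hcomp_heq rfl rfl (τ.naturality m) (τ.naturality n) HEq.rfl (τ.cell_naturality α) _ _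

/-- Whiskering on the left. -/
@[simps]
def whiskerLeft (F : DblFunctor D E) {G H : DblFunctor E K} (τ : ProTrans G H) :
    ProTrans (F.comp G) (F.comp H) where
  app a := τ.app (F.obj a)
  appArr f := τ.appArr (F.map f)
  left_appArr f := τ.left_appArr _
  right_appArr f := τ.right_appArr _
  appArr_id a := by rw [F.map_id, τ.appArr_id]
  appArr_comp f g := by rw [F.map_comp, τ.appArr_comp]
  naturality m := τ.naturality (F.mapPro m)
  cell_naturality α := by
    exact τ.cell_naturality' (F.mapCell α) (F.left_mapCell α) (F.right_mapCell α) _ _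

/-- Whiskering on the right with a strict double functor. -/
@[simps]
def whiskerRight (τ : ProTrans F G) (H : DblFunctor E K) (hH : H.IsStrict) :
    ProTrans (F.comp H) (G.comp H) where
  app a := H.mapPro (τ.app a)
  appArr f := H.mapCell (τ.appArr f)
  left_appArr f := (H.left_mapCell _).trans (congrArg _ (τ.left_appArr f))
  right_appArr f := (H.right_mapCell _).trans (congrArg _ (τ.right_appArr f))
  appArr_id a := by rw [τ.appArr_id, H.mapCell_id]
  appArr_comp f g := by rw [τ.appArr_comp, H.mapCell_comp]
  naturality m :=
    (hH.mapPro_pcomp _ _).trans ((congrArg H.mapPro (τ.naturality m)).trans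
      (hH.mapPro_pcomp _ _).symm)
  cell_naturality {a b c d m n} α :=
    (hH.hcomp _ _ (by simp) _).trans ((H.mapCell_heq (τ.naturality m) (τ.naturality n)
      (τ.cell_naturality α)).trans (hH.hcomp _ _ (by simp) _).symm)

end ProTrans

/-- A strict double category equipped with a functorial choice of companions: each arrow has a
chosen companion, the chosen companion of an identity is the external identity, and the chosen
companion of a composite is the composite of the chosen companions. -/
structure CompDblCat where
  dbl : DblCat.{u, v}
  strict : dbl.IsStrict
  companion {x y : dbl.Obj} (f : x ⟶ y) : dbl.Companion f
  companion_id (x : dbl.Obj) : companion (𝟙 x) = DblCat.Companion.id dbl x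
  companion_comp {x y z : dbl.Obj} (f : x ⟶ y) (g : y ⟶ z) :
    companion (f ≫ g) = (companion f).comp (companion g)

/-- A strict double functor preserving the chosen companions. -/
@[ext]
structure CompDblFunctor (C D : CompDblCat.{u, v}) where
  functor : DblFunctor C.dbl D.dbl
  strict : functor.IsStrict
  map_companion {x y : C.dbl.Obj} (f : x ⟶ y) :
    (C.companion f).map functor = D.companion (functor.map f)

namespace CompDblFunctor

/-- The identity functor. -/
@[simps]
abbrev id (C : CompDblCat.{u, v}) : CompDblFunctor C C where
  functor := DblFunctor.id C.dbl
  strict := DblFunctor.IsStrict.id C.dbl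
  map_companion f := DblCat.Companion.ext rfl (heq_of_eq (Category.id_comp _))
    (heq_of_eq (Category.comp_id _))

/-- Composition of strict double functors preserving the chosen companions. -/
@[simps]
abbrev comp {C D E : CompDblCat.{u, v}} (F : CompDblFunctor C D) (G : CompDblFunctor D E) :
    CompDblFunctor C E where
  functor := F.functor.comp G.functor
  strict := F.strict.comp G.strict
  map_companion f := by
    rw [DblCat.Companion.map_map, F.map_companion, G.map_companion]

/-- Strict double functors preserving chosen companions and strict protransformations form a
category. -/
instance (C D : CompDblCat.{u, v}) : Category (CompDblFunctor C D) where
  Hom F G := ProTrans F.functor G.functor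
  id F := ProTrans.id D.strict F.functor
  comp σ τ := ProTrans.comp D.strict σ τ
  id_comp _ := ProTrans.hext (fun _ => D.strict.unit_pcomp _) (fun _ => D.strict.unit_hcomp _ _ _)
  comp_id _ := ProTrans.hext (fun _ => D.strict.pcomp_unit _) (fun _ => D.strict.hcomp_unit _ _ _)
  assoc _ _ _ := ProTrans.hext (fun _ => D.strict.pcomp_assoc _ _ _)
    (fun _ => D.strict.hcomp_assoc _ _ _ _ _)


variable {C D E K : CompDblCat.{u, v}}

theorem id_comp' (F : CompDblFunctor C D) : (id C).comp F = F :=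
  CompDblFunctor.ext (DblFunctor.id_comp' F.functor)

theorem comp_id' (F : CompDblFunctor C D) : F.comp (id D) = F :=
  CompDblFunctor.ext (DblFunctor.comp_id' F.functor)

theorem comp_assoc' (F : CompDblFunctor C D) (G : CompDblFunctor D E) (H : CompDblFunctor E K) :
    (F.comp G).comp H = F.comp (G.comp H) :=
  CompDblFunctor.ext (DblFunctor.comp_assoc' F.functor G.functor H.functor)

/-- The unitor isomorphism, with identity components. -/
def leftUnitor (F : CompDblFunctor C D) : (id C).comp F ≅ F where
  hom :=
    { app := fun a => D.dbl.unit (F.functor.obj a)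
      appArr := fun f => D.dbl.unitCell (F.functor.map f)
      left_appArr := fun _ => D.dbl.left_unitCell _
      right_appArr := fun _ => D.dbl.right_unitCell _
      appArr_id := fun _ => by rw [F.functor.map_id, D.dbl.unitCell_id]
      appArr_comp := fun _ _ => by rw [F.functor.map_comp, D.dbl.unitCell_comp]
      naturality := fun _ => D.strict.unit_comm _
      cell_naturality := fun _ => D.strict.unitCell_comm _ _ _ _ _ }
  inv :=
    { app := fun a => D.dbl.unit (F.functor.obj a)
      appArr := fun f => D.dbl.unitCell (F.functor.map f)
      left_appArr := fun _ => D.dbl.left_unitCell _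
      right_appArr := fun _ => D.dbl.right_unitCell _
      appArr_id := fun _ => by rw [F.functor.map_id, D.dbl.unitCell_id]
      appArr_comp := fun _ _ => by rw [F.functor.map_comp, D.dbl.unitCell_comp]
      naturality := fun _ => D.strict.unit_comm _
      cell_naturality := fun _ => D.strict.unitCell_comm _ _ _ _ _ }
  hom_inv_id := ProTrans.hext (fun _ => D.strict.unit_pcomp _) (fun _ => D.strict.unit_hcomp _ _ _)
  inv_hom_id := ProTrans.hext (fun _ => D.strict.unit_pcomp _) (fun _ => D.strict.unit_hcomp _ _ _)

/-- The unitor isomorphism, with identity components. -/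
def rightUnitor (F : CompDblFunctor C D) : F.comp (id D) ≅ F where
  hom :=
    { app := fun a => D.dbl.unit (F.functor.obj a)
      appArr := fun f => D.dbl.unitCell (F.functor.map f)
      left_appArr := fun _ => D.dbl.left_unitCell _
      right_appArr := fun _ => D.dbl.right_unitCell _
      appArr_id := fun _ => by rw [F.functor.map_id, D.dbl.unitCell_id]
      appArr_comp := fun _ _ => by rw [F.functor.map_comp, D.dbl.unitCell_comp]
      naturality := fun _ => D.strict.unit_comm _
      cell_naturality := fun _ => D.strict.unitCell_comm _ _ _ _ _ }
  inv :=
    { app := fun a => D.dbl.unit (F.functor.obj a)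
      appArr := fun f => D.dbl.unitCell (F.functor.map f)
      left_appArr := fun _ => D.dbl.left_unitCell _
      right_appArr := fun _ => D.dbl.right_unitCell _
      appArr_id := fun _ => by rw [F.functor.map_id, D.dbl.unitCell_id]
      appArr_comp := fun _ _ => by rw [F.functor.map_comp, D.dbl.unitCell_comp]
      naturality := fun _ => D.strict.unit_comm _
      cell_naturality := fun _ => D.strict.unitCell_comm _ _ _ _ _ }
  hom_inv_id := ProTrans.hext (fun _ => D.strict.unit_pcomp _) (fun _ => D.strict.unit_hcomp _ _ _)
  inv_hom_id := ProTrans.hext (fun _ => D.strict.unit_pcomp _) (fun _ => D.strict.unit_hcomp _ _ _)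

/-- The associator isomorphism, with identity components. -/
def associator (F : CompDblFunctor C D) (G : CompDblFunctor D E) (H : CompDblFunctor E K) :
    (F.comp G).comp H ≅ F.comp (G.comp H) where
  hom :=
    { app := fun a => K.dbl.unit (H.functor.obj (G.functor.obj (F.functor.obj a)))
      appArr := fun f => K.dbl.unitCell (H.functor.map (G.functor.map (F.functor.map f)))
      left_appArr := fun _ => K.dbl.left_unitCell _
      right_appArr := fun _ => K.dbl.right_unitCell _
      appArr_id := fun _ => by
        rw [F.functor.map_id, G.functor.map_id, H.functor.map_id, K.dbl.unitCell_id]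
      appArr_comp := fun _ _ => by
        rw [F.functor.map_comp, G.functor.map_comp, H.functor.map_comp, K.dbl.unitCell_comp]
      naturality := fun _ => K.strict.unit_comm _
      cell_naturality := fun _ => K.strict.unitCell_comm _ _ _ _ _ }
  inv :=
    { app := fun a => K.dbl.unit (H.functor.obj (G.functor.obj (F.functor.obj a)))
      appArr := fun f => K.dbl.unitCell (H.functor.map (G.functor.map (F.functor.map f)))
      left_appArr := fun _ => K.dbl.left_unitCell _
      right_appArr := fun _ => K.dbl.right_unitCell _
      appArr_id := fun _ => by
        rw [F.functor.map_id, G.functor.map_id, H.functor.map_id, K.dbl.unitCell_id]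
      appArr_comp := fun _ _ => by
        rw [F.functor.map_comp, G.functor.map_comp, H.functor.map_comp, K.dbl.unitCell_comp]
      naturality := fun _ => K.strict.unit_comm _
      cell_naturality := fun _ => K.strict.unitCell_comm _ _ _ _ _ }
  hom_inv_id := ProTrans.hext (fun _ => K.strict.unit_pcomp _) (fun _ => K.strict.unit_hcomp _ _ _)
  inv_hom_id := ProTrans.hext (fun _ => K.strict.unit_pcomp _) (fun _ => K.strict.unit_hcomp _ _ _)

end CompDblFunctor

/-- The 2-category of strict double categories with a functorial choice of companions, strict
double functors preserving the chosen companions, and strict protransformations. -/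
instance : Bicategory CompDblCat.{u, v} where
  Hom C D := CompDblFunctor C D
  id C := CompDblFunctor.id C
  comp F G := F.comp G
  whiskerLeft F _ _ τ := ProTrans.whiskerLeft F.functor τ
  whiskerRight τ H := ProTrans.whiskerRight τ H.functor H.strict
  associator F G H := CompDblFunctor.associator F G H
  leftUnitor F := CompDblFunctor.leftUnitor F
  rightUnitor F := CompDblFunctor.rightUnitor F
  whiskerLeft_id F G := rfl
  whiskerLeft_comp F _ _ _ σ τ := rfl
  id_whiskerLeft {_ D _ _} τ := ProTrans.hext (fun _ => D.strict.eq_unit_unit _)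
    (fun _ => D.strict.heq_unit_unit _ _ _ _ _)
  comp_whiskerLeft {_ _ _ D} F G _ _ τ := ProTrans.hext (fun _ => D.strict.eq_unit_unit _)
    (fun _ => D.strict.heq_unit_unit _ _ _ _ _)
  id_whiskerRight F G := ProTrans.hext
    (fun _ => ((CompDblFunctor.strict G).mapPro_unit _).symm)
    (fun _ => ((CompDblFunctor.strict G).unitCell _).symm)
  comp_whiskerRight σ τ G := ProTrans.hext
    (fun _ => ((CompDblFunctor.strict G).mapPro_pcomp _ _).symm)
    (fun _ => ((CompDblFunctor.strict G).hcomp _ _ _ _).symm)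
  whiskerRight_id {_ D _ _} τ := ProTrans.hext (fun _ => D.strict.eq_unit_unit _)
    (fun _ => D.strict.heq_unit_unit _ _ _ _ _)
  whiskerRight_comp {_ _ _ D _ _} τ G H := ProTrans.hext (fun _ => D.strict.eq_unit_unit _)
    (fun _ => D.strict.heq_unit_unit _ _ _ _ _)
  whisker_assoc {_ _ _ D} F _ _ τ H := ProTrans.hext (fun _ => D.strict.eq_unit_unit _)
    (fun _ => D.strict.heq_unit_unit _ _ _ _ _)
  whisker_exchange σ τ := ProTrans.hext
    (fun a => (ProTrans.naturality τ (ProTrans.app σ a)).symm)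
    (fun f => (ProTrans.cell_naturality' τ (ProTrans.appArr σ f) (ProTrans.left_appArr σ f)
      (ProTrans.right_appArr σ f) _ _).symm)
  pentagon {_ _ _ _ E} F G H K := by
    have h := fun a => (CompDblFunctor.strict K).mapPro_unit
      (H.functor.obj (G.functor.obj (F.functor.obj a)))
    refine ProTrans.hext (fun a => ?_) (fun {a b} f => ?_)
    · exact (congrArg (fun m => E.dbl.pcomp m (E.dbl.pcomp (E.dbl.unit _) (E.dbl.unit _)))
        (h a).symm).trans (E.strict.unit_pcomp _)
    · have h' := (CompDblFunctor.strict K).unitCell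
        (H.functor.map (G.functor.map (F.functor.map f)))
      have h'' : E.dbl.right (E.dbl.unitCell
          (K.functor.map (H.functor.map (G.functor.map (F.functor.map f))))) =
        E.dbl.left (E.dbl.hcomp (E.dbl.unitCell
          (K.functor.map (H.functor.map (G.functor.map (F.functor.map f)))))
          (E.dbl.unitCell
          (K.functor.map (H.functor.map (G.functor.map (F.functor.map f))))) (by simp)) := by
        simp
      exact (E.dbl.hcomp_heq (h a).symm (h b).symm rfl rfl h'.symm HEq.rfl _ h'').trans
        (E.strict.unit_hcomp _ _ h'')
  triangle {_ _ E} F G := ProTrans.hext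
    (fun a => (E.strict.unit_pcomp _).trans ((CompDblFunctor.strict G).mapPro_unit _))
    (fun f => (E.strict.unit_hcomp _ _ _).trans ((CompDblFunctor.strict G).unitCell _))

theorem ProTrans.eqToHom_app {C D : CompDblCat.{u, v}} {F G : CompDblFunctor C D} (h : F = G)
    (a : C.dbl.Obj) : HEq (ProTrans.app (eqToHom h) a) (D.dbl.unit (F.functor.obj a)) := by
  subst h; rfl

theorem ProTrans.eqToHom_appArr {C D : CompDblCat.{u, v}} {F G : CompDblFunctor C D} (h : F = G)
    {a b : C.dbl.Obj} (f : a ⟶ b) :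
    HEq (ProTrans.appArr (eqToHom h) f) (D.dbl.unitCell (F.functor.map f)) := by
  subst h; rfl

instance : Bicategory.Strict CompDblCat.{u, v} where
  id_comp F := CompDblFunctor.id_comp' F
  comp_id F := CompDblFunctor.comp_id' F
  assoc F G H := CompDblFunctor.comp_assoc' F G H
  leftUnitor_eqToIso F := Iso.ext (ProTrans.hext
    (fun a => (eq_of_heq (ProTrans.eqToHom_app (CompDblFunctor.id_comp' F) a)).symm)
    (fun m => (ProTrans.eqToHom_appArr (CompDblFunctor.id_comp' F) m).symm))
  rightUnitor_eqToIso F := Iso.ext (ProTrans.hext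
    (fun a => (eq_of_heq (ProTrans.eqToHom_app (CompDblFunctor.comp_id' F) a)).symm)
    (fun m => (ProTrans.eqToHom_appArr (CompDblFunctor.comp_id' F) m).symm))
  associator_eqToIso F G H := Iso.ext (ProTrans.hext
    (fun a => (eq_of_heq (ProTrans.eqToHom_app (CompDblFunctor.comp_assoc' F G H) a)).symm)
    (fun m => (ProTrans.eqToHom_appArr (CompDblFunctor.comp_assoc' F G H) m).symm))

/-- A cell of the transpose of `D`, from the arrow `f` to the arrow `g`: a cell of `D` with left
side `f` and right side `g`. -/
structure TCell (D : DblCat.{u, v}) {a b c d : D.Obj} (f : a ⟶ c) (g : b ⟶ d) where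
  top : D.Pro a b
  bot : D.Pro c d
  cell : D.Cell top bot
  left_cell : D.left cell = f
  right_cell : D.right cell = g

namespace TCell

attribute [simp] left_cell right_cell

variable {D : DblCat.{u, v}}

theorem hext {a b c d : D.Obj} {f f' : a ⟶ c} {g g' : b ⟶ d} {α : TCell D f g}
    {β : TCell D f' g'} (ht : α.top = β.top) (hb : α.bot = β.bot) (hc : HEq α.cell β.cell) :
    HEq α β := by
  obtain ⟨t, b, c, h1, h2⟩ := α
  obtain ⟨t', b', c', h1', h2'⟩ := β
  dsimp only at *
  subst ht hb
  cases hc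
  subst h1 h2 h1' h2'
  rfl

theorem ext' {a b c d : D.Obj} {f : a ⟶ c} {g : b ⟶ d} {α β : TCell D f g}
    (ht : α.top = β.top) (hb : α.bot = β.bot) (hc : HEq α.cell β.cell) : α = β :=
  eq_of_heq (hext ht hb hc)

/-- The identity cell between equal arrows. -/
@[simps]
def ofEq {a b : D.Obj} {f g : a ⟶ b} (h : f = g) : TCell D f g where
  top := D.unit a
  bot := D.unit b
  cell := D.unitCell f
  left_cell := D.left_unitCell f
  right_cell := (D.right_unitCell f).trans h

/-- Composition of transposed cells along arrows. -/
@[simps]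
def vcomp {a b c d e k : D.Obj} {f : a ⟶ d} {g : b ⟶ e} {h : c ⟶ k} (α : TCell D f g)
    (β : TCell D g h) : TCell D f h where
  top := D.pcomp α.top β.top
  bot := D.pcomp α.bot β.bot
  cell := D.hcomp α.cell β.cell (by simp)
  left_cell := by simp
  right_cell := by simp

/-- Composition of transposed cells along proarrows. -/
@[simps]
def hcomp {a b c d e k : D.Obj} {f : a ⟶ b} {g : b ⟶ c} {f' : d ⟶ e} {g' : e ⟶ k}
    (α : TCell D f f') (β : TCell D g g') (h : α.bot = β.top) : TCell D (f ≫ g) (f' ≫ g') where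
  top := α.top
  bot := β.bot
  cell := α.cell ≫ eqToHom (congrArg ProArr.mk h) ≫ β.cell
  left_cell := by rw [D.left_comp, D.left_comp, D.left_eqToHom h, Category.id_comp, α.left_cell,
    β.left_cell]
  right_cell := by rw [D.right_comp, D.right_comp, D.right_eqToHom h, Category.id_comp,
    α.right_cell, β.right_cell]

theorem vcomp_ofEq (hD : D.IsStrict) {a b d e : D.Obj} {f : a ⟶ d} {g g' : b ⟶ e}
    (α : TCell D f g) (h : g = g') : HEq (α.vcomp (ofEq h)) α :=
  hext (hD.pcomp_unit _) (hD.pcomp_unit _) (hD.hcomp_unit _ _ _)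

theorem ofEq_vcomp (hD : D.IsStrict) {a b d e : D.Obj} {f f' : a ⟶ d} {g : b ⟶ e}
    (α : TCell D f' g) (h : f = f') : HEq ((ofEq h).vcomp α) α :=
  hext (hD.unit_pcomp _) (hD.unit_pcomp _) (hD.unit_hcomp _ _ _)

theorem hcomp_ofEq {a b c : D.Obj} {f f' : a ⟶ b} {g g' : b ⟶ c} (h : f = f') (h' : g = g') :
    (ofEq h).hcomp (ofEq h') rfl = ofEq (congrArg₂ (· ≫ ·) h h') :=
  ext' rfl rfl (heq_of_eq (by
    change D.unitCell f ≫ 𝟙 _ ≫ D.unitCell g = D.unitCell (f ≫ g)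
    rw [Category.id_comp, D.unitCell_comp]))

theorem hcomp_heq {a b c d e k : D.Obj} {f₁ f₂ : a ⟶ b} {g₁ g₂ : b ⟶ c} {f₁' f₂' : d ⟶ e}
    {g₁' g₂' : e ⟶ k} {α₁ : TCell D f₁ f₁'} {β₁ : TCell D g₁ g₁'} {α₂ : TCell D f₂ f₂'}
    {β₂ : TCell D g₂ g₂'} (hf : f₁ = f₂) (hg : g₁ = g₂) (hf' : f₁' = f₂') (hg' : g₁' = g₂')
    (hα : HEq α₁ α₂) (hβ : HEq β₁ β₂) (h₁ : α₁.bot = β₁.top) (h₂ : α₂.bot = β₂.top) :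
    HEq (α₁.hcomp β₁ h₁) (α₂.hcomp β₂ h₂) := by
  subst hf hg hf' hg'; cases hα; cases hβ; rfl

theorem ofEq_vcomp_ofEq (hD : D.IsStrict) {a b : D.Obj} {f g h : a ⟶ b} (e : f = g)
    (e' : g = h) : (ofEq e).vcomp (ofEq e') = ofEq (e.trans e') :=
  eq_of_heq ((vcomp_ofEq hD _ _).trans (hext rfl rfl HEq.rfl))

theorem vcomp_ofEq_eq (hD : D.IsStrict) {a b d e : D.Obj} {f f' : a ⟶ d} {g g' : b ⟶ e}
    {α : TCell D f g} {β : TCell D f' g'} (e' : g = g') (e : f = f') (h : HEq α β) :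
    α.vcomp (ofEq e') = (ofEq e).vcomp β :=
  eq_of_heq ((vcomp_ofEq hD _ _).trans (h.trans (ofEq_vcomp hD _ _).symm))

/-- The image of a transposed cell under a double functor. -/
@[simps]
def map {D E : DblCat.{u, v}} (F : DblFunctor D E) {a b c d : D.Obj} {f : a ⟶ c} {g : b ⟶ d}
    (α : TCell D f g) : TCell E (F.map f) (F.map g) where
  top := F.mapPro α.top
  bot := F.mapPro α.bot
  cell := F.mapCell α.cell
  left_cell := by simp
  right_cell := by simp

theorem map_ofEq {D E : DblCat.{u, v}} {F : DblFunctor D E} (hF : F.IsStrict) {a b : D.Obj}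
    {f g : a ⟶ b} (h : f = g) : (ofEq h).map F = ofEq (congrArg F.map h) :=
  ext' (hF.mapPro_unit _).symm (hF.mapPro_unit _).symm (hF.unitCell f).symm

theorem map_hcomp {D E : DblCat.{u, v}} (F : DblFunctor D E) {a b c d e k : D.Obj} {f : a ⟶ b}
    {g : b ⟶ c} {f' : d ⟶ e} {g' : e ⟶ k} (α : TCell D f f') (β : TCell D g g')
    (h : α.bot = β.top) :
    HEq ((α.map F).hcomp (β.map F) (congrArg F.mapPro h)) ((α.hcomp β h).map F) :=
  hext rfl rfl (heq_of_eq (by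
    change F.mapCell α.cell ≫ eqToHom _ ≫ F.mapCell β.cell =
      F.mapCell (α.cell ≫ eqToHom _ ≫ β.cell)
    rw [F.mapCell_comp, F.mapCell_comp, F.mapCell_eqToHom h]))

theorem map_assoc {D E : DblCat.{u, v}} {F : DblFunctor D E} (hF : F.IsStrict) (hE : E.IsStrict)
    {a b c d : D.Obj} (f : a ⟶ b) (g : b ⟶ c) (h : c ⟶ d) :
    ((ofEq (F.map_comp f g).symm).hcomp (ofEq (Eq.refl (F.map h))) rfl).vcomp
      ((ofEq (F.map_comp (f ≫ g) h).symm).vcomp ((ofEq (Category.assoc f g h)).map F)) =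
    (ofEq (Category.assoc (F.map f) (F.map g) (F.map h))).vcomp
      (((ofEq (Eq.refl (F.map f))).hcomp (ofEq (F.map_comp g h).symm) rfl).vcomp
      (ofEq (F.map_comp f (g ≫ h)).symm)) := by
  simp only [hcomp_ofEq, ofEq_vcomp_ofEq hE, map_ofEq hF]

theorem map_lunit {D E : DblCat.{u, v}} {F : DblFunctor D E} (hF : F.IsStrict) (hE : E.IsStrict)
    {a b : D.Obj} (f : a ⟶ b) :
    ((ofEq (F.map_id a).symm).hcomp (ofEq (Eq.refl (F.map f))) rfl).vcomp
      ((ofEq (F.map_comp (𝟙 a) f).symm).vcomp ((ofEq (Category.id_comp f)).map F)) =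
    ofEq (Category.id_comp (F.map f)) := by
  simp only [hcomp_ofEq, ofEq_vcomp_ofEq hE, map_ofEq hF]

theorem map_runit {D E : DblCat.{u, v}} {F : DblFunctor D E} (hF : F.IsStrict) (hE : E.IsStrict)
    {a b : D.Obj} (f : a ⟶ b) :
    ((ofEq (Eq.refl (F.map f))).hcomp (ofEq (F.map_id b).symm) rfl).vcomp
      ((ofEq (F.map_comp f (𝟙 b)).symm).vcomp ((ofEq (Category.comp_id f)).map F)) =
    ofEq (Category.comp_id (F.map f)) := by
  simp only [hcomp_ofEq, ofEq_vcomp_ofEq hE, map_ofEq hF]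

theorem vcomp_map_ofEq {D E : DblCat.{u, v}} {F : DblFunctor D E} (hF : F.IsStrict)
    (hE : E.IsStrict) {a b : D.Obj} {f g : a ⟶ b} {k : F.obj a ⟶ F.obj b} (h : f = g)
    (h' : k = F.map f) : (ofEq h').vcomp ((ofEq h).map F) = ofEq (h'.trans (congrArg F.map h)) := by
  rw [map_ofEq hF, ofEq_vcomp_ofEq hE]

/-- The category of arrows and transposed cells. -/
@[reducible]
def category (hD : D.IsStrict) : Category.{v} (ProArr fun a b : D.Obj => (a ⟶ b)) where
  Hom X Y := TCell D X.pro Y.pro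
  id _ := TCell.ofEq rfl
  comp α β := α.vcomp β
  id_comp α := eq_of_heq (TCell.ofEq_vcomp hD α rfl)
  comp_id α := eq_of_heq (TCell.vcomp_ofEq hD α rfl)
  assoc _ _ _ := TCell.ext' (hD.pcomp_assoc _ _ _) (hD.pcomp_assoc _ _ _)
    (hD.hcomp_assoc _ _ _ _ _)

/-- The identity isomorphism between equal arrows. -/
@[reducible]
def iso (hD : D.IsStrict) {a b : D.Obj} {f g : a ⟶ b} (h : f = g) :
    letI := category hD
    (ProArr.mk f : ProArr fun a b : D.Obj => (a ⟶ b)) ≅ ProArr.mk g :=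
  letI := category hD
  { hom := TCell.ofEq h
    inv := TCell.ofEq h.symm
    hom_inv_id := ofEq_vcomp_ofEq hD _ _
    inv_hom_id := ofEq_vcomp_ofEq hD _ _ }

end TCell

/-- The transpose of a strict double category, which exchanges arrows and proarrows. -/
def DblCat.transpose (D : DblCat.{u, v}) (hD : D.IsStrict) : DblCat.{u, v} where
  Obj := D.Obj
  cat :=
    { Hom := fun a b => D.Pro a b
      id := fun a => D.unit a
      comp := fun m n => D.pcomp m n
      id_comp := fun m => hD.unit_pcomp m
      comp_id := fun m => hD.pcomp_unit m
      assoc := fun m n p => hD.pcomp_assoc m n p }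
  Pro a b := (a ⟶ b)
  cells := TCell.category hD
  left α := α.top
  right α := α.bot
  left_id _ := rfl
  right_id _ := rfl
  left_comp _ _ := rfl
  right_comp _ _ := rfl
  unit a := 𝟙 a
  unitCell m := ⟨m, m, 𝟙 _, D.left_id _, D.right_id _⟩
  left_unitCell _ := rfl
  right_unitCell _ := rfl
  unitCell_id a := TCell.ext' rfl rfl (heq_of_eq (D.unitCell_id a).symm)
  unitCell_comp m n := TCell.ext' rfl rfl (heq_of_eq (D.hcomp_id m n).symm)
  pcomp f g := f ≫ g
  hcomp α β h := TCell.hcomp α β h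
  left_hcomp _ _ _ := rfl
  right_hcomp _ _ _ := rfl
  hcomp_id f g := TCell.hcomp_ofEq rfl rfl
  hcomp_comp := by
    rintro _ _ _ _ _ _ _ _ _ _ _ _ _ _ _ ⟨t, b, c, h1, h2⟩ ⟨t', b', c', h1', h2'⟩
      ⟨s, e, k, h3, h4⟩ ⟨s', e', k', h3', h4'⟩ h h'
    dsimp only at h h'
    subst h h'
    refine TCell.ext' rfl rfl (heq_of_eq ?_)
    change D.hcomp c k _ ≫ eqToHom rfl ≫ D.hcomp c' k' _ =
      D.hcomp (c ≫ eqToHom rfl ≫ c') (k ≫ eqToHom rfl ≫ k') _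
    rw [eqToHom_refl, Category.id_comp, ← D.hcomp_comp]
    exact D.hcomp_congr (by simp) (by simp) _
  assoc f g h := TCell.iso hD (Category.assoc f g h)
  left_assoc _ _ _ := rfl
  right_assoc _ _ _ := rfl
  assoc_naturality α β γ h h' := TCell.vcomp_ofEq_eq hD (Category.assoc _ _ _) (Category.assoc _ _ _) (TCell.hext rfl rfl (heq_of_eq (by
    change ((TCell.cell α ≫ _ ≫ TCell.cell β) ≫ _ ≫ TCell.cell γ) =
      TCell.cell α ≫ _ ≫ (TCell.cell β ≫ _ ≫ TCell.cell γ)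
    simp only [Category.assoc]
    rfl)))
  lunit f := TCell.iso hD (Category.id_comp f)
  left_lunit _ := rfl
  right_lunit _ := rfl
  lunit_naturality α := TCell.vcomp_ofEq_eq hD (Category.id_comp _) (Category.id_comp _) (TCell.hext rfl rfl (heq_of_eq (by
    change 𝟙 _ ≫ 𝟙 _ ≫ TCell.cell α = TCell.cell α
    rw [Category.id_comp, Category.id_comp])))
  runit f := TCell.iso hD (Category.comp_id f)
  left_runit _ := rfl
  right_runit _ := rfl
  runit_naturality α := TCell.vcomp_ofEq_eq hD (Category.comp_id _) (Category.comp_id _) (TCell.hext rfl rfl (heq_of_eq (by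
    change TCell.cell α ≫ 𝟙 _ ≫ 𝟙 _ = TCell.cell α
    rw [Category.comp_id, Category.comp_id])))
  pentagon f g h k := by
    change ((TCell.ofEq (Category.assoc f g h)).hcomp (TCell.ofEq (Eq.refl k)) rfl).vcomp
      ((TCell.ofEq (Category.assoc f (g ≫ h) k)).vcomp
      ((TCell.ofEq (Eq.refl f)).hcomp (TCell.ofEq (Category.assoc g h k)) rfl)) =
      (TCell.ofEq (Category.assoc (f ≫ g) h k)).vcomp (TCell.ofEq (Category.assoc f g (h ≫ k)))
    simp only [TCell.hcomp_ofEq, TCell.ofEq_vcomp_ofEq hD]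
  triangle {a b c} f g := by
    change (TCell.ofEq (Category.assoc f (𝟙 b) g)).vcomp
      ((TCell.ofEq (Eq.refl f)).hcomp (TCell.ofEq (Category.id_comp g)) rfl) =
      (TCell.ofEq (Category.comp_id f)).hcomp (TCell.ofEq (Eq.refl g)) rfl
    simp only [TCell.hcomp_ofEq, TCell.ofEq_vcomp_ofEq hD]

namespace DblFunctor

variable {D E : DblCat.{u, v}}

/-- The transpose of a strict double functor. -/
def transpose (F : DblFunctor D E) (hF : F.IsStrict) (hD : D.IsStrict) (hE : E.IsStrict) :
    DblFunctor (D.transpose hD) (E.transpose hE) where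
  obj a := F.obj a
  map m := F.mapPro m
  map_id a := (hF.mapPro_unit a).symm
  map_comp m n := (hF.mapPro_pcomp m n).symm
  mapPro f := F.map f
  mapCell α := TCell.map F α
  left_mapCell _ := rfl
  right_mapCell _ := rfl
  mapCell_id _ := TCell.map_ofEq hF rfl
  mapCell_comp α β := TCell.ext' (hF.mapPro_pcomp _ _).symm (hF.mapPro_pcomp _ _).symm
    (hF.hcomp _ _ _ _).symm
  mapUnit a := TCell.iso hE (F.map_id a).symm
  left_mapUnit _ := rfl
  right_mapUnit _ := rfl
  mapUnit_naturality m := TCell.vcomp_ofEq_eq hE (F.map_id _).symm (F.map_id _).symm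
    (TCell.hext rfl rfl (heq_of_eq (F.mapCell_id m).symm))
  mapComp f g := TCell.iso hE (F.map_comp f g).symm
  left_mapComp _ _ := rfl
  right_mapComp _ _ := rfl
  mapComp_naturality α β h := TCell.vcomp_ofEq_eq hE (F.map_comp _ _).symm
    (F.map_comp _ _).symm (TCell.map_hcomp F α β h)
  mapComp_assoc f g h := TCell.map_assoc hF hE f g h
  mapComp_lunit f := TCell.map_lunit hF hE f
  mapComp_runit f := TCell.map_runit hF hE f

end DblFunctor

/-- The transpose of a strict protransformation, a natural transformation. -/
def ProTrans.transpose {D E : DblCat.{u, v}} {F G : DblFunctor D E} (τ : ProTrans F G)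
    (hF : F.IsStrict) (hG : G.IsStrict) (hD : D.IsStrict) (hE : E.IsStrict) :
    DblNatTrans (F.transpose hF hD hE) (G.transpose hG hD hE) where
  app a := τ.app a
  naturality m := τ.naturality m
  appPro f := ⟨τ.app _, τ.app _, τ.appArr f, τ.left_appArr f, τ.right_appArr f⟩
  left_appPro _ := rfl
  right_appPro _ := rfl
  cell_naturality α := TCell.ext' (τ.naturality _) (τ.naturality _)
    (τ.cell_naturality' (TCell.cell α) (TCell.left_cell α) (TCell.right_cell α) _ _)
  appPro_unit a := (TCell.vcomp_ofEq_eq hE (G.map_id _).symm (F.map_id _).symm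
    (TCell.hext rfl rfl (heq_of_eq (τ.appArr_id a).symm))).symm
  appPro_comp f g := (TCell.vcomp_ofEq_eq hE (G.map_comp _ _).symm (F.map_comp _ _).symm
    (TCell.hext rfl rfl (heq_of_eq ((congrArg (τ.appArr f ≫ ·) (Category.id_comp _)).trans
      (τ.appArr_comp f g).symm)))).symm

theorem DblNatTrans.conj_ext {D E : DblCat.{u, v}} {F F' G' G : DblFunctor D E} (h : F = F')
    (h' : G' = G) (σ : F ⟶ G) (τ : F' ⟶ G')
    (H : ∀ a, HEq (DblNatTrans.app σ a) (DblNatTrans.app τ a))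
    (H' : ∀ {a b : D.Obj} (m : D.Pro a b), HEq (DblNatTrans.appPro σ m) (DblNatTrans.appPro τ m)) :
    σ = eqToHom h ≫ τ ≫ eqToHom h' := by
  subst h h'
  rw [eqToHom_refl, eqToHom_refl, Category.id_comp, Category.comp_id]
  exact DblNatTrans.hext (fun a => eq_of_heq (H a)) (fun m => eq_of_heq (H' m))

theorem ProTrans.conj_ext {C D : CompDblCat.{u, v}} {F F' G' G : CompDblFunctor C D} (h : F = F')
    (h' : G' = G) (σ : F ⟶ G) (τ : F' ⟶ G')
    (H : ∀ a, HEq (ProTrans.app σ a) (ProTrans.app τ a))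
    (H' : ∀ {a b : C.dbl.Obj} (f : a ⟶ b), HEq (ProTrans.appArr σ f) (ProTrans.appArr τ f)) :
    σ = eqToHom h ≫ τ ≫ eqToHom h' := by
  subst h h'
  rw [eqToHom_refl, eqToHom_refl, Category.id_comp, Category.comp_id]
  exact ProTrans.hext (fun a => eq_of_heq (H a)) (fun m => H' m)

/-- Transposition, as a 2-functor from the 2-category of strict double categories with a functorial
choice of companions to the 2-category of double categories. -/
def transposeTwoFunctor : StrictPseudofunctor CompDblCat.{u, v} DblCat.{u, v} :=
  StrictPseudofunctor.mk''
    { obj := fun C => C.dbl.transpose C.strict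
      map := fun {C D} F => DblFunctor.transpose (CompDblFunctor.functor F)
        (CompDblFunctor.strict F) C.strict D.strict
      map₂ := fun {C D F G} τ => ProTrans.transpose τ (CompDblFunctor.strict F)
        (CompDblFunctor.strict G) C.strict D.strict
      map₂_id := fun {C D} F => DblNatTrans.hext (fun _ => rfl) (fun _ => rfl)
      map₂_comp := fun {C D} F G H σ τ => DblNatTrans.hext (fun _ => rfl) (fun _ => rfl)
      map_id := fun C => DblFunctor.ext_of_rfl rfl (fun _ => HEq.rfl) (fun _ => HEq.rfl)
        (fun _ => HEq.rfl) (fun _ => HEq.rfl) (fun _ _ => HEq.rfl)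
      map_comp := fun {_ _ E} F G => DblFunctor.ext_of_rfl rfl (fun _ => HEq.rfl)
        (fun _ => HEq.rfl) (fun _ => HEq.rfl)
        (fun a => (heq_of_eq (TCell.vcomp_map_ofEq (CompDblFunctor.strict G) E.strict
          ((CompDblFunctor.functor F).map_id a).symm
          ((CompDblFunctor.functor G).map_id _).symm)).symm)
        (fun f g => (heq_of_eq (TCell.vcomp_map_ofEq (CompDblFunctor.strict G) E.strict
          ((CompDblFunctor.functor F).map_comp f g).symm
          ((CompDblFunctor.functor G).map_comp _ _).symm)).symm)
      map₂_whisker_left := fun _ _ _ _ =>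
        DblNatTrans.conj_ext _ _ _ _ (fun _ => HEq.rfl) (fun _ => HEq.rfl)
      map₂_whisker_right := fun _ _ =>
        DblNatTrans.conj_ext _ _ _ _ (fun _ => HEq.rfl) (fun _ => HEq.rfl) }

namespace DblCat

variable (D : DblCat.{u, v})

/-- Pasting of special cells, that is, of cells whose top and bottom are external identities. -/
def scomp {a b : D.Obj} (σ τ : D.Cell (D.unit a) (D.unit b)) (h : D.right σ = D.left τ) :
    D.Cell (D.unit a) (D.unit b) :=
  (D.lunit (D.unit a)).inv ≫ D.hcomp σ τ h ≫ (D.lunit (D.unit b)).hom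

@[simp] theorem left_scomp {a b : D.Obj} (σ τ : D.Cell (D.unit a) (D.unit b))
    (h : D.right σ = D.left τ) : D.left (D.scomp σ τ h) = D.left σ := by simp [scomp]

@[simp] theorem right_scomp {a b : D.Obj} (σ τ : D.Cell (D.unit a) (D.unit b))
    (h : D.right σ = D.left τ) : D.right (D.scomp σ τ h) = D.right τ := by simp [scomp]

theorem scomp_congr {a b : D.Obj} {σ τ σ' τ' : D.Cell (D.unit a) (D.unit b)} (hσ : σ = σ')
    (hτ : τ = τ') (h : D.right σ = D.left τ) (h' : D.right σ' = D.left τ') :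
    D.scomp σ τ h = D.scomp σ' τ' h' := by
  subst hσ hτ; rfl

theorem unit_scomp {a b : D.Obj} (f : a ⟶ b) (τ : D.Cell (D.unit a) (D.unit b))
    (h : D.right (D.unitCell f) = D.left τ) : D.scomp (D.unitCell f) τ h = τ := by
  rw [scomp, unit_hcomp]; simp

theorem scomp_unit {a b : D.Obj} (f : a ⟶ b) (σ : D.Cell (D.unit a) (D.unit b))
    (h : D.right σ = D.left (D.unitCell f)) : D.scomp σ (D.unitCell f) h = σ := by
  rw [scomp, hcomp_unit, lunit_unit_iso, lunit_unit_iso]; simp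

theorem scomp_comp {a b c : D.Obj} (σ τ : D.Cell (D.unit a) (D.unit b))
    (σ' τ' : D.Cell (D.unit b) (D.unit c)) (h : D.right σ = D.left τ)
    (h' : D.right σ' = D.left τ') :
    D.scomp (σ ≫ σ') (τ ≫ τ') (by simp [h, h']) = D.scomp σ τ h ≫ D.scomp σ' τ' h' := by
  simp only [scomp, Category.assoc, Iso.hom_inv_id_assoc]
  rw [D.hcomp_comp _ _ _ _ h h', Category.assoc]

theorem unit_comp_scomp {a b c : D.Obj} (f : a ⟶ b) (σ τ : D.Cell (D.unit b) (D.unit c))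
    (h : D.right σ = D.left τ) :
    D.unitCell f ≫ D.scomp σ τ h =
      D.scomp (D.unitCell f ≫ σ) (D.unitCell f ≫ τ) (by simp [h]) := by
  rw [D.scomp_comp _ _ _ _ (by simp) h, D.unit_scomp]

theorem scomp_comp_unit {a b c : D.Obj} (f : b ⟶ c) (σ τ : D.Cell (D.unit a) (D.unit b))
    (h : D.right σ = D.left τ) :
    D.scomp σ τ h ≫ D.unitCell f =
      D.scomp (σ ≫ D.unitCell f) (τ ≫ D.unitCell f) (by simp [h]) := by
  rw [D.scomp_comp _ _ _ _ h (by simp), D.unit_scomp]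

theorem scomp_assoc {a b : D.Obj} (σ τ ρ : D.Cell (D.unit a) (D.unit b))
    (h : D.right σ = D.left τ) (h' : D.right τ = D.left ρ) :
    D.scomp (D.scomp σ τ h) ρ (by simp [h']) = D.scomp σ (D.scomp τ ρ h') (by simp [h]) := by
  have h1 : D.hcomp (D.scomp σ τ h) ρ (by simp [h']) =
      D.hcomp (D.lunit (D.unit a)).inv (𝟙 (ProArr.mk (D.unit a))) (by simp) ≫
      D.hcomp (D.hcomp σ τ h) ρ (by simp [h']) ≫
      D.hcomp (D.lunit (D.unit b)).hom (𝟙 (ProArr.mk (D.unit b))) (by simp) := by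
    rw [← D.hcomp_comp, ← D.hcomp_comp]
    exact D.hcomp_congr rfl (by simp) _
  have h2 : D.hcomp σ (D.scomp τ ρ h') (by simp [h]) =
      D.hcomp (𝟙 (ProArr.mk (D.unit a))) (D.lunit (D.unit a)).inv (by simp) ≫
      D.hcomp σ (D.hcomp τ ρ h') (by simp [h]) ≫
      D.hcomp (𝟙 (ProArr.mk (D.unit b))) (D.lunit (D.unit b)).hom (by simp) := by
    rw [← D.hcomp_comp, ← D.hcomp_comp]
    exact D.hcomp_congr (by simp) rfl _
  have h3 : ∀ c : D.Obj, (D.assoc (D.unit c) (D.unit c) (D.unit c)).hom ≫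
      D.hcomp (𝟙 (ProArr.mk (D.unit c))) (D.lunit (D.unit c)).hom (by simp) =
      D.hcomp (D.lunit (D.unit c)).hom (𝟙 (ProArr.mk (D.unit c))) (by simp) := fun c => by
    rw [D.triangle]; exact D.hcomp_congr (D.lunit_unit c).symm rfl _
  have h4 : D.hcomp (D.lunit (D.unit a)).inv (𝟙 (ProArr.mk (D.unit a))) (by simp) ≫
      (D.assoc (D.unit a) (D.unit a) (D.unit a)).hom =
      D.hcomp (𝟙 (ProArr.mk (D.unit a))) (D.lunit (D.unit a)).inv (by simp) := by
    have e1 : D.hcomp (𝟙 (ProArr.mk (D.unit a))) (D.lunit (D.unit a)).hom (by simp) ≫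
        D.hcomp (𝟙 (ProArr.mk (D.unit a))) (D.lunit (D.unit a)).inv (by simp) = 𝟙 _ := by
      rw [← D.hcomp_comp, ← D.hcomp_id]
      exact D.hcomp_congr (by simp) (by simp) _
    have e2 : D.hcomp (D.lunit (D.unit a)).inv (𝟙 (ProArr.mk (D.unit a))) (by simp) ≫
        D.hcomp (D.lunit (D.unit a)).hom (𝟙 (ProArr.mk (D.unit a))) (by simp) = 𝟙 _ := by
      rw [← D.hcomp_comp, ← D.hcomp_id]
      exact D.hcomp_congr (by simp) (by simp) _
    rw [← h3] at e2
    have := congrArg (· ≫ D.hcomp (𝟙 (ProArr.mk (D.unit a))) (D.lunit (D.unit a)).inv (by simp)) e2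
    simp only [Category.assoc] at this
    rw [e1] at this
    simpa using this
  have h5 := D.assoc_naturality σ τ ρ h h'
  change _ ≫ D.hcomp (D.scomp σ τ h) ρ _ ≫ _ = _ ≫ D.hcomp σ (D.scomp τ ρ h') _ ≫ _
  rw [h1, h2, ← h3, ← h4]
  simp only [Category.assoc]
  rw [← Category.assoc (D.hcomp (D.hcomp σ τ h) ρ _), h5, Category.assoc]

end DblCat

/-- A cell of `Comp D`, from the arrow `h` to the arrow `k`: a square whose left and right sides
are arrows having companions, filled with a special cell from `h ≫ right` to `left ≫ k`. -/
@[ext]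
structure QCell (D : DblCat.{u, v}) {x y w z : D.Obj} (h : x ⟶ y) (k : w ⟶ z) where
  left : {f : x ⟶ w // D.HasCompanion f}
  right : {g : y ⟶ z // D.HasCompanion g}
  cell : D.Cell (D.unit x) (D.unit z)
  left_cell : D.left cell = h ≫ right.1
  right_cell : D.right cell = left.1 ≫ k

namespace DblCat

variable {D : DblCat.{u, v}}

theorem HasCompanion.id (x : D.Obj) : D.HasCompanion (𝟙 x) := ⟨Companion.id D x⟩

theorem HasCompanion.comp {x y z : D.Obj} {f : x ⟶ y} {g : y ⟶ z} (hf : D.HasCompanion f)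
    (hg : D.HasCompanion g) : D.HasCompanion (f ≫ g) :=
  ⟨(Classical.choice hf).comp (Classical.choice hg)⟩

/-- Objects and arrows with companions form a category. -/
@[reducible]
def companionCat (D : DblCat.{u, v}) : Category.{v} D.Obj where
  Hom x y := {f : x ⟶ y // D.HasCompanion f}
  id x := ⟨𝟙 x, HasCompanion.id x⟩
  comp f g := ⟨f.1 ≫ g.1, f.2.comp g.2⟩
  id_comp f := Subtype.ext (Category.id_comp f.1)
  comp_id f := Subtype.ext (Category.comp_id f.1)
  assoc f g h := Subtype.ext (Category.assoc f.1 g.1 h.1)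

end DblCat

namespace QCell

attribute [simp] left_cell right_cell

variable {D : DblCat.{u, v}}

theorem hext {x y w z : D.Obj} {h h' : x ⟶ y} {k k' : w ⟶ z} {α : QCell D h k}
    {β : QCell D h' k'} (hh : h = h') (hk : k = k') (hl : α.left = β.left)
    (hr : α.right = β.right) (hc : α.cell = β.cell) : HEq α β := by
  subst hh hk; exact heq_of_eq (QCell.ext hl hr hc)

/-- The identity cell. -/
abbrev id {x y : D.Obj} (h : x ⟶ y) : QCell D h h where
  left := ⟨𝟙 x, DblCat.HasCompanion.id x⟩
  right := ⟨𝟙 y, DblCat.HasCompanion.id y⟩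
  cell := D.unitCell h
  left_cell := by simp
  right_cell := by simp

/-- Composition of cells of `Comp D` along proarrows. -/
abbrev vcomp {x y w z s t : D.Obj} {h : x ⟶ y} {k : w ⟶ z} {l : s ⟶ t} (α : QCell D h k)
    (β : QCell D k l) : QCell D h l where
  left := ⟨α.left.1 ≫ β.left.1, α.left.2.comp β.left.2⟩
  right := ⟨α.right.1 ≫ β.right.1, α.right.2.comp β.right.2⟩
  cell := D.scomp (α.cell ≫ D.unitCell β.right.1) (D.unitCell α.left.1 ≫ β.cell) (by simp)
  left_cell := by simp
  right_cell := by simp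

/-- Composition of cells of `Comp D` along arrows. -/
abbrev hcomp {x y z x' y' z' : D.Obj} {h : x ⟶ y} {l : y ⟶ z} {h' : x' ⟶ y'} {l' : y' ⟶ z'}
    (α : QCell D h h') (β : QCell D l l') (e : α.right = β.left) :
    QCell D (h ≫ l) (h' ≫ l') where
  left := α.left
  right := β.right
  cell := D.scomp (D.unitCell h ≫ β.cell) (α.cell ≫ D.unitCell l') (by simp [e])
  left_cell := by simp
  right_cell := by simp

/-- The category of arrows of `D` and cells of `Comp D`. -/
@[reducible]
def category (D : DblCat.{u, v}) : Category.{v} (ProArr fun x y : D.Obj => (x ⟶ y)) where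
  Hom X Y := QCell D X.pro Y.pro
  id X := QCell.id X.pro
  comp α β := α.vcomp β
  id_comp α := QCell.ext (Subtype.ext (Category.id_comp _)) (Subtype.ext (Category.id_comp _))
    (by simp [← D.unitCell_comp, D.unitCell_id, D.unit_scomp])
  comp_id α := QCell.ext (Subtype.ext (Category.comp_id _)) (Subtype.ext (Category.comp_id _))
    (by simp [← D.unitCell_comp, D.unitCell_id, D.scomp_unit])
  assoc α β γ := QCell.ext (Subtype.ext (Category.assoc _ _ _))
    (Subtype.ext (Category.assoc _ _ _)) (by
      simp only [D.scomp_comp_unit, D.unit_comp_scomp]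
      rw [D.scomp_assoc _ _ _ (by simp) (by simp)]
      exact D.scomp_congr (by simp [D.unitCell_comp]) (D.scomp_congr (by simp)
        (by simp [D.unitCell_comp]) _ _) _ _)

theorem hcomp_vcomp {x y z x' y' z' x'' y'' z'' : D.Obj} {h : x ⟶ y} {m : y ⟶ z} {k : x' ⟶ y'}
    {n : y' ⟶ z'} {l : x'' ⟶ y''} {p : y'' ⟶ z''} (α : QCell D h k) (β : QCell D m n)
    (α' : QCell D k l) (β' : QCell D n p) (e : α.right = β.left) (e' : α'.right = β'.left) :
    (α.vcomp α').hcomp (β.vcomp β') (Subtype.ext (by simp [e, e'])) =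
      (α.hcomp β e).vcomp (α'.hcomp β' e') := by
  refine QCell.ext rfl rfl ?_
  simp only [D.scomp_comp_unit, D.unit_comp_scomp]
  rw [D.scomp_assoc _ _ _ (by simp) (by simp [e, ← e']), D.scomp_assoc _ _ _ (by simp [e]) (by simp)]
  refine D.scomp_congr (by simp) ?_ _ _
  rw [← D.scomp_assoc _ _ _ (by simp [e, e']) (by simp), ← D.scomp_assoc _ _ _ (by simp [e, e']) (by simp [e, e'])]
  refine D.scomp_congr ?_ (by simp) _ _
  have h1 : D.scomp (D.unitCell (h ≫ β.left.1) ≫ β'.cell) (α.cell ≫ D.unitCell (α'.right.1 ≫ p))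
      (by simp [e, e']) = α.cell ≫ β'.cell := by
    rw [D.scomp_comp _ _ _ _ (by simp [e]) (by simp [e']), D.unit_scomp, D.scomp_unit]
  have h2 : D.scomp (α.cell ≫ D.unitCell (n ≫ β'.right.1)) (D.unitCell (α.left.1 ≫ k) ≫ β'.cell)
      (by simp) = α.cell ≫ β'.cell := by
    rw [D.scomp_comp _ _ _ _ (by simp) (by simp), D.unit_scomp, D.scomp_unit]
  refine (D.scomp_congr ?_ ?_ _ _).trans (h1.trans (h2.symm.trans (D.scomp_congr ?_ ?_ _ _)))
  all_goals simp [D.unitCell_comp, ← e, ← e']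

theorem hcomp_assoc {a b c d a' b' c' d' : D.Obj} {h : a ⟶ b} {m : b ⟶ c} {p : c ⟶ d}
    {h' : a' ⟶ b'} {m' : b' ⟶ c'} {p' : c' ⟶ d'} (α : QCell D h h') (β : QCell D m m')
    (γ : QCell D p p') (e : α.right = β.left) (e' : β.right = γ.left) :
    HEq ((α.hcomp β e).hcomp γ e') (α.hcomp (β.hcomp γ e') e) := by
  refine hext (Category.assoc _ _ _) (Category.assoc _ _ _) rfl rfl ?_
  simp only [D.scomp_comp_unit, D.unit_comp_scomp]
  rw [D.scomp_assoc _ _ _ (by simp [e']) (by simp [e])]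
  exact D.scomp_congr (by simp [D.unitCell_comp]) (D.scomp_congr (by simp)
    (by simp [D.unitCell_comp]) _ _) _ _

/-- The external identity cell on an arrow with a companion. -/
abbrev unit {x w : D.Obj} (f : {f : x ⟶ w // D.HasCompanion f}) : QCell D (𝟙 x) (𝟙 w) where
  left := f
  right := f
  cell := D.unitCell f.1
  left_cell := by simp
  right_cell := by simp

theorem unit_hcomp {x y w z : D.Obj} {h : x ⟶ y} {k : w ⟶ z} (α : QCell D h k)
    (f : {f : x ⟶ w // D.HasCompanion f}) (e : f = α.left) : HEq ((unit f).hcomp α e) α := by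
  subst e
  refine hext (Category.id_comp _) (Category.id_comp _) rfl rfl ?_
  simp [← D.unitCell_comp, D.unitCell_id, D.scomp_unit]

theorem hcomp_unit {x y w z : D.Obj} {h : x ⟶ y} {k : w ⟶ z} (α : QCell D h k)
    (f : {f : y ⟶ z // D.HasCompanion f}) (e : α.right = f) : HEq (α.hcomp (unit f) e) α := by
  subst e
  refine hext (Category.comp_id _) (Category.comp_id _) rfl rfl ?_
  simp [← D.unitCell_comp, D.unitCell_id, D.unit_scomp]

theorem hcomp_id {x y z : D.Obj} (h : x ⟶ y) (k : y ⟶ z) : (id h).hcomp (id k) rfl = id (h ≫ k) :=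
  QCell.ext rfl rfl (by simp [← D.unitCell_comp, D.unit_scomp])

theorem left_eqToHom {a b : D.Obj} {m n : a ⟶ b} (h : m = n) :
    letI := category D
    QCell.left (eqToHom (congrArg (ProArr.mk (P := fun x y : D.Obj => (x ⟶ y))) h)) =
      ⟨𝟙 a, DblCat.HasCompanion.id a⟩ := by
  subst h; rfl

theorem right_eqToHom {a b : D.Obj} {m n : a ⟶ b} (h : m = n) :
    letI := category D
    QCell.right (eqToHom (congrArg (ProArr.mk (P := fun x y : D.Obj => (x ⟶ y))) h)) =
      ⟨𝟙 b, DblCat.HasCompanion.id b⟩ := by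
  subst h; rfl

theorem cell_eqToHom {a b : D.Obj} {m n : a ⟶ b} (h : m = n) :
    letI := category D
    QCell.cell (eqToHom (congrArg (ProArr.mk (P := fun x y : D.Obj => (x ⟶ y))) h)) =
      D.unitCell m := by
  subst h; rfl

theorem hcomp_eqToHom {a b c : D.Obj} {m m' : a ⟶ b} {n n' : b ⟶ c} (h : m = m') (h' : n = n') :
    letI := category D
    QCell.hcomp (eqToHom (congrArg (ProArr.mk (P := fun x y : D.Obj => (x ⟶ y))) h))
      (eqToHom (congrArg (ProArr.mk (P := fun x y : D.Obj => (x ⟶ y))) h'))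
      ((right_eqToHom h).trans (left_eqToHom h').symm) =
    eqToHom (congrArg (ProArr.mk (P := fun x y : D.Obj => (x ⟶ y)))
      (congrArg₂ (fun (f : a ⟶ b) (g : b ⟶ c) => f ≫ g) h h')) := by
  subst h h'; exact hcomp_id _ _

end QCell

theorem comm_of_heq_cat {C : Type*} [Category C] {X Y X' Y' : C} {α : X ⟶ Y} {α' : X' ⟶ Y'}
    (hX : X = X') (hY : Y = Y') (h : HEq α α') : α ≫ eqToHom hY = eqToHom hX ≫ α' := by
  subst hX hY; simpa using h

/-- The strict double category `Comp D`: its objects are those of `D`, its arrows are the arrows of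
`D` having companions, its proarrows are all arrows of `D`, and its cells are special cells of `D`
in squares of arrows. -/
def DblCat.compDbl (D : DblCat.{u, v}) : DblCat.{u, v} :=
  letI := QCell.category D
  { Obj := D.Obj
    cat := D.companionCat
    Pro := fun x y => (x ⟶ y)
    cells := QCell.category D
    left := fun α => QCell.left α
    right := fun α => QCell.right α
    left_id := fun _ => rfl
    right_id := fun _ => rfl
    left_comp := fun _ _ => rfl
    right_comp := fun _ _ => rfl
    unit := fun x => 𝟙 x
    unitCell := fun f => QCell.unit f
    left_unitCell := fun _ => rfl
    right_unitCell := fun _ => rfl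
    unitCell_id := fun a => QCell.ext rfl rfl rfl
    unitCell_comp := fun f g => QCell.ext rfl rfl (by
      change D.unitCell (f.1 ≫ g.1) = D.scomp (D.unitCell f.1 ≫ D.unitCell g.1)
        (D.unitCell f.1 ≫ D.unitCell g.1) _
      simp only [← D.unitCell_comp]
      exact (D.unit_scomp _ _ _).symm)
    pcomp := fun f g => f ≫ g
    hcomp := fun α β e => QCell.hcomp α β e
    left_hcomp := fun _ _ _ => rfl
    right_hcomp := fun _ _ _ => rfl
    hcomp_id := fun f g => QCell.hcomp_id f g
    hcomp_comp := fun α β α' β' e e' => QCell.hcomp_vcomp α β α' β' e e'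
    assoc := fun f g h => eqToIso (congrArg ProArr.mk (Category.assoc f g h))
    left_assoc := fun f g h => QCell.left_eqToHom (Category.assoc f g h)
    right_assoc := fun f g h => QCell.right_eqToHom (Category.assoc f g h)
    assoc_naturality := fun {_ _ _ _ _ _ _ _ m n p m' n' p'} α β γ e e' => comm_of_heq_cat
      (congrArg ProArr.mk (Category.assoc m n p)) (congrArg ProArr.mk (Category.assoc m' n' p')) (QCell.hcomp_assoc α β γ e e')
    lunit := fun f => eqToIso (congrArg ProArr.mk (Category.id_comp f))
    left_lunit := fun f => QCell.left_eqToHom (Category.id_comp f)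
    right_lunit := fun f => QCell.right_eqToHom (Category.id_comp f)
    lunit_naturality := fun {_ _ _ _ m m'} α => comm_of_heq_cat
      (congrArg ProArr.mk (Category.id_comp m)) (congrArg ProArr.mk (Category.id_comp m')) (QCell.unit_hcomp α _ rfl)
    runit := fun f => eqToIso (congrArg ProArr.mk (Category.comp_id f))
    left_runit := fun f => QCell.left_eqToHom (Category.comp_id f)
    right_runit := fun f => QCell.right_eqToHom (Category.comp_id f)
    runit_naturality := fun {_ _ _ _ m m'} α => comm_of_heq_cat
      (congrArg ProArr.mk (Category.comp_id m)) (congrArg ProArr.mk (Category.comp_id m')) (QCell.hcomp_unit α _ rfl)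
    pentagon := fun f g h k => by
      have h1 := QCell.hcomp_eqToHom (D := D) (Category.assoc f g h) (Eq.refl k)
      have h2 := QCell.hcomp_eqToHom (D := D) (Eq.refl f) (Category.assoc g h k)
      refine (congrArg₂ (fun x y => x ≫ (eqToHom (congrArg ProArr.mk
        (Category.assoc f (g ≫ h) k))) ≫ y) h1 h2).trans ?_
      simp only [eqToHom_trans, eqToIso.hom]
    triangle := fun {_ b _} f g => by
      have h1 := QCell.hcomp_eqToHom (D := D) (Category.comp_id f) (Eq.refl g)
      have h2 := QCell.hcomp_eqToHom (D := D) (Eq.refl f) (Category.id_comp g)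
      refine ((congrArg (fun y => (eqToHom (congrArg ProArr.mk
        (Category.assoc f (𝟙 b) g))) ≫ y) h2).trans ?_).trans h1.symm
      simp only [eqToHom_trans] }

theorem DblCat.compDbl_isStrict (D : DblCat.{u, v}) : D.compDbl.IsStrict where
  pcomp_assoc f g h := D.cat.assoc f g h
  unit_pcomp f := D.cat.id_comp f
  pcomp_unit f := D.cat.comp_id f
  assoc_eq _ _ _ := rfl
  lunit_eq _ := rfl
  runit_eq _ := rfl

theorem heq_eqToHom_comp_comp {C : Type*} [Category C] {W X Y Z : C} (h : W = X) (α : X ⟶ Y)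
    (h' : Y = Z) : HEq (eqToHom h ≫ α ≫ eqToHom h') α := by
  subst h h'; simp

theorem DblCat.IsStrict.binding {D : DblCat.{u, v}} (hD : D.IsStrict) {x y : D.Obj}
    {m : D.Pro x y} (η : D.Cell (D.unit x) m) (ε : D.Cell m (D.unit y)) (h : D.right η = D.left ε)
    (H : HEq (D.hcomp η ε h) (𝟙 (ProArr.mk m : ProArr D.Pro))) :
    (D.lunit m).inv ≫ D.hcomp η ε h ≫ (D.runit m).hom = 𝟙 (ProArr.mk m) := by
  rw [hD.lunit_eq, hD.runit_eq]
  exact eq_of_heq ((heq_eqToHom_comp_comp (congrArg ProArr.mk (hD.unit_pcomp m)).symm _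
    (congrArg ProArr.mk (hD.pcomp_unit m))).trans H)

theorem DblCat.IsStrict.comp_η {D : DblCat.{u, v}} (hD : D.IsStrict) {x y z : D.Obj} {k : x ⟶ y}
    {l : y ⟶ z} (c : D.Companion k) (d : D.Companion l) :
    HEq (D.hcomp c.η (D.unitCell k ≫ d.η) (by simp)) (c.comp d).η := by
  change HEq _ ((D.lunit (D.unit x)).inv ≫ D.hcomp c.η (D.unitCell k ≫ d.η) _)
  rw [hD.lunit_eq]
  exact (eqToHom_comp_heq _ (congrArg ProArr.mk (hD.unit_pcomp (D.unit x))).symm).symm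

theorem DblCat.IsStrict.comp_ε {D : DblCat.{u, v}} (hD : D.IsStrict) {x y z : D.Obj} {k : x ⟶ y}
    {l : y ⟶ z} (c : D.Companion k) (d : D.Companion l) :
    HEq (D.hcomp (c.ε ≫ D.unitCell l) d.ε (by simp)) (c.comp d).ε := by
  change HEq _ (D.hcomp (c.ε ≫ D.unitCell l) d.ε _ ≫ (D.lunit (D.unit z)).hom)
  rw [hD.lunit_eq]
  exact (comp_eqToHom_heq _ (congrArg ProArr.mk (hD.unit_pcomp (D.unit z)))).symm

theorem DblCat.Companion.hext {D : DblCat.{u, v}} {x y : D.Obj} {f : x ⟶ y}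
    {c d : D.Companion f} (hp : c.pro = d.pro) (hη : HEq c.η d.η) (hε : HEq c.ε d.ε) : c = d :=
  DblCat.Companion.ext hp hη hε

/-- The canonical companion in `Comp D` of an arrow of `D` having a companion: the arrow itself,
with external identities of `D` as binding cells. -/
def DblCat.compCompanion (D : DblCat.{u, v}) {x y : D.Obj} (f : {f : x ⟶ y // D.HasCompanion f}) :
    D.compDbl.Companion (x := x) (y := y) f where
  pro := f.1
  η := (⟨⟨𝟙 x, HasCompanion.id x⟩, f, D.unitCell f.1, by simp, by simp⟩ : QCell D (𝟙 x) f.1)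
  ε := (⟨f, ⟨𝟙 y, HasCompanion.id y⟩, D.unitCell f.1, by simp, by simp⟩ : QCell D f.1 (𝟙 y))
  left_η := rfl
  right_η := rfl
  left_ε := rfl
  right_ε := rfl
  η_ε := QCell.ext (Subtype.ext (Category.id_comp _)) (Subtype.ext (Category.comp_id _)) (by
    change D.scomp (D.unitCell f.1 ≫ D.unitCell (𝟙 y)) (D.unitCell (𝟙 x) ≫ D.unitCell f.1) _ =
      D.unitCell f.1
    simp only [← D.unitCell_comp, Category.comp_id, Category.id_comp]
    exact D.unit_scomp _ _ _)
  ε_η := D.compDbl_isStrict.binding _ _ _ (QCell.hext (Category.id_comp _) (Category.comp_id _)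
    rfl rfl (by
    change D.scomp (D.unitCell (𝟙 x) ≫ D.unitCell f.1) (D.unitCell f.1 ≫ D.unitCell (𝟙 y)) _ =
      D.unitCell f.1
    simp only [← D.unitCell_comp, Category.comp_id, Category.id_comp]
    exact D.unit_scomp _ _ _))

theorem DblCat.compCompanion_comp (D : DblCat.{u, v}) {x y z : D.Obj}
    (f : {f : x ⟶ y // D.HasCompanion f}) (g : {f : y ⟶ z // D.HasCompanion f}) :
    D.compCompanion ⟨f.1 ≫ g.1, f.2.comp g.2⟩ = (D.compCompanion f).comp (D.compCompanion g) := by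
  refine DblCat.Companion.hext rfl ?_ ?_
  · refine HEq.trans (QCell.hext (Category.id_comp _).symm rfl rfl rfl ?_)
      (D.compDbl_isStrict.comp_η (D.compCompanion f) (D.compCompanion g))
    change D.unitCell (f.1 ≫ g.1) = D.scomp (D.unitCell (𝟙 x) ≫
      D.scomp (D.unitCell f.1 ≫ D.unitCell g.1) (D.unitCell f.1 ≫ D.unitCell g.1) _)
      (D.unitCell f.1 ≫ D.unitCell g.1) _
    simp only [← D.unitCell_comp, D.unit_scomp, Category.id_comp]
  · refine HEq.trans (QCell.hext rfl (Category.id_comp _).symm rfl rfl ?_)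
      (D.compDbl_isStrict.comp_ε (D.compCompanion f) (D.compCompanion g))
    change D.unitCell (f.1 ≫ g.1) = D.scomp (D.unitCell f.1 ≫ D.unitCell g.1)
      (D.scomp (D.unitCell f.1 ≫ D.unitCell g.1) (D.unitCell f.1 ≫ D.unitCell g.1) _ ≫
        D.unitCell (𝟙 z)) _
    simp only [← D.unitCell_comp, D.unit_scomp, Category.comp_id]

/-- `Comp D`, with its canonical choice of companions. -/
def Comp (D : DblCat.{u, v}) : CompDblCat.{u, v} where
  dbl := D.compDbl
  strict := D.compDbl_isStrict
  companion f := D.compCompanion f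
  companion_id _ := rfl
  companion_comp f g := D.compCompanion_comp f g

namespace DblFunctor

variable {D E K : DblCat.{u, v}}

/-- The action of a double functor on special cells. -/
def mapSpecial (F : DblFunctor D E) {a b : D.Obj} (σ : D.Cell (D.unit a) (D.unit b)) :
    E.Cell (E.unit (F.obj a)) (E.unit (F.obj b)) :=
  (F.mapUnit a).hom ≫ F.mapCell σ ≫ (F.mapUnit b).inv

variable (F : DblFunctor D E)

@[simp] theorem left_mapSpecial {a b : D.Obj} (σ : D.Cell (D.unit a) (D.unit b)) :
    E.left (F.mapSpecial σ) = F.map (D.left σ) := by simp [mapSpecial]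

@[simp] theorem right_mapSpecial {a b : D.Obj} (σ : D.Cell (D.unit a) (D.unit b)) :
    E.right (F.mapSpecial σ) = F.map (D.right σ) := by simp [mapSpecial]

theorem mapSpecial_comp {a b c : D.Obj} (σ : D.Cell (D.unit a) (D.unit b))
    (τ : D.Cell (D.unit b) (D.unit c)) :
    F.mapSpecial (σ ≫ τ) = F.mapSpecial σ ≫ F.mapSpecial τ := by
  simp [mapSpecial]

theorem mapSpecial_unitCell {a b : D.Obj} (f : a ⟶ b) :
    F.mapSpecial (D.unitCell f) = E.unitCell (F.map f) := by
  rw [mapSpecial, ← Category.assoc, ← F.mapUnit_naturality, Category.assoc, Iso.hom_inv_id,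
    Category.comp_id]

theorem mapUnit_lunit (b : D.Obj) :
    E.hcomp (F.mapUnit b).hom (F.mapUnit b).hom (by simp) ≫ (F.mapComp _ _).hom ≫
      F.mapCell (D.lunit (D.unit b)).hom = (E.lunit (E.unit (F.obj b))).hom ≫ (F.mapUnit b).hom := by
  have h1 : E.hcomp (F.mapUnit b).hom (F.mapUnit b).hom (by simp) =
      E.hcomp (𝟙 (ProArr.mk (E.unit (F.obj b)))) (F.mapUnit b).hom (by simp) ≫
      E.hcomp (F.mapUnit b).hom (𝟙 (ProArr.mk (F.mapPro (D.unit b)))) (by simp) := by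
    rw [← E.hcomp_comp]; exact E.hcomp_congr (by simp) (by simp) _
  rw [h1, Category.assoc, F.mapComp_lunit, ← E.lunit_naturality]
  congr 1
  exact E.hcomp_congr (by rw [left_mapUnit, E.unitCell_id]) rfl _

theorem mapSpecial_scomp {a b : D.Obj} (σ τ : D.Cell (D.unit a) (D.unit b))
    (h : D.right σ = D.left τ) :
    F.mapSpecial (D.scomp σ τ h) = E.scomp (F.mapSpecial σ) (F.mapSpecial τ) (by simp [h]) := by
  have h1 : E.hcomp (F.mapSpecial σ) (F.mapSpecial τ) (by simp [h]) ≫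
      E.hcomp (F.mapUnit b).hom (F.mapUnit b).hom (by simp) =
      E.hcomp (F.mapUnit a).hom (F.mapUnit a).hom (by simp) ≫
        E.hcomp (F.mapCell σ) (F.mapCell τ) (by simp [h]) := by
    rw [← E.hcomp_comp, ← E.hcomp_comp]
    exact E.hcomp_congr (by simp [mapSpecial]) (by simp [mapSpecial]) _
  have h2 := F.mapUnit_lunit a
  have h3 := F.mapUnit_lunit b
  have h4 := F.mapComp_naturality σ τ h
  rw [mapSpecial, DblCat.scomp, DblCat.scomp, Iso.eq_inv_comp, F.mapCell_comp, F.mapCell_comp,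
    ← cancel_mono (F.mapUnit b).hom]
  simp only [Category.assoc, Iso.inv_hom_id, Category.comp_id]
  rw [← h3, ← Category.assoc (E.hcomp (F.mapSpecial σ) _ _), h1, Category.assoc,
    ← Category.assoc (E.hcomp (F.mapCell σ) _ _), h4, Category.assoc, ← F.mapCell_comp,
    ← Category.assoc (E.lunit _).hom, ← h2]
  simp only [Category.assoc]
  congr 2
  rw [← Category.assoc (F.mapCell (D.lunit (D.unit a)).hom), ← F.mapCell_comp, Iso.hom_inv_id,
    F.mapCell_id, Category.id_comp]

theorem mapSpecial_appUnit {F G : DblFunctor D E} (τ : DblNatTrans F G) {a b : D.Obj}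
    (σ : D.Cell (D.unit a) (D.unit b)) :
    F.mapSpecial σ ≫ E.unitCell (τ.app b) = E.unitCell (τ.app a) ≫ G.mapSpecial σ := by
  have h2 := τ.appPro_unit b
  have h3 := τ.cell_naturality σ
  rw [mapSpecial, mapSpecial, ← cancel_mono (G.mapUnit b).hom]
  simp only [Category.assoc, Iso.inv_hom_id, Category.comp_id]
  rw [← h2, Iso.inv_hom_id_assoc, h3, ← Category.assoc, τ.appPro_unit, Category.assoc]

end DblFunctor

/-- The image of a cell of `Comp D` under a double functor. -/
@[reducible]
def QCell.map {D E : DblCat.{u, v}} (F : DblFunctor D E) {x y w z : D.Obj} {h : x ⟶ y} {k : w ⟶ z}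
    (α : QCell D h k) : QCell E (F.map h) (F.map k) where
  left := ⟨F.map α.left.1, α.left.2.elim fun c => ⟨c.map F⟩⟩
  right := ⟨F.map α.right.1, α.right.2.elim fun c => ⟨c.map F⟩⟩
  cell := F.mapSpecial α.cell
  left_cell := by simp
  right_cell := by simp

namespace QCell

variable {D E : DblCat.{u, v}} (F : DblFunctor D E)

theorem map_vcomp {x y w z s t : D.Obj} {h : x ⟶ y} {k : w ⟶ z} {l : s ⟶ t} (α : QCell D h k)
    (β : QCell D k l) : (α.vcomp β).map F = (α.map F).vcomp (β.map F) :=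
  QCell.ext (Subtype.ext (F.map_comp _ _)) (Subtype.ext (F.map_comp _ _)) (by
    simp only [F.mapSpecial_scomp, F.mapSpecial_comp, F.mapSpecial_unitCell])

theorem map_id {x y : D.Obj} (h : x ⟶ y) : (QCell.id h).map F = QCell.id (F.map h) :=
  QCell.ext (Subtype.ext (F.map_id _)) (Subtype.ext (F.map_id _)) (F.mapSpecial_unitCell h)

theorem map_hcomp {x y z x' y' z' : D.Obj} {h : x ⟶ y} {l : y ⟶ z} {h' : x' ⟶ y'} {l' : y' ⟶ z'}
    (α : QCell D h h') (β : QCell D l l') (e : α.right = β.left)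
    (e' : (α.map F).right = (β.map F).left) :
    HEq ((α.map F).hcomp (β.map F) e') ((α.hcomp β e).map F) :=
  QCell.hext (F.map_comp _ _).symm (F.map_comp _ _).symm rfl rfl (by
    simp only [F.mapSpecial_scomp, F.mapSpecial_comp, F.mapSpecial_unitCell])

theorem map_unit {x w : D.Obj} (f : {f : x ⟶ w // D.HasCompanion f}) :
    HEq (QCell.unit (D := E) ⟨F.map f.1, f.2.elim fun c => ⟨c.map F⟩⟩) ((QCell.unit f).map F) :=
  QCell.hext (F.map_id _).symm (F.map_id _).symm rfl rfl (F.mapSpecial_unitCell f.1).symm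

theorem map_heq {x y w z : D.Obj} {h h' : x ⟶ y} {k k' : w ⟶ z} {α : QCell D h k}
    {β : QCell D h' k'} (e : h = h') (e' : k = k') (H : HEq α β) : HEq (α.map F) (β.map F) := by
  subst e e'; cases H; rfl

end QCell

/-- A strict double functor between strict double categories, from its actions on objects, arrows,
proarrows and cells. -/
@[reducible]
def DblFunctor.ofStrict {D E : DblCat.{u, v}} (hD : D.IsStrict) (hE : E.IsStrict)
    (obj : D.Obj → E.Obj) (map : ∀ {a b : D.Obj}, (a ⟶ b) → (obj a ⟶ obj b))
    (map_id : ∀ a, map (𝟙 a) = 𝟙 (obj a))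
    (map_comp : ∀ {a b c : D.Obj} (f : a ⟶ b) (g : b ⟶ c), map (f ≫ g) = map f ≫ map g)
    (mapPro : ∀ {a b : D.Obj}, D.Pro a b → E.Pro (obj a) (obj b))
    (mapCell : ∀ {a b c d : D.Obj} {m : D.Pro a b} {n : D.Pro c d},
      D.Cell m n → E.Cell (mapPro m) (mapPro n))
    (left_mapCell : ∀ {a b c d : D.Obj} {m : D.Pro a b} {n : D.Pro c d} (α : D.Cell m n),
      E.left (mapCell α) = map (D.left α))
    (right_mapCell : ∀ {a b c d : D.Obj} {m : D.Pro a b} {n : D.Pro c d} (α : D.Cell m n),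
      E.right (mapCell α) = map (D.right α))
    (mapCell_id : ∀ {a b : D.Obj} (m : D.Pro a b), mapCell (𝟙 (ProArr.mk m)) = 𝟙 _)
    (mapCell_comp : ∀ {a b c d e f : D.Obj} {m : D.Pro a b} {n : D.Pro c d} {p : D.Pro e f}
      (α : D.Cell m n) (β : D.Cell n p), mapCell (α ≫ β) = mapCell α ≫ mapCell β)
    (mapPro_unit : ∀ a, E.unit (obj a) = mapPro (D.unit a))
    (mapPro_pcomp : ∀ {a b c : D.Obj} (m : D.Pro a b) (n : D.Pro b c),
      E.pcomp (mapPro m) (mapPro n) = mapPro (D.pcomp m n))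
    (unitCell : ∀ {a b : D.Obj} (f : a ⟶ b), HEq (E.unitCell (map f)) (mapCell (D.unitCell f)))
    (hcomp : ∀ {a b c a' b' c' : D.Obj} {m : D.Pro a b} {n : D.Pro b c}
      {m' : D.Pro a' b'} {n' : D.Pro b' c'} (α : D.Cell m m') (β : D.Cell n n')
      (h : D.right α = D.left β),
      HEq (E.hcomp (mapCell α) (mapCell β) (by rw [left_mapCell, right_mapCell, h]))
        (mapCell (D.hcomp α β h))) :
    DblFunctor D E :=
  have map_eqToHom : ∀ {a b : D.Obj} {m m' : D.Pro a b} (hm : m = m'),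
      mapCell (eqToHom (congrArg ProArr.mk hm)) =
        eqToHom (congrArg ProArr.mk (congrArg mapPro hm)) := by
    intro a b m m' hm; subst hm; exact mapCell_id m
  { obj := obj
    map := map
    map_id := map_id
    map_comp := map_comp
    mapPro := mapPro
    mapCell := mapCell
    left_mapCell := left_mapCell
    right_mapCell := right_mapCell
    mapCell_id := mapCell_id
    mapCell_comp := mapCell_comp
    mapUnit := fun a => eqToIso (congrArg ProArr.mk (mapPro_unit a))
    left_mapUnit := fun a => E.left_eqToHom (mapPro_unit a)
    right_mapUnit := fun a => E.right_eqToHom (mapPro_unit a)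
    mapUnit_naturality := fun {a b} f => comm_of_heq_cat (congrArg ProArr.mk (mapPro_unit a))
      (congrArg ProArr.mk (mapPro_unit b)) (unitCell f)
    mapComp := fun m n => eqToIso (congrArg ProArr.mk (mapPro_pcomp m n))
    left_mapComp := fun m n => E.left_eqToHom (mapPro_pcomp m n)
    right_mapComp := fun m n => E.right_eqToHom (mapPro_pcomp m n)
    mapComp_naturality := fun {_ _ _ _ _ _ m n m' n'} α β h =>
      comm_of_heq_cat (congrArg ProArr.mk (mapPro_pcomp m n))
        (congrArg ProArr.mk (mapPro_pcomp m' n')) (hcomp α β h)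
    mapComp_assoc := fun m n p => by
      have h1 := E.hcomp_eqToHom (mapPro_pcomp m n) (Eq.refl (mapPro p))
      have h2 := E.hcomp_eqToHom (Eq.refl (mapPro m)) (mapPro_pcomp n p)
      have h3 : mapCell (D.assoc m n p).hom = eqToHom (congrArg ProArr.mk
          (congrArg mapPro (hD.pcomp_assoc m n p))) := by
        rw [hD.assoc_eq]; exact map_eqToHom (hD.pcomp_assoc m n p)
      rw [h3, hE.assoc_eq]
      refine (congrArg (· ≫ _) h1).trans (Eq.trans ?_
        (congrArg (fun x => (eqToIso _).hom ≫ x ≫ _) h2.symm))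
      simp only [eqToIso.hom, eqToHom_trans]
    mapComp_lunit := fun {a b} m => by
      have h1 := E.hcomp_eqToHom (mapPro_unit a) (Eq.refl (mapPro m))
      have h3 : mapCell (D.lunit m).hom = eqToHom (congrArg ProArr.mk
          (congrArg mapPro (hD.unit_pcomp m))) := by
        rw [hD.lunit_eq]; exact map_eqToHom (hD.unit_pcomp m)
      rw [h3, hE.lunit_eq]
      refine (congrArg (· ≫ _) h1).trans ?_
      simp only [eqToIso.hom, eqToHom_trans]
    mapComp_runit := fun {a b} m => by
      have h1 := E.hcomp_eqToHom (Eq.refl (mapPro m)) (mapPro_unit b)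
      have h3 : mapCell (D.runit m).hom = eqToHom (congrArg ProArr.mk
          (congrArg mapPro (hD.pcomp_unit m))) := by
        rw [hD.runit_eq]; exact map_eqToHom (hD.pcomp_unit m)
      rw [h3, hE.runit_eq]
      refine (congrArg (· ≫ _) h1).trans ?_
      simp only [eqToIso.hom, eqToHom_trans] }

/-- The strict double functor `Comp F`, which acts as the 2-functor underlying `F`. -/
def DblFunctor.compDbl {D E : DblCat.{u, v}} (F : DblFunctor D E) :
    DblFunctor D.compDbl E.compDbl :=
  DblFunctor.ofStrict D.compDbl_isStrict E.compDbl_isStrict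
    (obj := fun a => F.obj a)
    (map := fun f => ⟨F.map f.1, f.2.elim fun c => ⟨c.map F⟩⟩)
    (map_id := fun a => Subtype.ext (F.map_id a))
    (map_comp := fun f g => Subtype.ext (F.map_comp f.1 g.1))
    (mapPro := fun h => F.map h)
    (mapCell := fun α => QCell.map F α)
    (left_mapCell := fun _ => rfl)
    (right_mapCell := fun _ => rfl)
    (mapCell_id := fun h => QCell.map_id F h)
    (mapCell_comp := fun α β => QCell.map_vcomp F α β)
    (mapPro_unit := fun a => (F.map_id a).symm)
    (mapPro_pcomp := fun f g => (F.map_comp f g).symm)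
    (unitCell := fun f => QCell.map_unit F f)
    (hcomp := fun α β e => QCell.map_hcomp F α β e
      (Subtype.ext (congrArg (fun g => F.map g.1) e)))

theorem DblFunctor.compDbl_isStrict {D E : DblCat.{u, v}} (F : DblFunctor D E) :
    F.compDbl.IsStrict where
  mapPro_unit a := (F.map_id a).symm
  mapPro_pcomp f g := (F.map_comp f g).symm
  mapUnit_eq _ := rfl
  mapComp_eq _ _ := rfl

theorem DblFunctor.IsStrict.map_η {D E : DblCat.{u, v}} {F : DblFunctor D E} (hF : F.IsStrict)
    {x y : D.Obj} {f : x ⟶ y} (c : D.Companion f) : HEq (c.map F).η (F.mapCell c.η) := by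
  change HEq ((F.mapUnit x).hom ≫ F.mapCell c.η) _
  rw [hF.mapUnit_eq]
  exact eqToHom_comp_heq _ (congrArg ProArr.mk (hF.mapPro_unit x))

theorem DblFunctor.IsStrict.map_ε {D E : DblCat.{u, v}} {F : DblFunctor D E} (hF : F.IsStrict)
    {x y : D.Obj} {f : x ⟶ y} (c : D.Companion f) : HEq (c.map F).ε (F.mapCell c.ε) := by
  change HEq (F.mapCell c.ε ≫ (F.mapUnit y).inv) _
  rw [hF.mapUnit_eq]
  exact comp_eqToHom_heq _ (congrArg ProArr.mk (hF.mapPro_unit y)).symm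

/-- The strict double functor `Comp F` preserves the canonical companions. -/
def DblFunctor.compMap {D E : DblCat.{u, v}} (F : DblFunctor D E) :
    CompDblFunctor (Comp D) (Comp E) where
  functor := F.compDbl
  strict := F.compDbl_isStrict
  map_companion {x y} f := by
    refine DblCat.Companion.hext rfl ?_ ?_
    · exact (F.compDbl_isStrict.map_η (D.compCompanion f)).trans
        (QCell.hext (F.map_id x) rfl (Subtype.ext (F.map_id x)) rfl (F.mapSpecial_unitCell f.1))
    · exact (F.compDbl_isStrict.map_ε (D.compCompanion f)).trans
        (QCell.hext rfl (F.map_id y) rfl (Subtype.ext (F.map_id y)) (F.mapSpecial_unitCell f.1))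

/-- The external identity on the naturality square of a natural transformation, as a cell of
`Comp E`. -/
@[reducible]
def QCell.nat {D E : DblCat.{u, v}} {F G : DblFunctor D E} (τ : DblNatTrans F G) {a b : D.Obj}
    (f : {f : a ⟶ b // D.HasCompanion f}) : QCell E (τ.app a) (τ.app b) where
  left := ⟨F.map f.1, f.2.elim fun c => ⟨c.map F⟩⟩
  right := ⟨G.map f.1, f.2.elim fun c => ⟨c.map G⟩⟩
  cell := E.unitCell (τ.app a ≫ G.map f.1)
  left_cell := E.left_unitCell _
  right_cell := by rw [E.right_unitCell, τ.naturality]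

namespace QCell

variable {D E : DblCat.{u, v}} {F G : DblFunctor D E} (τ : DblNatTrans F G)

theorem nat_id (a : D.Obj) :
    QCell.nat τ ⟨𝟙 a, DblCat.HasCompanion.id a⟩ = QCell.id (τ.app a) :=
  QCell.ext (Subtype.ext (F.map_id a)) (Subtype.ext (G.map_id a)) (by simp)

theorem nat_comp {a b c : D.Obj} (f : {f : a ⟶ b // D.HasCompanion f})
    (g : {f : b ⟶ c // D.HasCompanion f}) :
    QCell.nat τ ⟨f.1 ≫ g.1, f.2.comp g.2⟩ = (QCell.nat τ f).vcomp (QCell.nat τ g) :=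
  QCell.ext (Subtype.ext (F.map_comp f.1 g.1)) (Subtype.ext (G.map_comp f.1 g.1)) (by
    have h' : (τ.app a ≫ G.map f.1) ≫ G.map g.1 = F.map f.1 ≫ τ.app b ≫ G.map g.1 := by
      rw [← τ.naturality, Category.assoc]
    change E.unitCell (τ.app a ≫ G.map (f.1 ≫ g.1)) =
      E.scomp (E.unitCell (τ.app a ≫ G.map f.1) ≫ E.unitCell (G.map g.1))
        (E.unitCell (F.map f.1) ≫ E.unitCell (τ.app b ≫ G.map g.1)) _
    simp only [← E.unitCell_comp, ← h']
    rw [E.unit_scomp, G.map_comp, Category.assoc])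

theorem nat_naturality {a b c d : D.Obj} {m : a ⟶ b} {n : c ⟶ d} (α : QCell D m n)
    (e : (α.map F).right = (nat τ α.right).left) (e' : (nat τ α.left).right = (α.map G).left) :
    HEq ((α.map F).hcomp (nat τ α.right) e) ((nat τ α.left).hcomp (α.map G) e') :=
  QCell.hext (τ.naturality m) (τ.naturality n) rfl rfl (by
    change E.scomp (E.unitCell (F.map m) ≫ E.unitCell (τ.app b ≫ G.map α.right.1))
        (F.mapSpecial α.cell ≫ E.unitCell (τ.app d)) _ =
      E.scomp (E.unitCell (τ.app a) ≫ G.mapSpecial α.cell)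
        (E.unitCell (τ.app a ≫ G.map α.left.1) ≫ E.unitCell (G.map n)) _
    simp only [← E.unitCell_comp]
    rw [E.unit_scomp, E.scomp_unit]
    exact DblFunctor.mapSpecial_appUnit τ α.cell)

theorem nat_hcomp {H : DblFunctor D E} (σ : DblNatTrans G H) {a b : D.Obj}
    (f : {f : a ⟶ b // D.HasCompanion f}) :
    QCell.nat (DblNatTrans.instCategoryDblFunctor.comp τ σ) f =
      (QCell.nat τ f).hcomp (QCell.nat σ f) rfl :=
  QCell.ext rfl rfl (by
    have h : (τ.app a ≫ G.map f.1) ≫ σ.app b = τ.app a ≫ σ.app a ≫ H.map f.1 := by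
      rw [Category.assoc, σ.naturality]
    change E.unitCell ((τ.app a ≫ σ.app a) ≫ H.map f.1) =
      E.scomp (E.unitCell (τ.app a) ≫ E.unitCell (σ.app a ≫ H.map f.1))
        (E.unitCell (τ.app a ≫ G.map f.1) ≫ E.unitCell (σ.app b)) _
    simp only [← E.unitCell_comp, h]
    rw [E.unit_scomp, Category.assoc])

theorem nat_map {K : DblCat.{u, v}} (H : DblFunctor E K) {a b : D.Obj}
    (f : {f : a ⟶ b // D.HasCompanion f}) :
    QCell.nat (DblNatTrans.whiskerRight τ H) f = (QCell.nat τ f).map H :=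
  QCell.ext rfl rfl (by
    change K.unitCell (H.map (τ.app a) ≫ H.map (G.map f.1)) =
      H.mapSpecial (E.unitCell (τ.app a ≫ G.map f.1))
    rw [H.mapSpecial_unitCell, H.map_comp])

theorem map_idFunctor {x y w z : D.Obj} {h : x ⟶ y} {k : w ⟶ z} (α : QCell D h k) :
    α.map (DblFunctor.id D) = α :=
  QCell.ext rfl rfl ((Category.id_comp _).trans (Category.comp_id _))

theorem map_compFunctor {K : DblCat.{u, v}} (F : DblFunctor D E) (G : DblFunctor E K)
    {x y w z : D.Obj} {h : x ⟶ y} {k : w ⟶ z} (α : QCell D h k) :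
    α.map (F.comp G) = (α.map F).map G :=
  QCell.ext rfl rfl (by
    change (G.mapUnit _ ≪≫ G.mapCellIso (F.mapUnit _)).hom ≫ G.mapCell (F.mapCell α.cell) ≫
      (G.mapUnit _ ≪≫ G.mapCellIso (F.mapUnit _)).inv =
      (G.mapUnit _).hom ≫ G.mapCell ((F.mapUnit _).hom ≫ F.mapCell α.cell ≫ (F.mapUnit _).inv) ≫
      (G.mapUnit _).inv
    simp)

end QCell

/-- The strict protransformation `Comp τ`: its component at an object is that of `τ`, and its
component at an arrow with a companion is the external identity on the naturality square. -/
def DblNatTrans.compTrans {D E : DblCat.{u, v}} {F G : DblFunctor D E} (τ : DblNatTrans F G) :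
    ProTrans F.compDbl G.compDbl where
  app a := τ.app a
  appArr f := QCell.nat τ f
  left_appArr _ := rfl
  right_appArr _ := rfl
  appArr_id a := QCell.nat_id τ a
  appArr_comp f g := QCell.nat_comp τ f g
  naturality m := τ.naturality m
  cell_naturality α := QCell.nat_naturality τ α rfl rfl

/-- Strict double functors with the same actions are equal. -/
theorem DblFunctor.IsStrict.ext_of_rfl {D E : DblCat.{u, v}} {F G : DblFunctor D E}
    (hF : F.IsStrict) (hG : G.IsStrict) (hobj : F.obj = G.obj)
    (hmap : ∀ {a b : D.Obj} (f : a ⟶ b), HEq (F.map f) (G.map f))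
    (hpro : ∀ {a b : D.Obj} (m : D.Pro a b), HEq (F.mapPro m) (G.mapPro m))
    (hcell : ∀ {a b c d : D.Obj} {m : D.Pro a b} {n : D.Pro c d} (α : D.Cell m n),
      HEq (F.mapCell α) (G.mapCell α)) : F = G := by
  obtain ⟨hu, hc, hu', hc'⟩ := hF
  obtain ⟨ku, kc, ku', kc'⟩ := hG
  obtain ⟨Fo, Fm, _, _, Fp, Fc, _, _, _, _, Fu, _, _, _, Fk, _, _, _, _, _, _⟩ := F
  obtain ⟨Go, Gm, _, _, Gp, Gc, _, _, _, _, Gu, _, _, _, Gk, _, _, _, _, _, _⟩ := G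
  dsimp only at *
  subst hobj
  obtain rfl : @Fm = @Gm := by
    funext a b f; exact eq_of_heq (hmap f)
  obtain rfl : @Fp = @Gp := by
    funext a b f; exact eq_of_heq (hpro f)
  obtain rfl : @Fc = @Gc := by
    funext a b c d m n f; exact eq_of_heq (hcell f)
  obtain rfl : @Fu = @Gu := by
    funext a; rw [hu', ku']
  obtain rfl : @Fk = @Gk := by
    funext a b c m n; rw [hc', kc']
  rfl

/-- Companions, as a 2-functor from the 2-category of double categories to the 2-category of strict
double categories with a functorial choice of companions. -/
def compTwoFunctor : StrictPseudofunctor DblCat.{u, v} CompDblCat.{u, v} :=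
  StrictPseudofunctor.mk''
    { obj := fun D => Comp D
      map := fun F => DblFunctor.compMap F
      map₂ := fun τ => DblNatTrans.compTrans τ
      map₂_id := fun F => ProTrans.hext (fun _ => rfl) (fun f => QCell.hext rfl rfl rfl rfl
        (congrArg (DblCat.unitCell _) (Category.id_comp _)))
      map₂_comp := fun σ τ => ProTrans.hext (fun _ => rfl) (fun f => heq_of_eq (QCell.nat_hcomp σ τ f))
      map_id := fun D => CompDblFunctor.ext (DblFunctor.IsStrict.ext_of_rfl
        (DblFunctor.compDbl_isStrict _) (DblFunctor.IsStrict.id _) rfl (fun _ => HEq.rfl)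
        (fun _ => HEq.rfl) (fun α => heq_of_eq (QCell.map_idFunctor α)))
      map_comp := fun F G => CompDblFunctor.ext (DblFunctor.IsStrict.ext_of_rfl
        (DblFunctor.compDbl_isStrict _) ((DblFunctor.compDbl_isStrict F).comp
          (DblFunctor.compDbl_isStrict G)) rfl (fun _ => HEq.rfl)
        (fun _ => HEq.rfl) (fun α => heq_of_eq (QCell.map_compFunctor F G α)))
      map₂_whisker_left := fun {_ _ _} H {F G} τ =>
        ProTrans.conj_ext (F := DblFunctor.compMap (DblFunctor.comp H F))
          (F' := CompDblFunctor.comp (DblFunctor.compMap H) (DblFunctor.compMap F))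
          (G' := CompDblFunctor.comp (DblFunctor.compMap H) (DblFunctor.compMap G))
          (G := DblFunctor.compMap (DblFunctor.comp H G)) _ _
          (DblNatTrans.compTrans (DblNatTrans.whiskerLeft H τ))
          (ProTrans.whiskerLeft (DblFunctor.compDbl H) (DblNatTrans.compTrans τ))
          (fun _ => HEq.rfl) (fun _ => HEq.rfl)
      map₂_whisker_right := fun {_ _ _ F G} τ H =>
        ProTrans.conj_ext (F := DblFunctor.compMap (DblFunctor.comp F H))
          (F' := CompDblFunctor.comp (DblFunctor.compMap F) (DblFunctor.compMap H))
          (G' := CompDblFunctor.comp (DblFunctor.compMap G) (DblFunctor.compMap H))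
          (G := DblFunctor.compMap (DblFunctor.comp G H)) _ _
          (DblNatTrans.compTrans (DblNatTrans.whiskerRight τ H))
          (ProTrans.whiskerRight (DblNatTrans.compTrans τ) (DblFunctor.compDbl H)
            (DblFunctor.compDbl_isStrict H)) (fun _ => HEq.rfl)
          (fun f => heq_of_eq (QCell.nat_map τ H f)) }

namespace Biadj

open Bicategory

variable {B C : Type*} [Bicategory B] [Bicategory C] {F : Pseudofunctor B C} {G : Pseudofunctor C B}

/-- The component `a ⟶ G (F a)` of a unit. -/
abbrev unitApp (unit : Pseudofunctor.StrongTrans (Pseudofunctor.id B) (F.comp G)) (a : B) :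
    a ⟶ G.obj (F.obj a) :=
  unit.app a

/-- The pseudonaturality constraint of a unit. -/
abbrev unitNat (unit : Pseudofunctor.StrongTrans (Pseudofunctor.id B) (F.comp G)) {a b : B}
    (f : a ⟶ b) : f ≫ unitApp unit b ≅ unitApp unit a ≫ G.map (F.map f) :=
  unit.naturality f

/-- The component `F (G c) ⟶ c` of a counit. -/
abbrev counitApp (counit : Pseudofunctor.StrongTrans (G.comp F) (Pseudofunctor.id C)) (c : C) :
    F.obj (G.obj c) ⟶ c :=
  counit.app c

/-- The pseudonaturality constraint of a counit. -/
abbrev counitNat (counit : Pseudofunctor.StrongTrans (G.comp F) (Pseudofunctor.id C)) {c d : C}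
    (g : c ⟶ d) : F.map (G.map g) ≫ counitApp counit d ≅ counitApp counit c ≫ g :=
  counit.naturality g

end Biadj

open Bicategory Biadj in
/-- A biadjunction `F ⊣ G` between bicategories: pseudonatural transformations, the unit and the
counit, satisfying the triangle identities up to invertible modifications, the triangulators
`left` and `right`, which in turn satisfy the two swallowtail identities. -/
structure Biadjunction {B C : Type*} [Bicategory B] [Bicategory C] (F : Pseudofunctor B C)
    (G : Pseudofunctor C B) where
  unit : Pseudofunctor.StrongTrans (Pseudofunctor.id B) (F.comp G)
  counit : Pseudofunctor.StrongTrans (G.comp F) (Pseudofunctor.id C)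
  left (a : B) : F.map (unitApp unit a) ≫ counitApp counit (F.obj a) ≅ 𝟙 (F.obj a)
  right (c : C) : unitApp unit (G.obj c) ≫ G.map (counitApp counit c) ≅ 𝟙 (G.obj c)
  /-- `left` is a modification from the pasting of `F unit` and `counit F` to the identity. -/
  left_naturality {a b : B} (f : a ⟶ b) :
    F.map f ◁ (left b).hom ≫ (ρ_ (F.map f)).hom =
      (α_ (F.map f) (F.map (unitApp unit b)) (counitApp counit (F.obj b))).inv ≫
        ((F.mapComp f (unitApp unit b)).inv ≫ F.map₂ (unitNat unit f).hom ≫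
          (F.mapComp (unitApp unit a) (G.map (F.map f))).hom) ▷ counitApp counit (F.obj b) ≫
        (α_ (F.map (unitApp unit a)) (F.map (G.map (F.map f))) (counitApp counit (F.obj b))).hom ≫
        F.map (unitApp unit a) ◁ (counitNat counit (F.map f)).hom ≫
        (α_ (F.map (unitApp unit a)) (counitApp counit (F.obj a)) (F.map f)).inv ≫
        (left a).hom ▷ F.map f ≫ (λ_ (F.map f)).hom
  /-- `right` is a modification from the pasting of `unit G` and `G counit` to the identity. -/
  right_naturality {c d : C} (g : c ⟶ d) :
    G.map g ◁ (right d).hom ≫ (ρ_ (G.map g)).hom =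
      (α_ (G.map g) (unitApp unit (G.obj d)) (G.map (counitApp counit d))).inv ≫
        (unitNat unit (G.map g)).hom ▷ G.map (counitApp counit d) ≫
        (α_ (unitApp unit (G.obj c)) (G.map (F.map (G.map g))) (G.map (counitApp counit d))).hom ≫
        unitApp unit (G.obj c) ◁ ((G.mapComp (F.map (G.map g)) (counitApp counit d)).inv ≫
          G.map₂ (counitNat counit g).hom ≫ (G.mapComp (counitApp counit c) g).hom) ≫
        (α_ (unitApp unit (G.obj c)) (G.map (counitApp counit c)) (G.map g)).inv ≫
        (right c).hom ▷ G.map g ≫ (λ_ (G.map g)).hom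
  /-- the first swallowtail identity -/
  swallowtail_left (a : B) :
    unitApp unit a ◁ ((G.mapComp (F.map (unitApp unit a)) (counitApp counit (F.obj a))).inv ≫
        G.map₂ (left a).hom ≫ (G.mapId (F.obj a)).hom) ≫ (ρ_ (unitApp unit a)).hom =
      (α_ (unitApp unit a) (G.map (F.map (unitApp unit a))) (G.map (counitApp counit (F.obj a)))).inv ≫
        (unitNat unit (unitApp unit a)).inv ▷ G.map (counitApp counit (F.obj a)) ≫
        (α_ (unitApp unit a) (unitApp unit (G.obj (F.obj a))) (G.map (counitApp counit (F.obj a)))).hom ≫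
        unitApp unit a ◁ (right (F.obj a)).hom ≫ (ρ_ (unitApp unit a)).hom
  /-- the second swallowtail identity -/
  swallowtail_right (c : C) :
    ((F.mapComp (unitApp unit (G.obj c)) (G.map (counitApp counit c))).inv ≫ F.map₂ (right c).hom ≫
        (F.mapId (G.obj c)).hom) ▷ counitApp counit c ≫ (λ_ (counitApp counit c)).hom =
      (α_ (F.map (unitApp unit (G.obj c))) (F.map (G.map (counitApp counit c))) (counitApp counit c)).hom ≫
        F.map (unitApp unit (G.obj c)) ◁ (counitNat counit (counitApp counit c)).hom ≫
        (α_ (F.map (unitApp unit (G.obj c))) (counitApp counit (F.obj (G.obj c))) (counitApp counit c)).inv ≫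
        (left (G.obj c)).hom ▷ counitApp counit c ≫ (λ_ (counitApp counit c)).hom

end

/-! The engine is the universal property of companions. For companions `f_!` and `g_!`, sending a
cell `α : f_! ⟶ g_!` to its mate `η ≫ α ≫ ε` is, for prescribed sides `h` and `k`, a bijection onto
the special cells (top and bottom external identities) with left side `h ≫ g` and right side `f ≫
k`; see `mate_ofMate` and `mate_inj`. Such special cells are exactly the cells of `Comp D`, and
`mate_comp` and `mate_hcomp` show that the two compositions of cells between companions become the
two pastings in `Comp D`.

The counit is therefore forced: it sends an arrow with a companion to its chosen companion and a
cell to the cell with that mate. The choice need not be functorial, so this is only a pseudo double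
functor. Its comparison cells are the globular cells whose mate is an external identity. Such
comparisons are unique (`IsComparison.unique`), and this uniqueness is the source of all the
coherence laws.

The unit at `C` fixes objects and proarrows. If `f_!` is the chosen companion of `f` in `C`, then in
the transpose the proarrow `f` is a companion of the arrow `f_!`, with the same binding cells. The
unit sends `f` to `f_!` and a cell to its mate in the transpose. Since the choice in `C` is
functorial, this is a strict double functor, and it is strictly natural in `C` because morphisms
preserve binding cells.

Every proarrow of a transpose is thus a companion. The component of a natural transformation at a
companion has the external identity on a naturality square as its mate (`mate_appPro`), so a natural
transformation out of a transpose is determined by its components at objects (`trans_ext`).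
Conversely, any family at objects that is natural for arrows and special cells extends to proarrows
(`extend`). The counit constraint and the left triangulator are the extensions of identity families;
these extensions exist because the counit acts trivially on special cells
(`counitFunctor_mapSpecial`). The right triangle commutes strictly (`unitMap_comp_counit`).

Every remaining equation compares 2-cells that are identities in a suitable sense. Out of a
transpose it suffices that the components at objects are identities (`HasIdApp.eq`). In the
2-category of strict double categories all 2-cells involved are `eqToHom`s (`IsEqToHom.eq`), and the
link between the two is `HasIdApp.compTrans`. -/

noncomputable section

/-! ### Mates: cells between companions as special cells. -/

namespace DblCat

variable {D E : DblCat.{u, v}}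

namespace Companion

variable {x y w z : D.Obj} {f : x ⟶ w} {g : y ⟶ z}

/-- The special cell corresponding to a cell between companions. -/
def mate (c : D.Companion f) (d : D.Companion g) (α : D.Cell c.pro d.pro) :
    D.Cell (D.unit x) (D.unit z) :=
  c.η ≫ α ≫ d.ε

@[simp] theorem left_mate (c : D.Companion f) (d : D.Companion g) (α : D.Cell c.pro d.pro) :
    D.left (c.mate d α) = D.left α ≫ g := by simp [mate]

@[simp] theorem right_mate (c : D.Companion f) (d : D.Companion g) (α : D.Cell c.pro d.pro) :
    D.right (c.mate d α) = f ≫ D.right α := by simp [mate]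

/-- A cell out of a companion, from a cell out of an external identity. -/
def desc (c : D.Companion f) {a b : D.Obj} {n : D.Pro a b} (k : w ⟶ b)
    (ψ : D.Cell (D.unit x) n) (h : D.right ψ = f ≫ k) : D.Cell c.pro n :=
  (D.lunit c.pro).inv ≫ D.hcomp ψ (c.ε ≫ D.unitCell k) (by simp [h]) ≫ (D.runit n).hom

/-- A cell into a companion, from a cell into an external identity. -/
def lift (d : D.Companion g) {a b : D.Obj} {m : D.Pro a b} (h : a ⟶ y)
    (ψ : D.Cell m (D.unit z)) (e : D.left ψ = h ≫ g) : D.Cell m d.pro :=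
  (D.lunit m).inv ≫ D.hcomp (D.unitCell h ≫ d.η) ψ (by simp [e]) ≫ (D.runit d.pro).hom

/-- By interchange the pasting in `desc` splits into `η ⊙ ε` followed by `φ` beside an external
identity, and the second companion equation turns `η ⊙ ε` into unitors. With `η_comp_desc` this is
the universal property of `η`. -/
theorem desc_η_comp (c : D.Companion f) {a b : D.Obj} {n : D.Pro a b} (φ : D.Cell c.pro n)
    (h : D.right (c.η ≫ φ) = f ≫ D.right φ) : c.desc (D.right φ) (c.η ≫ φ) h = φ := by
  rw [desc, D.hcomp_comp _ _ _ _ (by simp) (by simp), c.hcomp_eq, hcomp_unit]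
  simp

theorem η_comp_desc (c : D.Companion f) {a b : D.Obj} {n : D.Pro a b} (k : w ⟶ b)
    (ψ : D.Cell (D.unit x) n) (h : D.right ψ = f ≫ k) : c.η ≫ c.desc k ψ h = ψ := by
  have e : (D.lunit (D.unit x)).hom ≫ c.η ≫ c.desc k ψ h = (D.runit (D.unit x)).hom ≫ ψ := by
    have e' := D.lunit_naturality c.η
    rw [← Category.assoc, ← e', desc, Category.assoc, Iso.hom_inv_id_assoc, ← Category.assoc,
      ← D.hcomp_comp _ _ _ _ _ (by simp [h]), ← D.runit_naturality]
    congr 1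
    refine D.hcomp_congr (by simp [D.unitCell_id]) ?_ _
    rw [← Category.assoc, c.η_ε, ← D.unitCell_comp, h]
  -- The left and right unitors agree at an external identity, so the same isomorphism can be
  -- cancelled on both sides.
  rw [← D.lunit_unit] at e
  exact (cancel_epi _).1 e

/-- This is the dual universal property, that of `ε`, with the roles of the two sides exchanged;
`comp_ε_lift` is its other half. -/
theorem lift_comp_ε (d : D.Companion g) {a b : D.Obj} {m : D.Pro a b} (φ : D.Cell m d.pro)
    (h : D.left (φ ≫ d.ε) = D.left φ ≫ g) : d.lift (D.left φ) (φ ≫ d.ε) h = φ := by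
  rw [lift, D.hcomp_comp _ _ _ _ (by simp) (by simp), d.hcomp_eq, unit_hcomp]
  simp

theorem comp_ε_lift (d : D.Companion g) {a b : D.Obj} {m : D.Pro a b} (h : a ⟶ y)
    (ψ : D.Cell m (D.unit z)) (e : D.left ψ = h ≫ g) : d.lift h ψ e ≫ d.ε = ψ := by
  have e1 : D.hcomp (D.unitCell h ≫ d.η) ψ (by simp [e]) ≫
      D.hcomp d.ε (D.unitCell (D.right d.ε)) (by simp) =
      D.hcomp (D.unitCell (D.left ψ)) ψ (by simp) := by
    rw [← D.hcomp_comp]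
    refine D.hcomp_congr ?_ (by simp [D.unitCell_id]) _
    rw [Category.assoc, d.η_ε, ← D.unitCell_comp, e]
  rw [lift, Category.assoc, Category.assoc, ← D.runit_naturality, ← Category.assoc (D.hcomp _ _ _),
    e1, ← D.lunit_unit, D.lunit_naturality, Iso.inv_hom_id_assoc]

@[simp] theorem left_desc (c : D.Companion f) {a b : D.Obj} {n : D.Pro a b} (k : w ⟶ b)
    (ψ : D.Cell (D.unit x) n) (h : D.right ψ = f ≫ k) : D.left (c.desc k ψ h) = D.left ψ := by
  simp [desc]

@[simp] theorem right_desc (c : D.Companion f) {a b : D.Obj} {n : D.Pro a b} (k : w ⟶ b)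
    (ψ : D.Cell (D.unit x) n) (h : D.right ψ = f ≫ k) : D.right (c.desc k ψ h) = k := by
  simp [desc]

@[simp] theorem left_lift (d : D.Companion g) {a b : D.Obj} {m : D.Pro a b} (h : a ⟶ y)
    (ψ : D.Cell m (D.unit z)) (e : D.left ψ = h ≫ g) : D.left (d.lift h ψ e) = h := by
  simp [lift]

@[simp] theorem right_lift (d : D.Companion g) {a b : D.Obj} {m : D.Pro a b} (h : a ⟶ y)
    (ψ : D.Cell m (D.unit z)) (e : D.left ψ = h ≫ g) :
    D.right (d.lift h ψ e) = D.right ψ := by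
  simp [lift]

/-- The cell between companions corresponding to a special cell. -/
def ofMate (c : D.Companion f) (d : D.Companion g) (h : x ⟶ y) (k : w ⟶ z)
    (σ : D.Cell (D.unit x) (D.unit z)) (hl : D.left σ = h ≫ g) (hr : D.right σ = f ≫ k) :
    D.Cell c.pro d.pro :=
  c.desc k (d.lift h σ hl) (by simp [hr])

@[simp] theorem left_ofMate (c : D.Companion f) (d : D.Companion g) (h : x ⟶ y) (k : w ⟶ z)
    (σ : D.Cell (D.unit x) (D.unit z)) (hl : D.left σ = h ≫ g) (hr : D.right σ = f ≫ k) :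
    D.left (c.ofMate d h k σ hl hr) = h := by simp [ofMate]

@[simp] theorem right_ofMate (c : D.Companion f) (d : D.Companion g) (h : x ⟶ y) (k : w ⟶ z)
    (σ : D.Cell (D.unit x) (D.unit z)) (hl : D.left σ = h ≫ g) (hr : D.right σ = f ≫ k) :
    D.right (c.ofMate d h k σ hl hr) = k := by simp [ofMate]

-- Surjectivity of the mate correspondence for fixed sides; `mate_inj` is the injectivity.
@[simp] theorem mate_ofMate (c : D.Companion f) (d : D.Companion g) (h : x ⟶ y) (k : w ⟶ z)
    (σ : D.Cell (D.unit x) (D.unit z)) (hl : D.left σ = h ≫ g) (hr : D.right σ = f ≫ k) :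
    c.mate d (c.ofMate d h k σ hl hr) = σ := by
  rw [mate, ofMate, ← Category.assoc, η_comp_desc, comp_ε_lift]

/-- Cells between companions with the same sides are equal if their mates are. -/
theorem mate_inj (c : D.Companion f) (d : D.Companion g) {α β : D.Cell c.pro d.pro}
    (hl : D.left α = D.left β) (hr : D.right α = D.right β) (h : c.mate d α = c.mate d β) :
    α = β := by
  -- The universal property of `η` cancels `η` and uses the right sides; that of `ε` then cancels
  -- `ε` and uses the left sides.
  have h1 : α ≫ d.ε = β ≫ d.ε := by
    rw [← c.desc_η_comp (α ≫ d.ε) (by simp), ← c.desc_η_comp (β ≫ d.ε) (by simp)]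
    simp only [mate] at h
    congr 1
    simp [hr]
  rw [← d.lift_comp_ε α (by simp), ← d.lift_comp_ε β (by simp)]
  congr 1

theorem mate_id (c : D.Companion f) : c.mate c (𝟙 _) = D.unitCell f := by
  rw [mate, Category.id_comp, c.η_ε]

theorem mate_unitCell {a b : D.Obj} (h : a ⟶ b) :
    (Companion.id D a).mate (Companion.id D b) (D.unitCell h) = D.unitCell h :=
  (Category.id_comp _).trans (Category.comp_id _)

/-- Insert `η ⊙ ε` of the middle companion between `φ` and `ψ`: it consists of unitors only, and
interchange regroups the pasting into the two mates. The result is the cell part of `QCell.hcomp`.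
-/
theorem mate_comp {s t : D.Obj} {l : s ⟶ t} (c : D.Companion f) (d : D.Companion g)
    (e : D.Companion l) (φ : D.Cell c.pro d.pro) (ψ : D.Cell d.pro e.pro) :
    c.mate e (φ ≫ ψ) = D.scomp (D.unitCell (D.left φ) ≫ d.mate e ψ)
      (c.mate d φ ≫ D.unitCell (D.right ψ)) (by simp) := by
  have h1 : D.hcomp (D.unitCell (D.left φ) ≫ d.mate e ψ) (c.mate d φ ≫ D.unitCell (D.right ψ))
      (by simp) = D.hcomp (D.unitCell (D.left (c.η ≫ φ))) (c.η ≫ φ) (by simp) ≫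
        D.hcomp d.η d.ε (by simp) ≫
        D.hcomp (ψ ≫ e.ε) (D.unitCell (D.right (ψ ≫ e.ε))) (by simp) := by
    rw [← D.hcomp_comp _ _ _ _ (by simp) (by simp), ← D.hcomp_comp _ _ _ _ (by simp) (by simp)]
    exact D.hcomp_congr (by simp [mate]) (by simp [mate]) _
  rw [scomp, h1, d.hcomp_eq, unit_hcomp, hcomp_unit, lunit_unit_iso, lunit_unit_iso]
  simp [mate]

/-- The binding cells of a composite companion are themselves external composites, so this is
interchange. The result is the cell part of `QCell.vcomp`. -/
theorem mate_hcomp {x₁ x₂ x₃ y₁ y₂ y₃ : D.Obj} {f₁ : x₁ ⟶ x₂} {f₂ : x₂ ⟶ x₃} {g₁ : y₁ ⟶ y₂}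
    {g₂ : y₂ ⟶ y₃} (c₁ : D.Companion f₁) (c₂ : D.Companion f₂) (d₁ : D.Companion g₁)
    (d₂ : D.Companion g₂) (φ₁ : D.Cell c₁.pro d₁.pro) (φ₂ : D.Cell c₂.pro d₂.pro)
    (h : D.right φ₁ = D.left φ₂) :
    (c₁.comp c₂).mate (d₁.comp d₂) (D.hcomp φ₁ φ₂ h) =
      D.scomp (c₁.mate d₁ φ₁ ≫ D.unitCell g₂) (D.unitCell f₁ ≫ c₂.mate d₂ φ₂) (by simp [h]) := by
  have h1 : D.hcomp (c₁.mate d₁ φ₁ ≫ D.unitCell g₂) (D.unitCell f₁ ≫ c₂.mate d₂ φ₂)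
      (by simp [h]) = D.hcomp c₁.η (D.unitCell f₁ ≫ c₂.η) (by simp) ≫ D.hcomp φ₁ φ₂ h ≫
        D.hcomp (d₁.ε ≫ D.unitCell g₂) d₂.ε (by simp) := by
    rw [← D.hcomp_comp _ _ _ _ h (by simp), ← D.hcomp_comp _ _ _ _ (by simp) (by simp [h])]
    exact D.hcomp_congr (by simp [mate]) (by simp [mate]) _
  rw [scomp, h1]
  simp [mate, comp]

/-- Naturality moves the associator past the binding cells, each `η` meets its `ε` and gives an
external identity, and the remaining structure cells cancel by the triangle law. -/
theorem mate_assoc {a b c d : D.Obj} {f : a ⟶ b} {g : b ⟶ c} {h : c ⟶ d} (p : D.Companion f)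
    (q : D.Companion g) (r : D.Companion h) :
    ((p.comp q).comp r).mate (p.comp (q.comp r)) (D.assoc _ _ _).hom =
      D.unitCell (f ≫ g ≫ h) := by
  have h1 : D.hcomp ((D.lunit (D.unit a)).inv ≫ D.hcomp p.η (D.unitCell f ≫ q.η) (by simp))
      (D.unitCell (f ≫ g) ≫ r.η) (by simp) =
      D.hcomp (D.lunit (D.unit a)).inv (𝟙 (ProArr.mk (D.unit a))) (by simp) ≫
        D.hcomp (D.hcomp p.η (D.unitCell f ≫ q.η) (by simp)) (D.unitCell (f ≫ g) ≫ r.η)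
          (by simp) := by
    rw [← D.hcomp_comp]
    exact D.hcomp_congr rfl (by simp) _
  have h2 : D.hcomp (p.ε ≫ D.unitCell (g ≫ h))
      (D.hcomp (q.ε ≫ D.unitCell h) r.ε (by simp) ≫ (D.lunit (D.unit d)).hom) (by simp) =
      D.hcomp (p.ε ≫ D.unitCell (g ≫ h)) (D.hcomp (q.ε ≫ D.unitCell h) r.ε (by simp)) (by simp) ≫
        D.hcomp (𝟙 (ProArr.mk (D.unit d))) (D.lunit (D.unit d)).hom (by simp) := by
    rw [← D.hcomp_comp]
    exact D.hcomp_congr (by simp) rfl _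
  -- With the unitors split off, all three columns collapse by the companion equation `η ≫ ε = id`.
  have h3 : D.hcomp (D.hcomp p.η (D.unitCell f ≫ q.η) (by simp)) (D.unitCell (f ≫ g) ≫ r.η)
        (by simp) ≫ (D.assoc _ _ _).hom ≫
      D.hcomp (p.ε ≫ D.unitCell (g ≫ h)) (D.hcomp (q.ε ≫ D.unitCell h) r.ε (by simp)) (by simp) =
      D.hcomp (D.hcomp (D.unitCell (f ≫ g ≫ h)) (D.unitCell (f ≫ g ≫ h)) (by simp))
        (D.unitCell (f ≫ g ≫ h)) (by simp) ≫ (D.assoc _ _ _).hom := by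
    rw [← D.assoc_naturality _ _ _ (by simp) (by simp), ← Category.assoc,
      ← D.hcomp_comp _ _ _ _ (by simp) (by simp)]
    congr 1
    refine D.hcomp_congr ?_ ?_ _
    · rw [← D.hcomp_comp _ _ _ _ (by simp) (by simp)]
      refine D.hcomp_congr ?_ ?_ _
      · rw [← Category.assoc, p.η_ε, ← D.unitCell_comp]
      · rw [Category.assoc, ← Category.assoc q.η, q.η_ε, ← D.unitCell_comp, ← D.unitCell_comp]
    · rw [Category.assoc, r.η_ε, ← D.unitCell_comp, Category.assoc]
  have h4 : (D.assoc (D.unit d) (D.unit d) (D.unit d)).hom ≫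
      D.hcomp (𝟙 (ProArr.mk (D.unit d))) (D.lunit (D.unit d)).hom (by simp) =
      D.hcomp (D.lunit (D.unit d)).hom (𝟙 (ProArr.mk (D.unit d))) (by simp) := by
    rw [D.triangle]; exact D.hcomp_congr (D.lunit_unit d).symm rfl _
  have h5 : D.hcomp (D.lunit (D.unit a)).inv (𝟙 (ProArr.mk (D.unit a))) (by simp) ≫
      D.hcomp (D.hcomp (D.unitCell (f ≫ g ≫ h)) (D.unitCell (f ≫ g ≫ h)) (by simp))
        (D.unitCell (f ≫ g ≫ h)) (by simp) ≫
      D.hcomp (D.lunit (D.unit d)).hom (𝟙 (ProArr.mk (D.unit d))) (by simp) =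
      D.hcomp (D.unitCell (f ≫ g ≫ h)) (D.unitCell (f ≫ g ≫ h)) (by simp) := by
    rw [← D.hcomp_comp _ _ _ _ (by simp) (by simp), ← D.hcomp_comp _ _ _ _ (by simp) (by simp)]
    exact D.hcomp_congr (D.unit_scomp _ _ _) (by simp) _
  have h6 := congrArg (· ≫ D.hcomp (𝟙 (ProArr.mk (D.unit d))) (D.lunit (D.unit d)).hom (by simp)) h3
  simp only [Category.assoc] at h6
  -- The goal with the binding cells of the iterated composites written out.
  have h7 : ((D.lunit (D.unit a)).inv ≫
      D.hcomp ((D.lunit (D.unit a)).inv ≫ D.hcomp p.η (D.unitCell f ≫ q.η) (by simp))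
        (D.unitCell (f ≫ g) ≫ r.η) (by simp)) ≫
      (D.assoc _ _ _).hom ≫ D.hcomp (p.ε ≫ D.unitCell (g ≫ h))
        (D.hcomp (q.ε ≫ D.unitCell h) r.ε (by simp) ≫ (D.lunit (D.unit d)).hom) (by simp) ≫
      (D.lunit (D.unit d)).hom = D.unitCell (f ≫ g ≫ h) := by
    rw [h1, h2]
    simp only [Category.assoc]
    rw [← Category.assoc (D.hcomp (p.ε ≫ _) _ _), ← Category.assoc (D.assoc _ _ _).hom,
      ← Category.assoc (D.hcomp (D.hcomp _ _ _) _ _)]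
    simp only [Category.assoc]
    rw [reassoc_of% h6, reassoc_of% h4, reassoc_of% h5]
    exact D.unit_scomp _ _ _
  exact h7

/-- Naturality of the unitor at `η` reduces the mate to `η ≫ ε`; `mate_runit` has the same reason.
-/
theorem mate_lunit (c : D.Companion f) :
    ((Companion.id D x).comp c).mate c (D.lunit c.pro).hom = D.unitCell f := by
  have h := D.lunit_naturality c.η
  have h1 : D.hcomp (𝟙 (ProArr.mk (D.unit x))) (D.unitCell (𝟙 x) ≫ c.η) (by simp) =
      D.hcomp (D.unitCell (D.left c.η)) c.η (by simp) :=
    D.hcomp_congr (by simp [D.unitCell_id]) (by simp [D.unitCell_id]) _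
  change ((D.lunit (D.unit x)).inv ≫ D.hcomp (𝟙 (ProArr.mk (D.unit x)))
    (D.unitCell (𝟙 x) ≫ c.η) _) ≫ _ ≫ _ = _
  rw [h1, Category.assoc, ← Category.assoc (D.hcomp _ _ _), h]
  simp [c.η_ε]

theorem mate_runit (c : D.Companion f) :
    (c.comp (Companion.id D w)).mate c (D.runit c.pro).hom = D.unitCell f := by
  have h := D.runit_naturality c.η
  have h1 : D.hcomp c.η (D.unitCell f ≫ 𝟙 (ProArr.mk (D.unit w))) (by simp) =
      D.hcomp c.η (D.unitCell (D.right c.η)) (by simp) :=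
    D.hcomp_congr rfl (by simp) _
  change ((D.lunit (D.unit x)).inv ≫ D.hcomp c.η (D.unitCell f ≫ 𝟙 (ProArr.mk (D.unit w))) _) ≫
    _ ≫ _ = _
  rw [h1, Category.assoc, ← Category.assoc (D.hcomp _ _ _), h, D.lunit_unit_iso]
  simp [c.η_ε]

/-- The binding cells of `Companion.map` carry exactly the `mapUnit` cells by which `mapSpecial`
conjugates. -/
theorem map_mate (F : DblFunctor D E) (c : D.Companion f) (d : D.Companion g)
    (α : D.Cell c.pro d.pro) :
    (c.map F).mate (d.map F) (F.mapCell α) = F.mapSpecial (c.mate d α) := by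
  change ((F.mapUnit x).hom ≫ F.mapCell c.η) ≫ F.mapCell α ≫ F.mapCell d.ε ≫ (F.mapUnit z).inv =
    (F.mapUnit x).hom ≫ F.mapCell (c.η ≫ α ≫ d.ε) ≫ (F.mapUnit z).inv
  simp only [F.mapCell_comp, Category.assoc]

theorem mate_mapUnit (F : DblFunctor D E) (a : D.Obj) :
    (Companion.id E (F.obj a)).mate ((Companion.id D a).map F) (F.mapUnit a).hom =
      𝟙 (ProArr.mk (E.unit (F.obj a))) := by
  change 𝟙 _ ≫ (F.mapUnit a).hom ≫ F.mapCell (𝟙 _) ≫ (F.mapUnit a).inv = _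
  rw [F.mapCell_id, Category.id_comp, Category.id_comp, Iso.hom_inv_id]

/-- Shows that, at companions, the comparison cells of a double functor are forced: they are
comparisons of companions. -/
theorem mate_mapComp (F : DblFunctor D E) {a b c : D.Obj} {f : a ⟶ b} {g : b ⟶ c}
    (p : D.Companion f) (q : D.Companion g) :
    ((p.map F).comp (q.map F)).mate ((p.comp q).map F) (F.mapComp p.pro q.pro).hom =
      E.unitCell (F.map f ≫ F.map g) := by
  have h0 := (F.mapUnit_naturality (f ≫ g)).symm
  -- After naturality of `mapComp`, both columns collapse by `η ≫ ε = id` and naturality of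
  -- `mapUnit`; the two `mapUnit` cells left over are absorbed by `mapUnit_lunit`.
  have h1 : E.hcomp ((F.mapUnit a).hom ≫ F.mapCell p.η)
        (E.unitCell (F.map f) ≫ (F.mapUnit b).hom ≫ F.mapCell q.η) (by simp) ≫
      E.hcomp (F.mapCell (p.ε ≫ D.unitCell g)) (F.mapCell q.ε)
        (by rw [F.right_mapCell, F.left_mapCell]; simp) =
      E.hcomp (E.unitCell (F.map f ≫ F.map g)) (E.unitCell (F.map f ≫ F.map g)) (by simp) ≫
        E.hcomp (F.mapUnit c).hom (F.mapUnit c).hom (by simp) := by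
    rw [← E.hcomp_comp, ← E.hcomp_comp]
    refine E.hcomp_congr ?_ ?_ _
    · rw [Category.assoc, ← F.mapCell_comp, ← Category.assoc p.η, p.η_ε, ← D.unitCell_comp,
        h0, F.map_comp]
    · rw [Category.assoc, Category.assoc, ← F.mapCell_comp, q.η_ε, ← F.mapUnit_naturality,
        ← Category.assoc, ← E.unitCell_comp]
  have h2 := F.mapComp_naturality (p.ε ≫ D.unitCell g) q.ε (by simp)
  have h3 := F.mapUnit_lunit c
  have h4 : ((E.lunit (E.unit (F.obj a))).inv ≫
      E.hcomp ((F.mapUnit a).hom ≫ F.mapCell p.η)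
        (E.unitCell (F.map f) ≫ (F.mapUnit b).hom ≫ F.mapCell q.η) (by simp)) ≫
      (F.mapComp _ _).hom ≫
      F.mapCell (D.hcomp (p.ε ≫ D.unitCell g) q.ε (by simp) ≫ (D.lunit (D.unit c)).hom) ≫
      (F.mapUnit c).inv = E.unitCell (F.map f ≫ F.map g) := by
    rw [F.mapCell_comp]
    simp only [Category.assoc]
    rw [← reassoc_of% h2, reassoc_of% h1, reassoc_of% h3, Iso.hom_inv_id, Category.comp_id]
    exact E.unit_scomp _ _ _
  exact h4

/-- Cell naturality at `η` brings `η` and `ε` together. The right-hand side involves only components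
at objects, so these determine the component at a companion. -/
theorem mate_appPro {F G : DblFunctor D E} (τ : DblNatTrans F G) (c : D.Companion f) :
    (c.map F).mate (c.map G) (τ.appPro c.pro) = E.unitCell (τ.app x ≫ G.map f) := by
  have h := τ.cell_naturality c.η
  have h' := τ.appPro_unit x
  change ((F.mapUnit x).hom ≫ F.mapCell c.η) ≫ _ ≫ G.mapCell c.ε ≫ (G.mapUnit w).inv = _
  rw [Category.assoc, ← Category.assoc (F.mapCell _), h, Category.assoc,
    ← Category.assoc (G.mapCell _), ← G.mapCell_comp, c.η_ε, ← Category.assoc, h', Category.assoc,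
    ← Category.assoc (G.mapUnit x).hom, ← G.mapUnit_naturality, Category.assoc, Iso.hom_inv_id,
    Category.comp_id, ← E.unitCell_comp]

end Companion

end DblCat

/-! ### Companions in the transpose of a strict double category. -/

theorem TCell.iso_eq_eqToIso {D : DblCat.{u, v}} (hD : D.IsStrict) {a b : D.Obj} {f g : a ⟶ b}
    (h : f = g) :
    TCell.iso hD h = @eqToIso _ (TCell.category hD) _ _ (congrArg ProArr.mk h) := by
  subst h; let _ := TCell.category hD; exact Iso.ext rfl

namespace DblCat

variable {D E : DblCat.{u, v}}

theorem transpose_isStrict (hD : D.IsStrict) : (D.transpose hD).IsStrict where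
  pcomp_assoc := D.cat.assoc
  unit_pcomp := D.cat.id_comp
  pcomp_unit := D.cat.comp_id
  assoc_eq _ _ _ := TCell.iso_eq_eqToIso hD _
  lunit_eq _ := TCell.iso_eq_eqToIso hD _
  runit_eq _ := TCell.iso_eq_eqToIso hD _

namespace Companion

/-- A companion in a strict double category, as a companion in the transpose. -/
def transpose (hD : D.IsStrict) {x y : D.Obj} {f : x ⟶ y} (c : D.Companion f) :
    (D.transpose hD).Companion (x := x) (y := y) c.pro where
  pro := f
  η := (⟨D.unit x, c.pro, c.η, c.left_η, c.right_η⟩ : TCell D (𝟙 x) f)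
  ε := (⟨c.pro, D.unit y, c.ε, c.left_ε, c.right_ε⟩ : TCell D f (𝟙 y))
  left_η := rfl
  right_η := rfl
  left_ε := rfl
  right_ε := rfl
  -- Transposition exchanges the two directions of composition, and with them the two companion
  -- equations.
  η_ε := TCell.ext' (hD.unit_pcomp _) (hD.pcomp_unit _) (by
    change HEq (D.hcomp c.η c.ε _) (𝟙 (ProArr.mk c.pro))
    rw [c.hcomp_eq, hD.lunit_eq, hD.runit_eq]
    have := heq_eqToHom_comp_comp (congrArg ProArr.mk (hD.unit_pcomp c.pro)) (𝟙 _)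
      (congrArg ProArr.mk (hD.pcomp_unit c.pro)).symm
    rw [Category.id_comp] at this
    exact this)
  ε_η := (transpose_isStrict hD).binding _ _ _ (TCell.hext rfl rfl (heq_of_eq (by
    change c.η ≫ 𝟙 _ ≫ c.ε = D.unitCell f
    rw [Category.id_comp, c.η_ε])))

theorem transpose_id (hD : D.IsStrict) (x : D.Obj) :
    (Companion.id D x).transpose hD = Companion.id (D.transpose hD) x :=
  Companion.hext rfl
    (heq_of_eq (TCell.ext' rfl rfl (heq_of_eq (D.unitCell_id x).symm)))
    (heq_of_eq (TCell.ext' rfl rfl (heq_of_eq (D.unitCell_id x).symm)))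

/-- Each composite binding cell is a two-by-two pasting, which one side composes by columns and the
other by rows; interchange identifies them, and the unitors are casts by strictness. -/
theorem transpose_comp (hD : D.IsStrict) {x y z : D.Obj} {f : x ⟶ y} {g : y ⟶ z}
    (c : D.Companion f) (d : D.Companion g) :
    (c.comp d).transpose hD = (c.transpose hD).comp (d.transpose hD) := by
  refine Companion.hext rfl ?_ ?_
  · refine HEq.trans ?_ ((transpose_isStrict hD).comp_η (c.transpose hD) (d.transpose hD))
    refine TCell.hext rfl rfl ((hD.comp_η c d).symm.trans ?_)
    have h1 : D.hcomp c.η (D.unitCell f ≫ d.η) (by simp) =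
        D.hcomp c.η (D.unitCell f) (by simp) ≫ D.hcomp (𝟙 (ProArr.mk c.pro)) d.η (by simp) := by
      rw [← D.hcomp_comp]; exact D.hcomp_congr (by simp) rfl _
    rw [h1]
    change HEq _ (c.η ≫ eqToHom (congrArg ProArr.mk (hD.pcomp_unit c.pro).symm) ≫
      D.hcomp (𝟙 (ProArr.mk c.pro)) d.η _)
    rw [← Category.assoc c.η]
    refine D.comp_heq (congrArg ProArr.mk (hD.pcomp_unit _)) rfl rfl ?_ HEq.rfl
    exact (hD.hcomp_unit f c.η (by simp)).trans (comp_eqToHom_heq _ _).symm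
  · refine HEq.trans ?_ ((transpose_isStrict hD).comp_ε (c.transpose hD) (d.transpose hD))
    refine TCell.hext rfl rfl ((hD.comp_ε c d).symm.trans ?_)
    have h1 : D.hcomp (c.ε ≫ D.unitCell g) d.ε (by simp) =
        D.hcomp c.ε (𝟙 (ProArr.mk d.pro)) (by simp) ≫ D.hcomp (D.unitCell g) d.ε (by simp) := by
      rw [← D.hcomp_comp]; exact D.hcomp_congr rfl (by simp) _
    rw [h1]
    change HEq _ (D.hcomp c.ε (𝟙 (ProArr.mk d.pro)) _ ≫
      eqToHom (congrArg ProArr.mk (hD.unit_pcomp d.pro)) ≫ d.ε)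
    refine D.comp_heq rfl rfl (congrArg ProArr.mk (hD.unit_pcomp _)) HEq.rfl ?_
    exact (hD.unit_hcomp g d.ε (by simp)).trans (eqToHom_comp_heq _ _).symm

/-- The comparison cells of `F` and of its transpose are both identities up to casts, so both
binding cells are the image of the original one. This feeds the strict naturality of the unit. -/
theorem transpose_map {F : DblFunctor D E} (hF : F.IsStrict) (hD : D.IsStrict) (hE : E.IsStrict)
    {x y : D.Obj} {f : x ⟶ y} (c : D.Companion f) :
    (c.map F).transpose hE = (c.transpose hD).map (F.transpose hF hD hE) := by
  refine Companion.hext rfl ?_ ?_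
  · refine HEq.symm ((TCell.ofEq_vcomp hE ((c.transpose hD).η.map F) (F.map_id x).symm).trans ?_)
    exact TCell.hext (hF.mapPro_unit x).symm rfl (hF.map_η c).symm
  · refine HEq.symm ((TCell.vcomp_ofEq hE ((c.transpose hD).ε.map F) (F.map_id y)).trans ?_)
    exact TCell.hext rfl (hF.mapPro_unit y).symm (hF.map_ε c).symm

end Companion

end DblCat

/-- The side of a cell is an identity or a composite only propositionally, so functoriality of the
chosen companions is needed in heterogeneous form; the next two lemmas serve the same purpose. -/
theorem CompDblCat.companion_heq_id (C : CompDblCat.{u, v}) {x : C.dbl.Obj} {f : x ⟶ x}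
    (h : f = 𝟙 x) : HEq (C.companion f) (DblCat.Companion.id C.dbl x) := by
  subst h; exact heq_of_eq (C.companion_id x)

theorem CompDblCat.companion_heq_comp (C : CompDblCat.{u, v}) {x y z : C.dbl.Obj} {f : x ⟶ z}
    {g : x ⟶ y} {h : y ⟶ z} (e : f = g ≫ h) :
    HEq (C.companion f) ((C.companion g).comp (C.companion h)) := by
  subst e; exact heq_of_eq (C.companion_comp g h)

theorem CompDblCat.companion_heq (C : CompDblCat.{u, v}) {x y : C.dbl.Obj} {f g : x ⟶ y}
    (e : f = g) : HEq (C.companion f) (C.companion g) := by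
  subst e; rfl

/-! ### Mates formed in the transpose. -/

namespace DblCat.Companion

variable {D : DblCat.{u, v}} (hD : D.IsStrict)

theorem pro_eq {x y : D.Obj} {f g : x ⟶ y} {c : D.Companion f} {d : D.Companion g} (h : f = g)
    (h' : HEq c d) : c.pro = d.pro := by
  subst h; cases h'; rfl

theorem mate_heq {x y w z : D.Obj} {f : x ⟶ w} {g : y ⟶ z} {c c' : D.Companion f}
    {d d' : D.Companion g} (hc : c = c') (hd : d = d') {α : D.Cell c.pro d.pro}
    {α' : D.Cell c'.pro d'.pro} (h : HEq α α') : c.mate d α = c'.mate d' α' := by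
  subst hc hd; cases h; rfl

/-- The mate, in the transpose, of a cell of a strict double category. -/
def tmate {x y w z : D.Obj} {f : x ⟶ w} {g : y ⟶ z} {m : D.Pro x y} {n : D.Pro w z}
    (c : D.Companion f) (d : D.Companion g) (α : D.Cell m n) (hl : D.left α = f)
    (hr : D.right α = g) :
    (D.transpose hD).Cell (a := x) (b := x) (c := z) (d := z) (𝟙 x : x ⟶ x) (𝟙 z : z ⟶ z) :=
  (c.transpose hD).mate (d.transpose hD) (⟨m, n, α, hl, hr⟩ : TCell D f g)

/-- Replaces the chosen companions of the sides of a cell by those of their computed values, so that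
the laws below apply. -/
theorem tmate_congr {x y w z : D.Obj} {f f' : x ⟶ w} {g g' : y ⟶ z} {m : D.Pro x y}
    {n : D.Pro w z} {c : D.Companion f} {d : D.Companion g} {c' : D.Companion f'}
    {d' : D.Companion g'} {α : D.Cell m n} {hl : D.left α = f} {hr : D.right α = g}
    (hf : f = f') (hg : g = g') (hc : HEq c c') (hd : HEq d d') :
    tmate hD c d α hl hr = tmate hD c' d' α (hl.trans hf) (hr.trans hg) := by
  subst hf hg; cases hc; cases hd; rfl

theorem tmate_id {x y : D.Obj} (m : D.Pro x y) :
    tmate hD (Companion.id D x) (Companion.id D y) (𝟙 (ProArr.mk m)) (D.left_id _) (D.right_id _) =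
      (D.transpose hD).unitCell (a := x) (b := y) m := by
  exact (mate_heq (transpose_id hD x) (transpose_id hD y) HEq.rfl).trans
    (mate_unitCell (D := D.transpose hD) (a := x) (b := y) m)

/-- Composition along proarrows in `D` is external composition in the transpose, so this is
`mate_hcomp` there, with `transpose_comp` identifying the composite companions. -/
theorem tmate_comp {x₁ x₂ x₃ y₁ y₂ y₃ : D.Obj} {f₁ : x₁ ⟶ x₂} {f₂ : x₂ ⟶ x₃} {g₁ : y₁ ⟶ y₂}
    {g₂ : y₂ ⟶ y₃} (c₁ : D.Companion f₁) (c₂ : D.Companion f₂) (d₁ : D.Companion g₁)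
    (d₂ : D.Companion g₂) {m : D.Pro x₁ y₁} {n : D.Pro x₂ y₂} {p : D.Pro x₃ y₃} (α : D.Cell m n)
    (β : D.Cell n p) (hα : D.left α = f₁) (hα' : D.right α = g₁) (hβ : D.left β = f₂)
    (hβ' : D.right β = g₂) (h) :
    tmate hD (c₁.comp c₂) (d₁.comp d₂) (α ≫ β) (by rw [D.left_comp, hα, hβ])
        (by rw [D.right_comp, hα', hβ']) =
      (D.transpose hD).scomp (a := x₁) (b := y₃)
        (tmate hD c₁ d₁ α hα hα' ≫ (D.transpose hD).unitCell (a := y₂) (b := y₃) d₂.pro)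
        ((D.transpose hD).unitCell (a := x₁) (b := x₂) c₁.pro ≫ tmate hD c₂ d₂ β hβ hβ') h := by
  have h := mate_hcomp (c₁.transpose hD) (c₂.transpose hD) (d₁.transpose hD) (d₂.transpose hD)
    (⟨m, n, α, hα, hα'⟩ : TCell D f₁ g₁) (⟨n, p, β, hβ, hβ'⟩ : TCell D f₂ g₂) rfl
  refine (mate_heq (transpose_comp hD c₁ c₂) (transpose_comp hD d₁ d₂) (heq_of_eq ?_)).trans h
  exact TCell.ext' rfl rfl (heq_of_eq (by
    change α ≫ β = α ≫ 𝟙 _ ≫ β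
    rw [Category.id_comp]))

/-- External composition in `D` is vertical in the transpose, so this is `mate_comp` there. Two
middle companions occur because the glued sides are only propositionally equal. -/
theorem tmate_hcomp {x y z x' y' z' : D.Obj} {f : x ⟶ x'} {g g' : y ⟶ y'} {h : z ⟶ z'}
    (c : D.Companion f) (d : D.Companion g) (d' : D.Companion g') (e : D.Companion h)
    (hg : g = g') (hd : HEq d d') {m : D.Pro x y} {n : D.Pro y z}
    {m' : D.Pro x' y'} {n' : D.Pro y' z'} (α : D.Cell m m') (β : D.Cell n n')
    (hα : D.left α = f) (hα' : D.right α = g) (hβ : D.left β = g') (hβ' : D.right β = h) (h') :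
    tmate hD c e (D.hcomp α β (hα'.trans (hg.trans hβ.symm))) ((D.left_hcomp _ _ _).trans hα)
        ((D.right_hcomp _ _ _).trans hβ') =
      (D.transpose hD).scomp (a := x) (b := z')
        ((D.transpose hD).unitCell (a := x) (b := y) m ≫ tmate hD d' e β hβ hβ')
        (tmate hD c d α hα hα' ≫ (D.transpose hD).unitCell (a := y') (b := z') n') h' := by
  subst hg
  cases hd
  exact mate_comp (c.transpose hD) (d.transpose hD) (e.transpose hD)
    (⟨m, m', α, hα, hα'⟩ : TCell D f g) (⟨n, n', β, hβ, hβ'⟩ : TCell D g h)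

theorem tmate_unitCell {x y : D.Obj} {f : x ⟶ y} (c : D.Companion f) :
    tmate hD c c (D.unitCell f) (D.left_unitCell f) (D.right_unitCell f) =
      (D.transpose hD).unitCell (a := x) (b := y) c.pro :=
  mate_id (c.transpose hD)

/-- The mate reduces to `η ≫ ε` in the transpose. External identities are the binding cells of
`Comp`, so this and `tmate_ε` make the unit preserve chosen companions. -/
theorem tmate_η {x y : D.Obj} {f : x ⟶ y} (c : D.Companion f) :
    tmate hD (Companion.id D x) c c.η c.left_η c.right_η =
      (D.transpose hD).unitCell (a := x) (b := y) c.pro := by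
  exact (mate_heq (transpose_id hD x) rfl HEq.rfl).trans
    ((Category.id_comp _).trans (c.transpose hD).η_ε)

theorem tmate_ε {x y : D.Obj} {f : x ⟶ y} (c : D.Companion f) :
    tmate hD c (Companion.id D y) c.ε c.left_ε c.right_ε =
      (D.transpose hD).unitCell (a := x) (b := y) c.pro := by
  exact (mate_heq rfl (transpose_id hD y) HEq.rfl).trans
    ((congrArg ((c.transpose hD).η ≫ ·) (Category.comp_id _)).trans (c.transpose hD).η_ε)

end DblCat.Companion

/-! ### The unit. -/

namespace CompDblCat

open DblCat

variable (C : CompDblCat.{u, v})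

/-- An arrow of a strict double category with chosen companions, as an arrow of the transpose
having a companion. -/
def compArrow {x y : C.dbl.Obj} (f : x ⟶ y) :
    {m : C.dbl.Pro x y // (C.dbl.transpose C.strict).HasCompanion (x := x) (y := y) m} :=
  ⟨(C.companion f).pro, ⟨(C.companion f).transpose C.strict⟩⟩

/-- A cell of `C`, as a cell of `Comp` of the transpose of `C`. -/
def compCell {x y w z : C.dbl.Obj} {m : C.dbl.Pro x y} {n : C.dbl.Pro w z} (α : C.dbl.Cell m n) :
    QCell (C.dbl.transpose C.strict) (x := x) (y := y) (w := w) (z := z) m n where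
  left := C.compArrow (C.dbl.left α)
  right := C.compArrow (C.dbl.right α)
  cell := Companion.tmate C.strict (C.companion (C.dbl.left α)) (C.companion (C.dbl.right α)) α
    rfl rfl
  left_cell := Companion.left_mate _ _ _
  right_cell := Companion.right_mate _ _ _

/-- The unit of the biadjunction, as a strict double functor. -/
def unitFunctor : DblFunctor C.dbl (C.dbl.transpose C.strict).compDbl :=
  DblFunctor.ofStrict C.strict (compDbl_isStrict _)
    (obj := fun a => a)
    (map := fun f => C.compArrow f)
    -- Functoriality on arrows is the functoriality of the choice of companions.
    (map_id := fun _ => Subtype.ext (Companion.pro_eq rfl (C.companion_heq_id rfl)))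
    (map_comp := fun _ _ => Subtype.ext (Companion.pro_eq rfl (C.companion_heq_comp rfl)))
    (mapPro := fun m => m)
    (mapCell := fun α => C.compCell α)
    (left_mapCell := fun _ => rfl)
    (right_mapCell := fun _ => rfl)
    -- Each law on cells is the corresponding law for `tmate`, once `tmate_congr` has rewritten the
    -- chosen companions of the sides.
    (mapCell_id := fun m => QCell.ext
      (Subtype.ext (Companion.pro_eq (C.dbl.left_id _) (C.companion_heq_id (C.dbl.left_id _))))
      (Subtype.ext (Companion.pro_eq (C.dbl.right_id _) (C.companion_heq_id (C.dbl.right_id _))))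
      ((Companion.tmate_congr C.strict (C.dbl.left_id _) (C.dbl.right_id _)
        (C.companion_heq_id (C.dbl.left_id _)) (C.companion_heq_id (C.dbl.right_id _))).trans
        (Companion.tmate_id C.strict m)))
    (mapCell_comp := fun α β => QCell.ext
      (Subtype.ext (Companion.pro_eq (C.dbl.left_comp _ _)
        (C.companion_heq_comp (C.dbl.left_comp _ _))))
      (Subtype.ext (Companion.pro_eq (C.dbl.right_comp _ _)
        (C.companion_heq_comp (C.dbl.right_comp _ _))))
      ((Companion.tmate_congr C.strict (C.dbl.left_comp _ _) (C.dbl.right_comp _ _)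
        (C.companion_heq_comp (C.dbl.left_comp _ _))
        (C.companion_heq_comp (C.dbl.right_comp _ _))).trans
        (Companion.tmate_comp C.strict _ _ _ _ α β rfl rfl rfl rfl _)))
    -- Proarrows of `C` are the arrows of its transpose and hence the proarrows of `Comp` of it,
    -- with the same composition.
    (mapPro_unit := fun _ => rfl)
    (mapPro_pcomp := fun _ _ => rfl)
    (unitCell := fun f => QCell.hext rfl rfl
      (Subtype.ext (Companion.pro_eq (C.dbl.left_unitCell f) (C.companion_heq (C.dbl.left_unitCell f)))).symm
      (Subtype.ext (Companion.pro_eq (C.dbl.right_unitCell f) (C.companion_heq (C.dbl.right_unitCell f)))).symm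
      ((Companion.tmate_congr C.strict (C.dbl.left_unitCell f) (C.dbl.right_unitCell f)
        (C.companion_heq (C.dbl.left_unitCell f))
        (C.companion_heq (C.dbl.right_unitCell f))).trans
        (Companion.tmate_unitCell C.strict (C.companion f))).symm)
    (hcomp := fun α β h => QCell.hext rfl rfl
      (Subtype.ext (Companion.pro_eq (C.dbl.left_hcomp α β h) (C.companion_heq (C.dbl.left_hcomp α β h)))).symm
      (Subtype.ext (Companion.pro_eq (C.dbl.right_hcomp α β h) (C.companion_heq (C.dbl.right_hcomp α β h)))).symm
      ((Companion.tmate_congr C.strict (C.dbl.left_hcomp α β h) (C.dbl.right_hcomp α β h)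
        (C.companion_heq (C.dbl.left_hcomp α β h))
        (C.companion_heq (C.dbl.right_hcomp α β h))).trans
        (Companion.tmate_hcomp C.strict _ _ _ _ h (C.companion_heq h) α β rfl rfl rfl rfl _)).symm)

theorem unitFunctor_isStrict : C.unitFunctor.IsStrict where
  mapPro_unit _ := rfl
  mapPro_pcomp _ _ := rfl
  mapUnit_eq _ := rfl
  mapComp_eq _ _ := rfl

/-- The component of the unit of the biadjunction. -/
def unitMap : CompDblFunctor C (Comp (C.dbl.transpose C.strict)) where
  functor := C.unitFunctor
  strict := C.unitFunctor_isStrict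
  map_companion {x y} f := by
    have hl := (C.companion f).left_η
    have hr := (C.companion f).right_η
    have hl' := (C.companion f).left_ε
    have hr' := (C.companion f).right_ε
    refine Companion.hext rfl ?_ ?_
    -- Strictness removes the comparison cell from the binding cell of the image, leaving the mate
    -- of `η`.
    · exact (C.unitFunctor_isStrict.map_η (C.companion f)).trans
        (QCell.hext rfl rfl
          (Subtype.ext (Companion.pro_eq hl (C.companion_heq_id hl)))
          (Subtype.ext (Companion.pro_eq hr (C.companion_heq hr)))
          ((Companion.tmate_congr C.strict hl hr (C.companion_heq_id hl)
            (C.companion_heq hr)).trans (Companion.tmate_η C.strict (C.companion f))))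
    · exact (C.unitFunctor_isStrict.map_ε (C.companion f)).trans
        (QCell.hext rfl rfl
          (Subtype.ext (Companion.pro_eq hl' (C.companion_heq hl')))
          (Subtype.ext (Companion.pro_eq hr' (C.companion_heq_id hr')))
          ((Companion.tmate_congr C.strict hl' hr' (C.companion_heq hl')
            (C.companion_heq_id hr')).trans (Companion.tmate_ε C.strict (C.companion f))))

end CompDblCat

/-! ### Comparisons between companions, and cells with a prescribed mate. -/

namespace DblCat.Companion

variable {D E : DblCat.{u, v}}

/-- A globular cell between companions of the same arrow is a comparison if its mate is an external
identity. -/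
structure IsComparison {x y : D.Obj} {f g : x ⟶ y} (c : D.Companion f) (d : D.Companion g)
    (α : D.Cell c.pro d.pro) : Prop where
  left : D.left α = 𝟙 x
  right : D.right α = 𝟙 y
  mate : c.mate d α = D.unitCell f

namespace IsComparison

section

variable {x y : D.Obj} {f g h : x ⟶ y} {c : D.Companion f} {d : D.Companion g}
  {e : D.Companion h}

theorem eq_arrow {α : D.Cell c.pro d.pro} (H : c.IsComparison d α) : f = g := by
  have := congrArg D.left H.mate
  simpa [H.left] using this.symm

/-- Sides and mate are prescribed, so `mate_inj` applies. Every coherence law of the counit is an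
instance. -/
theorem unique {α β : D.Cell c.pro d.pro} (H : c.IsComparison d α) (H' : c.IsComparison d β) :
    α = β :=
  mate_inj c d (H.left.trans H'.left.symm) (H.right.trans H'.right.symm)
    (H.mate.trans H'.mate.symm)

theorem id (c : D.Companion f) : c.IsComparison c (𝟙 _) :=
  ⟨D.left_id _, D.right_id _, c.mate_id⟩

/-- In the pasting of `mate_comp` the factor coming from the comparison is an external identity and
drops out. -/
theorem mate_comp_right {x' y' : D.Obj} {k : x' ⟶ y'} {b : D.Companion k}
    (φ : D.Cell b.pro c.pro) {ψ : D.Cell c.pro d.pro} (H : c.IsComparison d ψ) :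
    b.mate d (φ ≫ ψ) = b.mate c φ := by
  rw [mate_comp b c d φ ψ]
  refine (D.scomp_congr (τ' := b.mate c φ) (congrArg _ H.mate) ?_ _ (by simp)).trans ?_
  · rw [H.right, D.unitCell_id, Category.comp_id]
  · rw [D.scomp_congr (D.unitCell_comp _ _).symm rfl _ (by simp), D.unit_scomp]

theorem mate_comp_left {x' y' : D.Obj} {k : x' ⟶ y'} {b : D.Companion k}
    {φ : D.Cell c.pro d.pro} (H : c.IsComparison d φ) (ψ : D.Cell d.pro b.pro) :
    c.mate b (φ ≫ ψ) = d.mate b ψ := by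
  have e := H.eq_arrow
  rw [mate_comp c d b φ ψ]
  refine (D.scomp_congr (σ' := d.mate b ψ) ?_ (congrArg (· ≫ _) H.mate) _ (by simp [e])).trans ?_
  · rw [H.left, D.unitCell_id, Category.id_comp]
  · rw [D.scomp_congr rfl (D.unitCell_comp _ _).symm _ (by simp [e]), D.scomp_unit]

theorem comp {α : D.Cell c.pro d.pro} {β : D.Cell d.pro e.pro} (H : c.IsComparison d α)
    (H' : d.IsComparison e β) : c.IsComparison e (α ≫ β) :=
  ⟨by simp [H.left, H'.left], by simp [H.right, H'.right],
    (mate_comp_right α H').trans H.mate⟩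

/-- Composing with comparisons changes neither sides nor mates, so naturality squares with respect
to comparisons amount to equality of mates. -/
theorem naturality {x y x' y' : D.Obj} {f g : x ⟶ y} {f' g' : x' ⟶ y'} (c : D.Companion f)
    (c' : D.Companion g) (d : D.Companion f') (d' : D.Companion g') {α : D.Cell c.pro c'.pro}
    {β : D.Cell d.pro d'.pro} (H : c.IsComparison c' α) (H' : d.IsComparison d' β)
    (φ : D.Cell c.pro d.pro) (φ' : D.Cell c'.pro d'.pro) (hl : D.left φ = D.left φ')
    (hr : D.right φ = D.right φ') (h : c.mate d φ = c'.mate d' φ') : φ ≫ β = α ≫ φ' := by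
  refine mate_inj c d' ?_ ?_ ?_
  · rw [D.left_comp, D.left_comp, H.left, H'.left, hl, Category.id_comp, Category.comp_id]
  · rw [D.right_comp, D.right_comp, H.right, H'.right, hr, Category.id_comp, Category.comp_id]
  · rw [mate_comp_right φ H', mate_comp_left H φ', h]

end

theorem hcomp {x y z : D.Obj} {f f' : x ⟶ y} {g g' : y ⟶ z} {c : D.Companion f}
    {c' : D.Companion f'} {d : D.Companion g} {d' : D.Companion g'} {α : D.Cell c.pro c'.pro}
    {β : D.Cell d.pro d'.pro} (H : c.IsComparison c' α) (H' : d.IsComparison d' β)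
    (h : D.right α = D.left β) : (c.comp d).IsComparison (c'.comp d') (D.hcomp α β h) :=
  ⟨(D.left_hcomp _ _ _).trans H.left, (D.right_hcomp _ _ _).trans H'.right, by
    have e := H'.eq_arrow
    subst e
    rw [mate_hcomp]
    have h1 : c.mate c' α ≫ D.unitCell g = D.unitCell (f ≫ g) := by
      rw [H.mate, D.unitCell_comp]
    have h2 : D.unitCell f ≫ d.mate d' β = D.unitCell (f ≫ g) := by
      rw [H'.mate, D.unitCell_comp]
    rw [D.scomp_congr h1 h2 _ (by simp), D.unit_scomp]⟩

/-- From here on, the structure cells of double categories and double functors are exhibited as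
comparisons, so that uniqueness and invariance of mates apply to them. -/
theorem assoc {a b c d : D.Obj} {f : a ⟶ b} {g : b ⟶ c} {h : c ⟶ d} (p : D.Companion f)
    (q : D.Companion g) (r : D.Companion h) :
    ((p.comp q).comp r).IsComparison (p.comp (q.comp r)) (D.assoc p.pro q.pro r.pro).hom :=
  ⟨D.left_assoc _ _ _, D.right_assoc _ _ _, by rw [mate_assoc, Category.assoc]⟩

theorem lunit {x y : D.Obj} {f : x ⟶ y} (c : D.Companion f) :
    ((Companion.id D x).comp c).IsComparison c (D.lunit c.pro).hom :=
  ⟨D.left_lunit _, D.right_lunit _, by rw [mate_lunit, Category.id_comp]⟩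

theorem runit {x y : D.Obj} {f : x ⟶ y} (c : D.Companion f) :
    (c.comp (Companion.id D y)).IsComparison c (D.runit c.pro).hom :=
  ⟨D.left_runit _, D.right_runit _, by rw [mate_runit, Category.comp_id]⟩

theorem mapUnit (F : DblFunctor D E) (a : D.Obj) :
    (Companion.id E (F.obj a)).IsComparison ((Companion.id D a).map F) (F.mapUnit a).hom :=
  ⟨F.left_mapUnit a, F.right_mapUnit a, by rw [mate_mapUnit, E.unitCell_id]⟩

theorem mapComp (F : DblFunctor D E) {a b c : D.Obj} {f : a ⟶ b} {g : b ⟶ c}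
    (p : D.Companion f) (q : D.Companion g) :
    ((p.map F).comp (q.map F)).IsComparison ((p.comp q).map F) (F.mapComp p.pro q.pro).hom :=
  ⟨F.left_mapComp _ _, F.right_mapComp _ _, mate_mapComp F p q⟩

end IsComparison

section

variable {x y : D.Obj} {f g : x ⟶ y} (c : D.Companion f) (d : D.Companion g)

/-- The comparison between two companions of an arrow. -/
def comparison (h : f = g) : D.Cell c.pro d.pro :=
  c.ofMate d (𝟙 x) (𝟙 y) (D.unitCell f) (by simp [h]) (by simp)

theorem isComparison_comparison (h : f = g) : c.IsComparison d (c.comparison d h) :=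
  ⟨left_ofMate _ _ _ _ _ _ _, right_ofMate _ _ _ _ _ _ _, mate_ofMate _ _ _ _ _ _ _⟩

/-- The comparison between two companions of an arrow, as an isomorphism. -/
def comparisonIso (h : f = g) : ProArr.mk c.pro ≅ ProArr.mk d.pro where
  hom := c.comparison d h
  inv := d.comparison c h.symm
  hom_inv_id := ((c.isComparison_comparison d h).comp
    (d.isComparison_comparison c h.symm)).unique (IsComparison.id c)
  inv_hom_id := ((d.isComparison_comparison c h.symm).comp
    (c.isComparison_comparison d h)).unique (IsComparison.id d)

end

section

/-- The cell between companions corresponding to a cell of `Comp D`. -/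
def ofQCell {x y w z : D.Obj} {f : x ⟶ w} {g : y ⟶ z} {h : x ⟶ y} {k : w ⟶ z}
    (c : D.Companion f) (d : D.Companion g) (q : QCell D h k) (hl : q.left.1 = f)
    (hr : q.right.1 = g) : D.Cell c.pro d.pro :=
  c.ofMate d h k q.cell (by rw [q.left_cell, hr]) (by rw [q.right_cell, hl])

variable {x y w z : D.Obj} {f : x ⟶ w} {g : y ⟶ z} {h : x ⟶ y} {k : w ⟶ z}

@[simp] theorem left_ofQCell (c : D.Companion f) (d : D.Companion g) (q : QCell D h k)
    (hl : q.left.1 = f) (hr : q.right.1 = g) : D.left (c.ofQCell d q hl hr) = h :=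
  left_ofMate _ _ _ _ _ _ _

@[simp] theorem right_ofQCell (c : D.Companion f) (d : D.Companion g) (q : QCell D h k)
    (hl : q.left.1 = f) (hr : q.right.1 = g) : D.right (c.ofQCell d q hl hr) = k :=
  right_ofMate _ _ _ _ _ _ _

@[simp] theorem mate_ofQCell (c : D.Companion f) (d : D.Companion g) (q : QCell D h k)
    (hl : q.left.1 = f) (hr : q.right.1 = g) : c.mate d (c.ofQCell d q hl hr) = q.cell :=
  mate_ofMate _ _ _ _ _ _ _

/-- Both sides have the same mate, since `mate_comp` is the pasting formula of `QCell.hcomp`. It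
gives functoriality of the counit on cells. -/
theorem ofQCell_hcomp {y' z' : D.Obj} {h' : y ⟶ y'} {k' : z ⟶ z'} {l : y' ⟶ z'}
    (c : D.Companion f) (d : D.Companion g) (e : D.Companion l) (p : QCell D h k)
    (q : QCell D h' k') (hp : p.left.1 = f) (hp' : p.right.1 = g) (hq : q.left.1 = g)
    (hq' : q.right.1 = l) (H : p.right = q.left) :
    c.ofQCell e (p.hcomp q H) hp hq' = c.ofQCell d p hp hp' ≫ d.ofQCell e q hq hq' := by
  refine mate_inj c e (by simp) (by simp) ?_
  rw [mate_comp c d e, mate_ofQCell]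
  exact D.scomp_congr (by simp) (by simp) _ _

/-- Naturality of the unit comparison of the counit: the mates on both sides are the external
identity on `m`. -/
theorem unitCell_comp_comparison {a b : D.Obj} (m : a ⟶ b) {i : a ⟶ a} {j : b ⟶ b}
    (c : D.Companion i) (d : D.Companion j) (hi : 𝟙 a = i) (hj : 𝟙 b = j) (q : QCell D m m)
    (hl : q.left.1 = i) (hr : q.right.1 = j) (hq : q.cell = D.unitCell m) :
    D.unitCell m ≫ (Companion.id D b).comparison d hj =
      (Companion.id D a).comparison c hi ≫ c.ofQCell d q hl hr := by
  refine IsComparison.naturality (Companion.id D a) c (Companion.id D b) d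
    (isComparison_comparison _ _ _) (isComparison_comparison _ _ _) (D.unitCell m) _ ?_ ?_ ?_
  · rw [left_ofQCell]; exact D.left_unitCell m
  · rw [right_ofQCell]; exact D.right_unitCell m
  · rw [mate_ofQCell, hq]; exact mate_unitCell m

/-- Naturality of the composition comparison of the counit: `mate_hcomp` is the pasting formula of
`QCell.vcomp`. -/
theorem hcomp_comp_comparison {x₁ x₂ x₃ y₁ y₂ y₃ : D.Obj} {f₁ : x₁ ⟶ x₂} {f₂ : x₂ ⟶ x₃}
    {g₁ : y₁ ⟶ y₂} {g₂ : y₂ ⟶ y₃} {f₀ : x₁ ⟶ x₃} {g₀ : y₁ ⟶ y₃} (c₁ : D.Companion f₁)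
    (c₂ : D.Companion f₂) (d₁ : D.Companion g₁) (d₂ : D.Companion g₂) (c₀ : D.Companion f₀)
    (d₀ : D.Companion g₀) (hf : f₁ ≫ f₂ = f₀) (hg : g₁ ≫ g₂ = g₀) {h₁ : x₁ ⟶ y₁} {h₂ : x₂ ⟶ y₂}
    {h₃ : x₃ ⟶ y₃} (p : QCell D h₁ h₂) (q : QCell D h₂ h₃) (r : QCell D h₁ h₃)
    (hp : p.left.1 = f₁) (hp' : p.right.1 = g₁) (hq : q.left.1 = f₂) (hq' : q.right.1 = g₂)
    (hr : r.left.1 = f₀) (hr' : r.right.1 = g₀) (H : r.cell = (p.vcomp q).cell) :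
    D.hcomp (c₁.ofQCell d₁ p hp hp') (c₂.ofQCell d₂ q hq hq') (by simp) ≫
        (d₁.comp d₂).comparison d₀ hg =
      (c₁.comp c₂).comparison c₀ hf ≫ c₀.ofQCell d₀ r hr hr' := by
  refine IsComparison.naturality (c₁.comp c₂) c₀ (d₁.comp d₂) d₀
    (isComparison_comparison _ _ _) (isComparison_comparison _ _ _)
    (D.hcomp (c₁.ofQCell d₁ p hp hp') (c₂.ofQCell d₂ q hq hq') (by simp)) _ ?_ ?_ ?_
  · exact (D.left_hcomp _ _ _).trans ((left_ofQCell _ _ _ _ _).trans (left_ofQCell _ _ _ _ _).symm)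
  · exact (D.right_hcomp _ _ _).trans
      ((right_ofQCell _ _ _ _ _).trans (right_ofQCell _ _ _ _ _).symm)
  · rw [mate_ofQCell, H, mate_hcomp]
    subst hp hp' hq hq'
    exact D.scomp_congr (by simp) (by simp) _ _

theorem isComparison_ofQCell {f g : x ⟶ w} (c : D.Companion f) (d : D.Companion g)
    (q : QCell D (𝟙 x) (𝟙 w)) (hl : q.left.1 = f) (hr : q.right.1 = g)
    (H : q.cell = D.unitCell f) : c.IsComparison d (c.ofQCell d q hl hr) :=
  ⟨left_ofQCell _ _ _ _ _, right_ofQCell _ _ _ _ _, (mate_ofQCell _ _ _ _ _).trans H⟩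

end

end DblCat.Companion

/-! ### The counit. -/

namespace DblCat

open Companion

variable (D : DblCat.{u, v})

/-- The counit of the biadjunction, which sends each arrow having a companion to its chosen
companion. -/
def counitFunctor (χ : ∀ {x y : D.Obj} (f : x ⟶ y), D.HasCompanion f → D.Companion f) :
    DblFunctor ((Comp D).dbl.transpose (Comp D).strict) D :=
  let K {x y : D.Obj} (f : {f : x ⟶ y // D.HasCompanion f}) : D.Companion f.1 := χ f.1 f.2
  -- The associators and unitors of the transpose are cells `TCell.ofEq`, so the counit sends them
  -- to comparisons.
  have isComp {x y : D.Obj} {f g : {f : x ⟶ y // D.HasCompanion f}} (h : f = g) :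
      (K f).IsComparison (K g) ((K f).ofQCell (K g)
        (TCell.ofEq (D := D.compDbl) (a := x) (b := y) h).cell rfl (congrArg Subtype.val h)) :=
    isComparison_ofQCell _ _ _ _ _ rfl
  { obj := fun x => x
    map := fun f => f
    map_id := fun _ => rfl
    map_comp := fun _ _ => rfl
    mapPro := fun f => (K f).pro
    mapCell := fun {_ _ _ _ f g} α => (K f).ofQCell (K g) (TCell.cell α)
      (congrArg Subtype.val (TCell.left_cell α)) (congrArg Subtype.val (TCell.right_cell α))
    left_mapCell := fun _ => left_ofQCell _ _ _ _ _
    right_mapCell := fun _ => right_ofQCell _ _ _ _ _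
    mapCell_id := fun f => (isComp (Eq.refl f)).unique (IsComparison.id _)
    mapCell_comp := fun α β => ofQCell_hcomp _ _ _ (TCell.cell α) (TCell.cell β) _ _ _ _
      ((TCell.right_cell α).trans (TCell.left_cell β).symm)
    mapUnit := fun (a : D.Obj) =>
      (Companion.id D a).comparisonIso (K ⟨𝟙 a, HasCompanion.id a⟩) rfl
    left_mapUnit := fun _ => (isComparison_comparison _ _ rfl).left
    right_mapUnit := fun _ => (isComparison_comparison _ _ rfl).right
    mapUnit_naturality := fun {a b : D.Obj} (f : a ⟶ b) =>
      unitCell_comp_comparison (D := D) f _ _ rfl rfl _ _ _ rfl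
    mapComp := fun {a b c : D.Obj} (f : {f : a ⟶ b // D.HasCompanion f})
      (g : {f : b ⟶ c // D.HasCompanion f}) =>
      ((K f).comp (K g)).comparisonIso (K ⟨f.1 ≫ g.1, f.2.comp g.2⟩) rfl
    left_mapComp := fun _ _ => (isComparison_comparison _ _ rfl).left
    right_mapComp := fun _ _ => (isComparison_comparison _ _ rfl).right
    mapComp_naturality := by
      intro _ _ _ _ _ _ _ _ _ _ α β h
      obtain ⟨t, b, c, h1, h2⟩ := α
      obtain ⟨t', b', c', h1', h2'⟩ := β
      -- External composition in the transpose glues along this equality by an `eqToHom`;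
      -- substituting makes that cell an identity, which the last line removes.
      change b = t' at h
      subst h
      exact hcomp_comp_comparison _ _ _ _ _ _ rfl rfl c c' _ _ _ _ _ _ _
        (congrArg (fun q => QCell.cell (c ≫ q)) (Category.id_comp (X := ProArr.mk b) c'))
    -- In this law and the two unit laws both composites are comparisons between the same
    -- companions, hence equal.
    mapComp_assoc := fun {a b c d : D.Obj} (f : {f : a ⟶ b // D.HasCompanion f})
      (g : {f : b ⟶ c // D.HasCompanion f}) (h : {f : c ⟶ d // D.HasCompanion f}) =>
      IsComparison.unique (c := ((K f).comp (K g)).comp (K h))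
        (d := K ⟨f.1 ≫ g.1 ≫ h.1, f.2.comp (g.2.comp h.2)⟩)
        (((isComparison_comparison _ _ rfl).hcomp (IsComparison.id _) _).comp
          ((isComparison_comparison _ _ rfl).comp (isComp (Subtype.ext (Category.assoc f.1 g.1 h.1)))))
        ((IsComparison.assoc _ _ _).comp
        (((IsComparison.id _).hcomp (isComparison_comparison _ _ rfl) _).comp
          (isComparison_comparison _ _ rfl)))
    mapComp_lunit := fun {a b : D.Obj} (f : {f : a ⟶ b // D.HasCompanion f}) =>
      IsComparison.unique (c := (Companion.id D a).comp (K f)) (d := K f)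
        (((isComparison_comparison _ _ rfl).hcomp (IsComparison.id _) _).comp
          ((isComparison_comparison _ _ rfl).comp (isComp (Subtype.ext (Category.id_comp f.1)))))
        (IsComparison.lunit _)
    mapComp_runit := fun {a b : D.Obj} (f : {f : a ⟶ b // D.HasCompanion f}) =>
      IsComparison.unique (c := (K f).comp (Companion.id D b)) (d := K f)
        (((IsComparison.id _).hcomp (isComparison_comparison _ _ rfl) _).comp
          ((isComparison_comparison _ _ rfl).comp (isComp (Subtype.ext (Category.comp_id f.1)))))
        (IsComparison.runit _) }

end DblCat

namespace DblCat.Companion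

variable {D : DblCat.{u, v}}

theorem mate_id_id {a b : D.Obj} (σ : D.Cell (D.unit a) (D.unit b)) :
    (Companion.id D a).mate (Companion.id D b) σ = σ :=
  (Category.id_comp _).trans (Category.comp_id _)

end DblCat.Companion

namespace DblCat

open Companion

variable (D : DblCat.{u, v})

/-- `mapSpecial` conjugates by comparisons, which do not change mates, and the mate of the image of
a cell is by construction the special cell it carries. This makes the counit transparent on special
cells, as needed to extend identity families. -/
theorem counitFunctor_mapSpecial
    (χ : ∀ {x y : D.Obj} (f : x ⟶ y), D.HasCompanion f → D.Companion f) {a b : D.Obj}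
    (σ : ((Comp D).dbl.transpose (Comp D).strict).Cell
      (((Comp D).dbl.transpose (Comp D).strict).unit a)
      (((Comp D).dbl.transpose (Comp D).strict).unit b)) :
    (D.counitFunctor χ).mapSpecial σ = QCell.cell (TCell.cell σ) := by
  refine (mate_id_id (D := D) _).symm.trans ?_
  refine (IsComparison.mate_comp_left (D := D) (c := Companion.id D a)
    (d := χ (𝟙 a) (HasCompanion.id a)) (b := Companion.id D b)
    (isComparison_comparison _ _ rfl) _).trans ?_
  refine (IsComparison.mate_comp_right (D := D) (d := Companion.id D b)
    (c := χ (𝟙 b) (HasCompanion.id b)) (b := χ (𝟙 a) (HasCompanion.id a)) _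
    (isComparison_comparison _ _ rfl)).trans ?_
  exact mate_ofQCell _ _ (TCell.cell σ) (congrArg Subtype.val (TCell.left_cell σ))
    (congrArg Subtype.val (TCell.right_cell σ))

end DblCat

/-! ### Extending natural transformations from objects to companions. -/

/-- The part of a natural transformation between double functors given by arrows, natural with
respect to arrows and special cells. -/
structure SpecialTrans {D E : DblCat.{u, v}} (F G : DblFunctor D E) where
  app (a : D.Obj) : F.obj a ⟶ G.obj a
  naturality {a b : D.Obj} (f : a ⟶ b) : F.map f ≫ app b = app a ≫ G.map f
  special_naturality {a b : D.Obj} (σ : D.Cell (D.unit a) (D.unit b)) :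
    F.mapSpecial σ ≫ E.unitCell (app b) = E.unitCell (app a) ≫ G.mapSpecial σ

namespace SpecialTrans

open DblCat Companion

variable {D E : DblCat.{u, v}} {F G : DblFunctor D E} (τ : SpecialTrans F G)

/-- The component at a companion. -/
def appCompanion {x y : D.Obj} {f : x ⟶ y} (c : D.Companion f) :
    E.Cell (F.mapPro c.pro) (G.mapPro c.pro) :=
  (c.map F).ofMate (c.map G) (τ.app x) (τ.app y) (E.unitCell (τ.app x ≫ G.map f)) (by simp)
    (by rw [E.right_unitCell, τ.naturality])

section

variable {x y : D.Obj} {f : x ⟶ y} (c : D.Companion f)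

@[simp] theorem left_appCompanion : E.left (τ.appCompanion c) = τ.app x :=
  left_ofMate _ _ _ _ _ _ _

@[simp] theorem right_appCompanion : E.right (τ.appCompanion c) = τ.app y :=
  right_ofMate _ _ _ _ _ _ _

theorem mate_appCompanion :
    (c.map F).mate (c.map G) (τ.appCompanion c) = E.unitCell (τ.app x ≫ G.map f) :=
  mate_ofMate _ _ _ _ _ _ _

end

/-- On mates this becomes naturality of `τ` with respect to the single special cell `c.mate d α`. -/
theorem appCompanion_naturality {x y w z : D.Obj} {f : x ⟶ y} {g : w ⟶ z} (c : D.Companion f)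
    (d : D.Companion g) (α : D.Cell c.pro d.pro) :
    F.mapCell α ≫ τ.appCompanion d = τ.appCompanion c ≫ G.mapCell α := by
  have hl : E.left (F.mapCell α ≫ τ.appCompanion d) = E.left (τ.appCompanion c ≫ G.mapCell α) := by
    simp [τ.naturality]
  have hr : E.right (F.mapCell α ≫ τ.appCompanion d) =
      E.right (τ.appCompanion c ≫ G.mapCell α) := by
    simp [τ.naturality]
  refine mate_inj (c.map F) (d.map G) hl hr ((mate_comp (c.map F) (d.map F) (d.map G)
    (F.mapCell α) (τ.appCompanion d)).trans (Eq.trans ?_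
      (mate_comp (c.map F) (c.map G) (d.map G) (τ.appCompanion c) (G.mapCell α)).symm))
  -- In each of the two pastings given by `mate_comp`, the factor contributed by `τ` is an external
  -- identity; removing both leaves `special_naturality`.
  refine (E.scomp_congr (σ' := E.unitCell (F.map (D.left α) ≫ τ.app w ≫ G.map g))
      (τ' := F.mapSpecial (c.mate d α) ≫ E.unitCell (τ.app z)) ?_ ?_ _ ?_).trans
      (((E.unit_scomp _ _ _).trans ((τ.special_naturality _).trans (E.scomp_unit
        (τ.app x ≫ G.map f ≫ G.map (D.right α)) _ ?_).symm)).trans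
          (E.scomp_congr ?_ ?_ _ _))
  · rw [mate_appCompanion]
    exact (congrArg (E.unitCell · ≫ _) (F.left_mapCell α)).trans (E.unitCell_comp _ _).symm
  · rw [map_mate]
    exact congrArg (_ ≫ E.unitCell ·) (τ.right_appCompanion d)
  · rw [E.right_unitCell, E.left_comp, F.left_mapSpecial, left_mate, E.left_unitCell,
      ← τ.naturality, F.map_comp, Category.assoc]
  · rw [E.left_unitCell, E.right_comp, G.right_mapSpecial, right_mate, E.right_unitCell,
      G.map_comp]
  · rw [map_mate]
    exact congrArg (E.unitCell · ≫ _) (τ.left_appCompanion c).symm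
  · rw [mate_appCompanion, ← Category.assoc]
    exact (E.unitCell_comp _ _).trans (congrArg (_ ≫ E.unitCell ·) (G.right_mapCell α).symm)

/-- The cells `mapUnit` are comparisons and leave mates unchanged; what remains on both sides is the
external identity on `τ.app a`. -/
theorem appCompanion_id (a : D.Obj) :
    (F.mapUnit a).hom ≫ τ.appCompanion (Companion.id D a) =
      E.unitCell (τ.app a) ≫ (G.mapUnit a).hom := by
  have hl := (E.left_comp (F.mapUnit a).hom (τ.appCompanion (Companion.id D a))).trans
    (congrArg₂ (· ≫ ·) (F.left_mapUnit a) (τ.left_appCompanion (Companion.id D a)))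
  have hr := (E.right_comp (F.mapUnit a).hom (τ.appCompanion (Companion.id D a))).trans
    (congrArg₂ (· ≫ ·) (F.right_mapUnit a) (τ.right_appCompanion (Companion.id D a)))
  have hl' : 𝟙 _ ≫ τ.app a = E.left (E.unitCell (τ.app a) ≫ (G.mapUnit a).hom) := by simp
  have hr' : 𝟙 _ ≫ τ.app a = E.right (E.unitCell (τ.app a) ≫ (G.mapUnit a).hom) := by simp
  refine mate_inj (Companion.id E (F.obj a)) ((Companion.id D a).map G) (hl.trans hl')
    (hr.trans hr') ?_
  refine (IsComparison.mate_comp_left (c := Companion.id E (F.obj a))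
    (d := (Companion.id D a).map F) (b := (Companion.id D a).map G)
    (by simpa using IsComparison.mapUnit F a) _).trans ((τ.mate_appCompanion _).trans ?_)
  refine Eq.trans ?_ (IsComparison.mate_comp_right (c := Companion.id E (G.obj a))
    (d := (Companion.id D a).map G) (b := Companion.id E (F.obj a))
    (E.unitCell (τ.app a)) (IsComparison.mapUnit G a)).symm
  rw [G.map_id, Category.comp_id]
  exact (mate_unitCell (D := E) (τ.app a)).symm

/-- The cells `mapComp` are comparisons, and by `mate_hcomp` the mate of the external composite
pastes two external identities on the two naturality squares, whose boundaries fit together. -/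
theorem appCompanion_comp {x y z : D.Obj} {f : x ⟶ y} {g : y ⟶ z} (c : D.Companion f)
    (d : D.Companion g) :
    (F.mapComp c.pro d.pro).hom ≫ τ.appCompanion (c.comp d) =
      E.hcomp (τ.appCompanion c) (τ.appCompanion d)
        ((τ.right_appCompanion c).trans (τ.left_appCompanion d).symm) ≫
      (G.mapComp c.pro d.pro).hom := by
  have h : E.right (τ.appCompanion c) = E.left (τ.appCompanion d) := by simp
  have hl := (E.left_comp (F.mapComp c.pro d.pro).hom (τ.appCompanion (c.comp d))).trans
    (congrArg₂ (· ≫ ·) (F.left_mapComp _ _) (τ.left_appCompanion (c.comp d)))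
  have hr := (E.right_comp (F.mapComp c.pro d.pro).hom (τ.appCompanion (c.comp d))).trans
    (congrArg₂ (· ≫ ·) (F.right_mapComp _ _) (τ.right_appCompanion (c.comp d)))
  have hl' : 𝟙 _ ≫ τ.app x = E.left (E.hcomp (τ.appCompanion c) (τ.appCompanion d) h ≫
    (G.mapComp c.pro d.pro).hom) := by simp
  have hr' : 𝟙 _ ≫ τ.app z = E.right (E.hcomp (τ.appCompanion c) (τ.appCompanion d) h ≫
    (G.mapComp c.pro d.pro).hom) := by simp
  refine mate_inj ((c.map F).comp (d.map F)) ((c.comp d).map G) (hl.trans hl')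
    (hr.trans hr') ?_
  refine (IsComparison.mate_comp_left (c := (c.map F).comp (d.map F))
    (d := (c.comp d).map F) (b := (c.comp d).map G)
    (by simpa using IsComparison.mapComp F c d) _).trans ((τ.mate_appCompanion _).trans ?_)
  refine Eq.trans ?_ (IsComparison.mate_comp_right (c := (c.map G).comp (d.map G))
    (d := (c.comp d).map G) (b := (c.map F).comp (d.map F))
    (E.hcomp (τ.appCompanion c) (τ.appCompanion d) h)
    (by simpa using IsComparison.mapComp G c d)).symm
  have e : τ.app x ≫ G.map (f ≫ g) = (τ.app x ≫ G.map f) ≫ G.map g := by simp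
  have e' : (τ.app x ≫ G.map f) ≫ G.map g = F.map f ≫ τ.app y ≫ G.map g := by
    rw [← τ.naturality, Category.assoc]
  refine Eq.trans ?_ (mate_hcomp (c.map F) (d.map F) (c.map G) (d.map G) (τ.appCompanion c)
    (τ.appCompanion d) h).symm
  refine (congrArg E.unitCell (e.trans e')).trans ((E.unit_scomp
    (F.map f ≫ τ.app y ≫ G.map g) _ (by rw [E.right_unitCell, E.left_unitCell])).symm.trans
      (E.scomp_congr ?_ ?_ _ _))
  · rw [mate_appCompanion, ← E.unitCell_comp, e']
  · rw [mate_appCompanion, ← E.unitCell_comp]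

/-- Naturality at the cast between the proarrows shows that the component depends on the proarrow
only, not on the binding cells or even the arrow. -/
theorem appCompanion_heq {x y : D.Obj} {f g : x ⟶ y} (c : D.Companion f) (d : D.Companion g)
    (h : c.pro = d.pro) : HEq (τ.appCompanion c) (τ.appCompanion d) := by
  have H := τ.appCompanion_naturality c d (eqToHom (congrArg ProArr.mk h))
  rw [F.mapCell_eqToHom h, G.mapCell_eqToHom h] at H
  exact E.heq_of_comm (congrArg ProArr.mk (congrArg F.mapPro h))
    (congrArg ProArr.mk (congrArg G.mapPro h)) H.symm

end SpecialTrans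

namespace CompDblCat

open DblCat Companion

variable (C : CompDblCat.{u, v}) {E : DblCat.{u, v}}

/-- The transpose of a strict double category with a functorial choice of companions. -/
abbrev tr : DblCat.{u, v} := C.dbl.transpose C.strict

/-- Each proarrow of the transpose is a companion. -/
def trCompanion {x y : C.dbl.Obj} (f : x ⟶ y) :
    C.tr.Companion (x := x) (y := y) (C.companion f).pro :=
  (C.companion f).transpose C.strict

variable {C} {F G : DblFunctor C.tr E}

/-- Natural transformations between double functors out of a transpose are determined by their
components at objects. -/
theorem trans_ext {σ τ : F ⟶ G} (h : ∀ a, DblNatTrans.app σ a = DblNatTrans.app τ a) : σ = τ := by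
  refine DblNatTrans.hext h (fun {a b : C.dbl.Obj} (f : a ⟶ b) => ?_)
  -- The proarrow `f` of the transpose is itself a companion, so `mate_appPro` fixes its component.
  refine mate_inj ((C.trCompanion f).map F) ((C.trCompanion f).map G) ?_ ?_ ?_
  · exact (DblNatTrans.left_appPro σ _).trans ((h a).trans (DblNatTrans.left_appPro τ _).symm)
  · exact (DblNatTrans.right_appPro σ _).trans ((h b).trans (DblNatTrans.right_appPro τ _).symm)
  · refine (mate_appPro σ (C.trCompanion f)).trans
      (Eq.trans ?_ (mate_appPro τ (C.trCompanion f)).symm)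
    exact congrArg (fun k => E.unitCell (k ≫ G.map (C.companion f).pro)) (h a)

/-- The natural transformation determined by its components at objects. -/
def extend (τ : SpecialTrans F G) : F ⟶ G where
  app := τ.app
  naturality := τ.naturality
  appPro {a b : C.dbl.Obj} (f : a ⟶ b) := τ.appCompanion (C.trCompanion f)
  left_appPro _ := τ.left_appCompanion _
  right_appPro _ := τ.right_appCompanion _
  cell_naturality α := τ.appCompanion_naturality (C.trCompanion _) (C.trCompanion _) α
  -- The companion structure chosen on the external identity and `Companion.id` share their
  -- proarrow, which is all the component depends on.
  appPro_unit a := (congrArg ((F.mapUnit a).hom ≫ ·) (eq_of_heq (τ.appCompanion_heq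
    (C.trCompanion _) (Companion.id C.tr a) rfl))).trans (τ.appCompanion_id a)
  appPro_comp {a b c : C.dbl.Obj} (f : a ⟶ b) (g : b ⟶ c) :=
    (congrArg ((F.mapComp _ _).hom ≫ ·) (eq_of_heq (τ.appCompanion_heq
      (C.trCompanion _) ((C.trCompanion f).comp (C.trCompanion g)) rfl))).trans
      (τ.appCompanion_comp (C.trCompanion f) (C.trCompanion g))

/-- The natural isomorphism determined by its components at objects. -/
def extendIso (e : ∀ a, F.obj a ≅ G.obj a)
    (naturality : ∀ {a b : C.tr.Obj} (f : a ⟶ b), F.map f ≫ (e b).hom = (e a).hom ≫ G.map f)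
    (special_naturality : ∀ {a b : C.tr.Obj} (σ : C.tr.Cell (C.tr.unit a) (C.tr.unit b)),
      F.mapSpecial σ ≫ E.unitCell (e b).hom = E.unitCell (e a).hom ≫ G.mapSpecial σ) :
    F ≅ G where
  hom := extend ⟨fun a => (e a).hom, naturality, special_naturality⟩
  inv := extend ⟨fun a => (e a).inv, fun {a b} f => by
    rw [Iso.comp_inv_eq, Category.assoc, naturality, Iso.inv_hom_id_assoc],
    fun {a b} σ => by
      have h : ∀ a, E.unitCell (e a).inv ≫ E.unitCell (e a).hom = 𝟙 _ := fun a => by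
        rw [← E.unitCell_comp, Iso.inv_hom_id, E.unitCell_id]
      have h' : ∀ a, E.unitCell (e a).hom ≫ E.unitCell (e a).inv = 𝟙 _ := fun a => by
        rw [← E.unitCell_comp, Iso.hom_inv_id, E.unitCell_id]
      -- The inverse family is natural on special cells by conjugating with the invertible cells
      -- `unitCell (e a).hom`.
      calc G.mapSpecial σ ≫ E.unitCell (e b).inv
          = (E.unitCell (e a).inv ≫ E.unitCell (e a).hom) ≫ G.mapSpecial σ ≫
              E.unitCell (e b).inv := by rw [h, Category.id_comp]
        _ = E.unitCell (e a).inv ≫ (E.unitCell (e a).hom ≫ G.mapSpecial σ) ≫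
              E.unitCell (e b).inv := by simp only [Category.assoc]
        _ = _ := by
          rw [← special_naturality, Category.assoc, h', Category.comp_id]⟩
  hom_inv_id := trans_ext fun a => (e a).hom_inv_id
  inv_hom_id := trans_ext fun a => (e a).inv_hom_id

end CompDblCat

/-! ### Naturality constraints of unit and counit, and the triangle identities. -/

theorem DblFunctor.comp_mapSpecial {D E K : DblCat.{u, v}} (F : DblFunctor D E)
    (G : DblFunctor E K) {a b : D.Obj} (σ : D.Cell (D.unit a) (D.unit b)) :
    (F.comp G).mapSpecial σ = G.mapSpecial (F.mapSpecial σ) := by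
  change (G.mapUnit _ ≪≫ G.mapCellIso (F.mapUnit _)).hom ≫ G.mapCell (F.mapCell σ) ≫
    (G.mapUnit _ ≪≫ G.mapCellIso (F.mapUnit _)).inv =
    (G.mapUnit _).hom ≫ G.mapCell ((F.mapUnit _).hom ≫ F.mapCell σ ≫ (F.mapUnit _).inv) ≫
    (G.mapUnit _).inv
  simp

theorem DblFunctor.id_mapSpecial {D : DblCat.{u, v}} {a b : D.Obj}
    (σ : D.Cell (D.unit a) (D.unit b)) : (DblFunctor.id D).mapSpecial σ = σ :=
  (Category.id_comp _).trans (Category.comp_id _)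

/-- The comparison cells of the transpose are external identities of `E`, and pasting with them
changes nothing up to casts. -/
theorem DblFunctor.cell_transpose_mapSpecial {D E : DblCat.{u, v}} {F : DblFunctor D E}
    (hF : F.IsStrict) (hD : D.IsStrict) (hE : E.IsStrict) {a b : D.Obj}
    (σ : TCell D (𝟙 a) (𝟙 b)) :
    HEq (TCell.cell ((F.transpose hF hD hE).mapSpecial (a := a) (b := b) σ))
      (F.mapCell σ.cell) :=
  (hE.heq_unit_unit _ _ _ _ _).symm

theorem QCell.cell_heq {D : DblCat.{u, v}} {x y w z : D.Obj} {h h' : x ⟶ y} {k k' : w ⟶ z}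
    {α : QCell D h k} {α' : QCell D h' k'} (hh : h = h') (hk : k = k') (e : HEq α α') :
    α.cell = α'.cell := by
  subst hh hk; cases e; rfl

namespace CompDblCat

open DblCat Companion

/-- The pseudonaturality constraint of the counit. -/
def counitNatIso (χ : ∀ (D : DblCat.{u, v}) {x y : D.Obj} (f : x ⟶ y), D.HasCompanion f →
    D.Companion f) {D E : DblCat.{u, v}} (g : DblFunctor D E) :
    (g.compDbl.transpose g.compDbl_isStrict (Comp D).strict (Comp E).strict).comp
      (E.counitFunctor (χ E)) ≅ (D.counitFunctor (χ D)).comp g :=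
  extendIso (C := Comp D) (fun a => Iso.refl (g.obj a))
    (fun _ => (Category.comp_id _).trans (Category.id_comp _).symm) (fun {a b} σ => by
      -- With identity components, naturality on special cells says that both composites act equally
      -- on them.
      refine (congrArg (_ ≫ ·) (E.unitCell_id _)).trans ((Category.comp_id _).trans
        (Eq.trans ?_ ((congrArg (· ≫ _) (E.unitCell_id _)).trans (Category.id_comp _)).symm))
      refine (DblFunctor.comp_mapSpecial _ _ σ).trans
        (Eq.trans ?_ (DblFunctor.comp_mapSpecial (D.counitFunctor (χ D)) g σ).symm)
      -- Along either path the special cell of `D` carried by `σ` is sent to its image under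
      -- `g.mapSpecial`.
      refine (counitFunctor_mapSpecial E _ _).trans
        (Eq.trans ?_ (congrArg _ (counitFunctor_mapSpecial D _ _)).symm)
      refine QCell.cell_heq ?_ ?_ (DblFunctor.cell_transpose_mapSpecial g.compDbl_isStrict
        (Comp D).strict (Comp E).strict σ)
      · exact (E.compDbl_isStrict.eq_unit_unit _).symm
      · exact (E.compDbl_isStrict.eq_unit_unit _).symm)

variable (C : CompDblCat.{u, v})


/-- The first triangulator. -/
def leftTriangulator (χ : ∀ {x y : C.tr.Obj} (f : x ⟶ y), C.tr.HasCompanion f →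
    C.tr.Companion f) :
    (C.unitFunctor.transpose C.unitFunctor_isStrict C.strict (Comp C.tr).strict).comp
      (C.tr.counitFunctor χ) ≅ DblFunctor.id C.tr :=
  extendIso (fun a => Iso.refl a)
    (fun _ => (Category.comp_id _).trans (Category.id_comp _).symm) (fun {a b} σ => by
      refine (congrArg (_ ≫ ·) (C.tr.unitCell_id _)).trans ((Category.comp_id _).trans
        (Eq.trans ?_ ((congrArg (· ≫ _) (C.tr.unitCell_id _)).trans (Category.id_comp _)).symm))
      refine (DblFunctor.comp_mapSpecial _ _ σ).trans
        (Eq.trans ?_ (DblFunctor.id_mapSpecial σ).symm)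
      refine (counitFunctor_mapSpecial C.tr _ _).trans ?_
      refine (QCell.cell_heq ?_ ?_ (DblFunctor.cell_transpose_mapSpecial C.unitFunctor_isStrict
        C.strict (Comp C.tr).strict σ)).trans ?_
      · exact ((compDbl_isStrict C.tr).eq_unit_unit _).symm
      · exact ((compDbl_isStrict C.tr).eq_unit_unit _).symm
      -- The sides of `σ` are identities, so their chosen companions are identity companions, and
      -- taking mates along these does nothing.
      · have hl := TCell.left_cell σ
        have hr := TCell.right_cell σ
        refine (tmate_congr C.strict hl hr (C.companion_heq_id hl) (C.companion_heq_id hr)).trans ?_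
        refine (mate_heq (transpose_id C.strict a) (transpose_id C.strict b) HEq.rfl).trans ?_
        exact mate_id_id _)

/-- The unit is built from chosen companions and mates. Morphisms preserve the former with their
binding cells, and `map_mate` gives compatibility with the latter, so no isomorphism is needed. -/
theorem unitMap_naturality {C D : CompDblCat.{u, v}} (F : CompDblFunctor C D) :
    F.comp D.unitMap = C.unitMap.comp
      (F.functor.transpose F.strict C.strict D.strict).compMap := by
  refine CompDblFunctor.ext (DblFunctor.IsStrict.ext_of_rfl
    (F.strict.comp D.unitFunctor_isStrict) (C.unitFunctor_isStrict.comp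
      (DblFunctor.compDbl_isStrict _)) rfl ?_ (fun _ => HEq.rfl) ?_)
  · intro a b f
    exact heq_of_eq (Subtype.ext (congrArg Companion.pro (F.map_companion f).symm))
  · intro a b c d m n α
    -- Preservation of companions along a propositional equality, since the side of
    -- `F.functor.mapCell α` is not definitionally `F.functor.map` of the side of `α`.
    have H : ∀ {x y : C.dbl.Obj} {f : x ⟶ y} {g : F.functor.obj x ⟶ F.functor.obj y},
        g = F.functor.map f → HEq (D.companion g) ((C.companion f).map F.functor) := by
      intro x y f g h
      subst h
      exact heq_of_eq (F.map_companion f).symm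
    have hl := F.functor.left_mapCell α
    have hr := F.functor.right_mapCell α
    refine heq_of_eq (QCell.ext (Subtype.ext (pro_eq hl (H hl))) (Subtype.ext (pro_eq hr (H hr))) ?_)
    refine (tmate_congr D.strict hl hr (H hl) (H hr)).trans ?_
    refine (mate_heq (transpose_map F.strict C.strict D.strict _)
      (transpose_map F.strict C.strict D.strict _) HEq.rfl).trans ?_
    exact map_mate (F.functor.transpose F.strict C.strict D.strict)
      (C.trCompanion (C.dbl.left α)) (C.trCompanion (C.dbl.right α))
      (⟨m, n, α, rfl, rfl⟩ : TCell C.dbl (C.dbl.left α) (C.dbl.right α))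

/-- On an arrow, the left side is the mate in the transpose of the component of `τ`. By
`mate_appPro` this mate is the external identity on the naturality square, which is how `compTrans`
acts. -/
theorem unitMap_whisker {C D : CompDblCat.{u, v}} {F G : CompDblFunctor C D} (τ : F ⟶ G) :
    ProTrans.whiskerRight τ D.unitFunctor D.unitFunctor_isStrict =
      eqToHom (X := F.comp D.unitMap) (unitMap_naturality F) ≫
        ProTrans.whiskerLeft C.unitFunctor
          (ProTrans.transpose τ F.strict G.strict C.strict D.strict).compTrans ≫
        eqToHom (Y := G.comp D.unitMap) (unitMap_naturality G).symm := by
  refine ProTrans.conj_ext (F := F.comp D.unitMap) (G := G.comp D.unitMap)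
    (unitMap_naturality F) (unitMap_naturality G).symm _ _ (fun _ => HEq.rfl) ?_
  intro a b f
  have hl := ProTrans.left_appArr τ f
  have hr := ProTrans.right_appArr τ f
  have H : ∀ (K : CompDblFunctor C D) {g : K.functor.obj a ⟶ K.functor.obj b},
      g = K.functor.map f → HEq (D.companion g) ((C.companion f).map K.functor) := by
    intro K g h
    subst h
    exact heq_of_eq (K.map_companion f).symm
  refine heq_of_eq (QCell.ext (Subtype.ext (pro_eq hl (H F hl))) (Subtype.ext (pro_eq hr (H G hr))) ?_)
  refine (tmate_congr D.strict hl hr (H F hl) (H G hr)).trans ?_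
  refine (mate_heq (transpose_map F.strict C.strict D.strict _)
    (transpose_map G.strict C.strict D.strict _) HEq.rfl).trans ?_
  exact mate_appPro (ProTrans.transpose τ F.strict G.strict C.strict D.strict) (C.trCompanion f)

/-- The second triangle identity holds strictly. -/
theorem unitMap_comp_counit (D : DblCat.{u, v})
    (χ : ∀ {x y : D.Obj} (f : x ⟶ y), D.HasCompanion f → D.Companion f) :
    (Comp D).unitMap.comp (D.counitFunctor χ).compMap = CompDblFunctor.id (Comp D) := by
  refine CompDblFunctor.ext (DblFunctor.IsStrict.ext_of_rfl
    ((Comp D).unitFunctor_isStrict.comp (DblFunctor.compDbl_isStrict _))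
    (DblFunctor.IsStrict.id _) rfl (fun _ => HEq.rfl) (fun _ => HEq.rfl) ?_)
  intro (a : D.Obj) (b : D.Obj) (c : D.Obj) (d : D.Obj) (m : a ⟶ b) (n : c ⟶ d) (α : QCell D m n)
  refine heq_of_eq (QCell.ext rfl rfl ?_)
  refine (counitFunctor_mapSpecial D χ _).trans ?_
  -- The mate of `α` pastes it with binding cells of `Comp D`, which are external identities, so the
  -- whole pasting collapses to `α.cell`.
  change D.scomp (D.unitCell (𝟙 a) ≫ D.scomp (D.unitCell m ≫ D.unitCell α.right.1)
    (α.cell ≫ D.unitCell (𝟙 d)) _) (D.unitCell α.left.1 ≫ D.unitCell (n ≫ 𝟙 d)) _ = α.cell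
  simp only [D.unitCell_id, Category.id_comp, Category.comp_id, ← D.unitCell_comp, D.unit_scomp,
    D.scomp_unit]

end CompDblCat

/-! ### Two-cells that are identities up to equality. -/

/-- A morphism is an identity, up to equality of its source and target. -/
def IsEqToHom {C : Type*} [Category C] {X Y : C} (f : X ⟶ Y) : Prop :=
  ∃ h : X = Y, f = eqToHom h

namespace IsEqToHom

section

variable {C : Type*} [Category C] {X Y Z : C}

/-- By proof irrelevance there is at most one `eqToHom` between two objects. Coherence between
strict constraints thus needs only closure of the class under the bicategory operations. -/
theorem eq {f g : X ⟶ Y} (hf : IsEqToHom f) (hg : IsEqToHom g) : f = g := by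
  obtain ⟨h, rfl⟩ := hf
  obtain ⟨_, rfl⟩ := hg
  rfl

theorem eqToIso_hom (h : X = Y) : IsEqToHom (eqToIso h).hom := ⟨h, rfl⟩

theorem id (X : C) : IsEqToHom (𝟙 X) := ⟨rfl, rfl⟩

theorem comp {f : X ⟶ Y} {g : Y ⟶ Z} (hf : IsEqToHom f) (hg : IsEqToHom g) :
    IsEqToHom (f ≫ g) := by
  obtain ⟨h, rfl⟩ := hf
  obtain ⟨h', rfl⟩ := hg
  exact ⟨h.trans h', eqToHom_trans h h'⟩

theorem inv {e : X ≅ Y} (he : IsEqToHom e.hom) : IsEqToHom e.inv := by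
  obtain ⟨h, h'⟩ := he
  subst h
  exact ⟨rfl, (Iso.inv_eq_inv e (Iso.refl X)).2 h'⟩

/-- Turns a conjugation formula such as `unitMap_whisker` into a naturality square. -/
theorem conj_comp {X' Y' : C} (h : X = X') (h' : Y = Y') (f : X' ⟶ Y') :
    (eqToHom h ≫ f ≫ eqToHom h'.symm) ≫ (eqToIso h').hom = (eqToIso h).hom ≫ f := by
  subst h h'; simp

end

section

open Bicategory

variable {B : Type*} [Bicategory B] {a b c d : B}

theorem whiskerLeft (f : a ⟶ b) {g h : b ⟶ c} {η : g ⟶ h} (hη : IsEqToHom η) :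
    IsEqToHom (f ◁ η) := by
  obtain ⟨e, rfl⟩ := hη
  subst e
  exact ⟨rfl, Bicategory.whiskerLeft_id f g⟩

theorem whiskerRight {f g : a ⟶ b} {η : f ⟶ g} (hη : IsEqToHom η) (h : b ⟶ c) :
    IsEqToHom (η ▷ h) := by
  obtain ⟨e, rfl⟩ := hη
  subst e
  exact ⟨rfl, Bicategory.id_whiskerRight f h⟩

section

variable [Bicategory.Strict B]

theorem associator (f : a ⟶ b) (g : b ⟶ c) (h : c ⟶ d) : IsEqToHom (α_ f g h).hom :=
  ⟨Bicategory.Strict.assoc f g h, by rw [Bicategory.Strict.associator_eqToIso]; rfl⟩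

theorem leftUnitor (f : a ⟶ b) : IsEqToHom (λ_ f).hom :=
  ⟨Bicategory.Strict.id_comp f, by rw [Bicategory.Strict.leftUnitor_eqToIso]; rfl⟩

theorem rightUnitor (f : a ⟶ b) : IsEqToHom (ρ_ f).hom :=
  ⟨Bicategory.Strict.comp_id f, by rw [Bicategory.Strict.rightUnitor_eqToIso]; rfl⟩

end

variable {C : Type*} [Bicategory C]

theorem map₂ (F : Pseudofunctor B C) {f g : a ⟶ b} {η : f ⟶ g} (hη : IsEqToHom η) :
    IsEqToHom (F.map₂ η) := by
  obtain ⟨e, rfl⟩ := hη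
  subst e
  exact ⟨rfl, F.map₂_id f⟩

theorem mapComp (F : StrictPseudofunctor B C) (f : a ⟶ b) (g : b ⟶ c) :
    IsEqToHom (F.mapComp f g).hom :=
  ⟨F.map_comp f g, by rw [F.mapComp_eq_eqToIso]; rfl⟩

theorem mapId (F : StrictPseudofunctor B C) (a : B) : IsEqToHom (F.mapId a).hom :=
  ⟨F.map_id a, by rw [F.mapId_eq_eqToIso]; rfl⟩

variable {A : Type*} [Bicategory A]

theorem comp_mapComp (F : StrictPseudofunctor B C) (G : StrictPseudofunctor C A) (f : a ⟶ b)
    (g : b ⟶ c) : IsEqToHom ((F.toPseudofunctor.comp G.toPseudofunctor).mapComp f g).hom :=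
  ((mapComp F f g).map₂ G.toPseudofunctor).comp (mapComp G (F.map f) (F.map g))

theorem comp_mapId (F : StrictPseudofunctor B C) (G : StrictPseudofunctor C A) (a : B) :
    IsEqToHom ((F.toPseudofunctor.comp G.toPseudofunctor).mapId a).hom :=
  ((mapId F a).map₂ G.toPseudofunctor).comp (mapId G (F.obj a))

end

end IsEqToHom

/-! ### Natural transformations with identity components at objects. -/

/-- A natural transformation whose components at objects are identities, up to equality of their
source and target. -/
def HasIdApp {D E : DblCat.{u, v}} {F G : DblFunctor D E} (τ : DblNatTrans F G) : Prop :=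
  ∃ h : ∀ a, F.obj a = G.obj a, ∀ a, τ.app a = eqToHom (h a)

theorem IsEqToHom.hasIdApp {D E : DblCat.{u, v}} {F G : D ⟶ E} {τ : F ⟶ G} (h : IsEqToHom τ) :
    HasIdApp τ := by
  obtain ⟨h, rfl⟩ := h
  exact ⟨fun a => congrArg (fun F => DblFunctor.obj F a) h, DblNatTrans.eqToHom_app h⟩

namespace HasIdApp

open Bicategory

variable {D E K : DblCat.{u, v}}

theorem comp {F G H : D ⟶ E} {σ : F ⟶ G} {τ : G ⟶ H} (hσ : HasIdApp σ) (hτ : HasIdApp τ) :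
    HasIdApp (F := F) (G := H) (σ ≫ τ) := by
  obtain ⟨h, e⟩ := hσ
  obtain ⟨h', e'⟩ := hτ
  exact ⟨fun a => (h a).trans (h' a), fun a =>
    (congrArg₂ (· ≫ ·) (e a) (e' a)).trans (eqToHom_trans _ _)⟩

theorem whiskerLeft (F : D ⟶ E) {G H : E ⟶ K} {τ : G ⟶ H} (hτ : HasIdApp τ) :
    HasIdApp (F := F ≫ G) (G := F ≫ H) (F ◁ τ) := by
  obtain ⟨h, h'⟩ := hτ
  exact ⟨fun a => h (DblFunctor.obj F a), fun a => h' (DblFunctor.obj F a)⟩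

theorem whiskerRight {F G : D ⟶ E} {τ : F ⟶ G} (hτ : HasIdApp τ) (H : E ⟶ K) :
    HasIdApp (F := F ≫ H) (G := G ≫ H) (τ ▷ H) := by
  obtain ⟨h, h'⟩ := hτ
  have map_eqToHom : ∀ {x y : E.Obj} (e : x = y), DblFunctor.map H (eqToHom e) =
      eqToHom (congrArg (DblFunctor.obj H) e) := by
    intro x y e; subst e; exact DblFunctor.map_id H _
  exact ⟨fun a => congrArg (DblFunctor.obj H) (h a), fun a =>
    (congrArg (DblFunctor.map H) (h' a)).trans (map_eqToHom (h a))⟩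

/-- `HasIdApp` does not constrain the components at proarrows; the domain must be a transpose so
that `trans_ext` recovers them. -/
theorem eq {C : CompDblCat.{u, v}} {F G : DblFunctor C.tr E} {σ τ : F ⟶ G} (hσ : HasIdApp σ)
    (hτ : HasIdApp τ) : σ = τ := by
  obtain ⟨h, e⟩ := hσ
  obtain ⟨h', e'⟩ := hτ
  exact CompDblCat.trans_ext fun a => (e a).trans (e' a).symm

/-- `Comp` sees double functors only through arrows and special cells, and transformations only
through components at objects. If these components are identities, naturality makes `F` and `G`
agree on arrows and special cells, so the image of `τ` is an identity even when `F` and `G` differ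
on proarrows. -/
theorem compTrans {F G : DblFunctor D E} {τ : DblNatTrans F G} (hτ : HasIdApp τ) :
    IsEqToHom (X := F.compMap) (Y := G.compMap) τ.compTrans := by
  obtain ⟨h, e⟩ := hτ
  have hobj : F.obj = G.obj := funext h
  have hmap : ∀ {a b : D.Obj} (f : a ⟶ b), HEq (F.map f) (G.map f) := by
    intro a b f
    have H := τ.naturality f
    rw [e, e] at H
    exact (comp_eqToHom_heq _ (h b)).symm.trans
      ((heq_of_eq H).trans (eqToHom_comp_heq _ (h a)))
  -- In the naturality square on special cells, the external identities on the components are casts.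
  have hspecial : ∀ {a b : D.Obj} (σ : D.Cell (D.unit a) (D.unit b)),
      HEq (F.mapSpecial σ) (G.mapSpecial σ) := by
    intro a b σ
    have H := DblFunctor.mapSpecial_appUnit τ σ
    have unitCell_eqToHom : ∀ {x y : E.Obj} (e : x = y), E.unitCell (eqToHom e) =
        eqToHom (congrArg (fun x => ProArr.mk (E.unit x)) e) := by
      intro x y e; subst e; exact E.unitCell_id _
    rw [e, e, unitCell_eqToHom, unitCell_eqToHom] at H
    exact (comp_eqToHom_heq _ _).symm.trans ((heq_of_eq H).trans (eqToHom_comp_heq _ _))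
  -- The object parts of `F` and `G` agree only propositionally, so equality of arrows and cells
  -- must be stated with varying endpoints.
  have subtype_heq : ∀ {a b a' b' : E.Obj} (ha : a = a') (hb : b = b')
      (f : {f : a ⟶ b // E.HasCompanion f}) (g : {f : a' ⟶ b' // E.HasCompanion f}),
      HEq f.1 g.1 → HEq f g := by
    intro a b a' b' ha hb f g hfg
    subst ha hb
    exact heq_of_eq (Subtype.ext (eq_of_heq hfg))
  have qcell_heq : ∀ {x y w z x' y' w' z' : E.Obj} {h : x ⟶ y} {k : w ⟶ z} {h' : x' ⟶ y'}
      {k' : w' ⟶ z'} (α : QCell E h k) (α' : QCell E h' k'), x = x' → y = y' → w = w' → z = z' →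
      HEq h h' → HEq k k' → HEq α.left.1 α'.left.1 → HEq α.right.1 α'.right.1 →
      HEq α.cell α'.cell → HEq α α' := by
    intro x y w z x' y' w' z' h k h' k' α α' hx hy hw hz hh hk hl hr hc
    subst hx hy hw hz
    exact QCell.hext (eq_of_heq hh) (eq_of_heq hk) (Subtype.ext (eq_of_heq hl))
      (Subtype.ext (eq_of_heq hr)) (eq_of_heq hc)
  have H : F.compMap = G.compMap := CompDblFunctor.ext (DblFunctor.IsStrict.ext_of_rfl
    F.compDbl_isStrict G.compDbl_isStrict hobj
    (fun {a b} f => subtype_heq (h a) (h b) _ _ (hmap f.1)) (fun f => hmap f)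
    (fun {a b c d m n} α => qcell_heq _ _ (h a) (h b) (h c) (h d) (hmap m) (hmap n)
      (hmap (QCell.left α).1) (hmap (QCell.right α).1) (hspecial (QCell.cell α))))
  have app_heq : ∀ a, HEq (τ.app a) (𝟙 (F.obj a)) := fun a =>
    (heq_of_eq (e a)).trans (eqToHom_heq_id_dom _ _ (h a))
  refine ⟨H, ?_⟩
  refine (ProTrans.conj_ext (F := F.compMap) (F' := F.compMap) (G' := F.compMap) (G := G.compMap)
    rfl H _ (𝟙 F.compMap) ?_ ?_).trans (by simp)
  · exact app_heq
  · intro a b f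
    refine qcell_heq _ _ rfl (h a).symm rfl (h b).symm (app_heq a) (app_heq b) HEq.rfl
      (hmap f.1).symm ?_
    have unitCell_heq : ∀ {x y y' : E.Obj} (hy : y = y') (f : x ⟶ y) (g : x ⟶ y'), HEq f g →
        HEq (E.unitCell f) (E.unitCell g) := by
      intro x y y' hy f g hfg
      subst hy
      exact heq_of_eq (congrArg _ (eq_of_heq hfg))
    -- The component at `f` is the external identity on a composite that naturality rewrites as
    -- `F.map f.1` followed by a cast.
    refine unitCell_heq (h b).symm (τ.app a ≫ G.map f.1) (F.map f.1) ?_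
    exact (heq_of_eq (τ.naturality f.1).symm).trans
      ((heq_of_eq (congrArg (F.map f.1 ≫ ·) (e b))).trans (comp_eqToHom_heq _ (h b)))

end HasIdApp

/-! ### Assembly of the biadjunction. -/

namespace CompDblCat

open Bicategory DblCat

/-- The unit of the biadjunction. -/
def unitTrans : Pseudofunctor.StrongTrans (Pseudofunctor.id CompDblCat.{u, v})
    (transposeTwoFunctor.{u, v}.toPseudofunctor.comp compTwoFunctor.{u, v}.toPseudofunctor) where
  app C := C.unitMap
  naturality F := eqToIso (unitMap_naturality F)
  naturality_naturality {_ _ _ G} τ :=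
    (congrArg (· ≫ (eqToIso (unitMap_naturality G)).hom) (unitMap_whisker τ)).trans
      (IsEqToHom.conj_comp _ _ _)
  -- The unit is strictly natural and both 2-functors are strict, so the two coherence laws compare
  -- `eqToHom`s.
  naturality_id C :=
    ((IsEqToHom.eqToIso_hom _).comp ((IsEqToHom.comp_mapId transposeTwoFunctor.{u, v}
      compTwoFunctor.{u, v} C).whiskerLeft _)).eq
      (((IsEqToHom.id _).whiskerRight _).comp
        ((IsEqToHom.leftUnitor _).comp (IsEqToHom.rightUnitor
          (b := Comp (C.dbl.transpose C.strict)) C.unitMap).inv))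
  naturality_comp F G :=
    ((IsEqToHom.eqToIso_hom _).comp ((IsEqToHom.comp_mapComp transposeTwoFunctor.{u, v}
      compTwoFunctor.{u, v} F G).whiskerLeft _)).eq
      (((IsEqToHom.id _).whiskerRight _).comp ((IsEqToHom.associator _ _ _).comp
        (((IsEqToHom.eqToIso_hom _).whiskerLeft _).comp ((IsEqToHom.associator _ _ _).inv.comp
        (((IsEqToHom.eqToIso_hom _).whiskerRight _).comp (IsEqToHom.associator _ _ _))))))

variable (χ : ∀ (D : DblCat.{u, v}) {x y : D.Obj} (f : x ⟶ y), D.HasCompanion f → D.Companion f)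

theorem hasIdApp_counitNatIso {D E : DblCat.{u, v}} (F : DblFunctor D E) :
    HasIdApp (counitNatIso χ F).hom :=
  ⟨fun _ => rfl, fun _ => rfl⟩

theorem hasIdApp_leftTriangulator (C : CompDblCat.{u, v}) :
    HasIdApp (C.leftTriangulator (χ C.tr)).hom :=
  ⟨fun _ => rfl, fun _ => rfl⟩

/-- The counit of the biadjunction. -/
def counitTrans : Pseudofunctor.StrongTrans
    (compTwoFunctor.{u, v}.toPseudofunctor.comp transposeTwoFunctor.{u, v}.toPseudofunctor)
    (Pseudofunctor.id DblCat.{u, v}) where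
  app D := D.counitFunctor (χ D)
  naturality F := counitNatIso χ F
  -- The source is a transpose, so equality at objects suffices, and there the constraints are
  -- identities.
  naturality_naturality {D _ _ _} _ := trans_ext (C := Comp D) fun _ =>
    (Category.comp_id _).trans (Category.id_comp _).symm
  -- The counit constraint is not an `eqToHom` in general, because it compares companions at
  -- proarrows; only its components at objects are identities, whence `HasIdApp`.
  naturality_id D :=
    HasIdApp.eq (C := Comp D)
      ((hasIdApp_counitNatIso χ (𝟙 D)).comp ((IsEqToHom.id (𝟙 D)).whiskerLeft _).hasIdApp)
      (((IsEqToHom.comp_mapId compTwoFunctor.{u, v} transposeTwoFunctor.{u, v} D).whiskerRight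
        _).comp ((IsEqToHom.leftUnitor _).comp (IsEqToHom.rightUnitor _).inv)).hasIdApp
  naturality_comp {D _ _} F G :=
    HasIdApp.eq (C := Comp D)
      ((hasIdApp_counitNatIso χ (F ≫ G)).comp ((IsEqToHom.id (F ≫ G)).whiskerLeft _).hasIdApp)
      (HasIdApp.comp ((IsEqToHom.comp_mapComp compTwoFunctor.{u, v} transposeTwoFunctor.{u, v}
        F G).whiskerRight _).hasIdApp (HasIdApp.comp (IsEqToHom.associator _ _ _).hasIdApp
        (HasIdApp.comp ((hasIdApp_counitNatIso χ G).whiskerLeft _)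
        (HasIdApp.comp (IsEqToHom.associator _ _ _).inv.hasIdApp
        (HasIdApp.comp ((hasIdApp_counitNatIso χ F).whiskerRight _)
          (IsEqToHom.associator _ _ _).hasIdApp)))))

/-- The biadjunction between transposition and `Comp`. -/
def biadjunction : Biadjunction transposeTwoFunctor.{u, v}.toPseudofunctor
    compTwoFunctor.{u, v}.toPseudofunctor where
  unit := unitTrans
  counit := counitTrans χ
  left C := C.leftTriangulator (χ C.tr)
  right D := eqToIso (unitMap_comp_counit D (χ D))
  -- An equation between 2-cells out of the transpose of `C`: every factor has identity components
  -- at objects.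
  left_naturality {C D} F :=
    HasIdApp.eq (C := C)
      (HasIdApp.comp ((hasIdApp_leftTriangulator χ D).whiskerLeft _)
        (IsEqToHom.rightUnitor _).hasIdApp)
      (HasIdApp.comp (IsEqToHom.associator _ _ _).inv.hasIdApp
      (HasIdApp.comp (HasIdApp.whiskerRight
        (IsEqToHom.comp (IsEqToHom.mapComp transposeTwoFunctor _ _).inv
          (((IsEqToHom.eqToIso_hom (unitMap_naturality F)).map₂
            transposeTwoFunctor.toPseudofunctor).comp
          (IsEqToHom.mapComp transposeTwoFunctor _ _))).hasIdApp _)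
      (HasIdApp.comp (IsEqToHom.associator _ _ _).hasIdApp
      (HasIdApp.comp ((hasIdApp_counitNatIso χ _).whiskerLeft _)
      (HasIdApp.comp (IsEqToHom.associator _ _ _).inv.hasIdApp
      (HasIdApp.comp ((hasIdApp_leftTriangulator χ C).whiskerRight _)
        (IsEqToHom.leftUnitor _).hasIdApp))))))
  -- An equation between strict protransformations: the counit constraint enters through `Comp`,
  -- where `compTrans` makes it an `eqToHom`.
  right_naturality {C D} F :=
    IsEqToHom.eq
      (((IsEqToHom.eqToIso_hom (unitMap_comp_counit D (χ D))).whiskerLeft _).comp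
        (IsEqToHom.rightUnitor _))
      (IsEqToHom.comp (IsEqToHom.associator _ _ _).inv
      (IsEqToHom.comp ((IsEqToHom.eqToIso_hom (unitMap_naturality F.compMap)).whiskerRight _)
      (IsEqToHom.comp (IsEqToHom.associator _ _ _)
      (IsEqToHom.comp (IsEqToHom.whiskerLeft _
        (IsEqToHom.comp (IsEqToHom.mapComp compTwoFunctor _ _).inv
          (IsEqToHom.comp (hasIdApp_counitNatIso χ F).compTrans
          (IsEqToHom.mapComp compTwoFunctor _ _))))
      (IsEqToHom.comp (IsEqToHom.associator _ _ _).inv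
      (IsEqToHom.comp ((IsEqToHom.eqToIso_hom (unitMap_comp_counit C (χ C))).whiskerRight _)
        (IsEqToHom.leftUnitor _)))))))
  -- The left triangulator likewise enters through `Comp`; the other factors are strict constraints.
  swallowtail_left C :=
    IsEqToHom.eq
      (IsEqToHom.comp (IsEqToHom.whiskerLeft _
        (IsEqToHom.comp (IsEqToHom.mapComp compTwoFunctor _ _).inv
          (IsEqToHom.comp (hasIdApp_leftTriangulator χ C).compTrans
          (IsEqToHom.mapId compTwoFunctor _))))
        (IsEqToHom.rightUnitor _))
      (IsEqToHom.comp (IsEqToHom.associator _ _ _).inv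
      (IsEqToHom.comp ((IsEqToHom.eqToIso_hom (unitMap_naturality C.unitMap)).inv.whiskerRight _)
      (IsEqToHom.comp (IsEqToHom.associator _ _ _)
      (IsEqToHom.comp ((IsEqToHom.eqToIso_hom (unitMap_comp_counit C.tr (χ C.tr))).whiskerLeft _)
        (IsEqToHom.rightUnitor _)))))
  -- The 2-cells start at the transpose of `Comp D`, so identity components at objects again
  -- suffice.
  swallowtail_right D :=
    HasIdApp.eq (C := Comp D)
      (HasIdApp.comp (HasIdApp.whiskerRight
        (IsEqToHom.comp (IsEqToHom.mapComp transposeTwoFunctor _ _).inv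
          (((IsEqToHom.eqToIso_hom (unitMap_comp_counit D (χ D))).map₂
            transposeTwoFunctor.toPseudofunctor).comp
          (IsEqToHom.mapId transposeTwoFunctor _))).hasIdApp _)
        (IsEqToHom.leftUnitor _).hasIdApp)
      (HasIdApp.comp (IsEqToHom.associator _ _ _).hasIdApp
      (HasIdApp.comp ((hasIdApp_counitNatIso χ _).whiskerLeft _)
      (HasIdApp.comp (IsEqToHom.associator _ _ _).inv.hasIdApp
      (HasIdApp.comp ((hasIdApp_leftTriangulator χ (Comp D)).whiskerRight _)
        (IsEqToHom.leftUnitor _).hasIdApp))))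

end CompDblCat
end

theorem mainTheorem7
    (χ : ∀ (D : DblCat.{u, v}) {x y : D.Obj} (f : x ⟶ y), D.HasCompanion f → D.Companion f) :
    ∃ B : Biadjunction transposeTwoFunctor.{u, v}.toPseudofunctor
        compTwoFunctor.{u, v}.toPseudofunctor,
      ∀ D : DblCat.{u, v},
        let E : DblFunctor ((Comp D).dbl.transpose (Comp D).strict) D := B.counit.app D
        (∀ x : D.Obj, E.obj x = x) ∧
        (∀ {x y : D.Obj} (f : x ⟶ y), HEq (E.map f) f) ∧
        (∀ {x y : D.Obj} (h : {h : x ⟶ y // D.HasCompanion h}),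
          HEq (E.mapPro h) (χ D h.1 h.2).pro) := by
  -- The counit is `counitFunctor` of the given choice, which has the required values by definition.
  exact ⟨CompDblCat.biadjunction χ, fun _ => ⟨fun _ => rfl, fun _ => HEq.rfl, fun _ => HEq.rfl⟩⟩
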